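/- Let $n>2$ be a natural number, and let $G$ be a (finite or infinite) simple graph which is connected, is locally finite (every vertex has finite degree), has at least six vertices, and is $K_{1,n}$-free (no induced subgraph of $G$ is isomorphic to $K_{1,n}$). Then the distinguishing index $D'(G)$ of $G$ is at most $n-1$. Here $D'(G)$ is the least number of colours in a (not necessarily proper) edge colouring of $G$ for which the identity is the only automorphism of $G$ that preserves the colouring. -/

import Mathlib

namespace SimpleGraph

/-- `G` is `H`-free in the induced sense: no induced subgraph of `G` is isomorphic to `H`. -/
def IndFree {V W : Type*} (G : SimpleGraph V) (H : SimpleGraph W) : Prop :=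
  ¬ H.IsIndContained G

/-- The star `K_{1,n}`. -/
abbrev star (n : ℕ) : SimpleGraph (Fin 1 ⊕ Fin n) :=
  completeBipartiteGraph (Fin 1) (Fin n)

/-- The automorphism `φ` of `G` preserves the (not necessarily proper) edge colouring `c`. -/
def PreservesEdgeColouring {V K : Type*} {G : SimpleGraph V} (c : G.EdgeLabeling K)
    (φ : G ≃g G) : Prop :=
  ∀ e : G.edgeSet, c (φ.mapEdgeSet e) = c e

/-- An edge colouring is distinguishing if the identity is the only automorphism of the graph
that preserves it. -/
def IsDistinguishingEdgeColouring {V K : Type*} {G : SimpleGraph V}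
    (c : G.EdgeLabeling K) : Prop :=
  ∀ φ : G ≃g G, PreservesEdgeColouring c φ → φ = Iso.refl

/-- The distinguishing index `D'(G)`: the least number `k` of colours for which `G` has a
distinguishing edge colouring with colours in a `k`-element set; it is `⊤` if no finite number of
colours suffices. -/
noncomputable def distinguishingIndex {V : Type*} (G : SimpleGraph V) : ℕ∞ :=
  ⨅ (k : ℕ) (_ : ∃ c : G.EdgeLabeling (Fin k), IsDistinguishingEdgeColouring c), (k : ℕ∞)

end SimpleGraph

/-! Fix a root `r` of minimal degree and give every other vertex a parent one step nearer to `r`,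
chosen canonically from its set of nearer neighbours. Once all nearer levels are fixed by an
automorphism, parents are preserved. Hence an automorphism that fixes `r` and its neighbours is the
identity as soon as the children of each other vertex are coloured rigidly
(`eq_of_fixes_neighbors`). For `v ≠ r` the parent of `v` is adjacent to no child of `v`, so among
the children at most `n - 2` are pairwise nonadjacent, and they can be partitioned into at most `n -
2` paths. Colouring the edges from `v` to the starts of these paths with distinct positive colours,
the other edges to children with 0, and the path edges with 1 is rigid and uses only the colours `0,
…, n - 2` (`exists_isPathColouring`).

The root is made recognisable as the only vertex without an incident edge of colour 1. This leaves
the colours `2, …, n - 2` for marking starts of paths among its neighbours, that is `n - 3` marks,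
whereas up to `n - 1` paths may be needed. The paths without a mark must be told apart, and
oriented, by the edges one level further out. The invariants of a neighbour `x` of `r` are the
number of its neighbours at distance two, the number of its edges of colour 0 to them, and the
presence of an edge of colour 0 between them (`label`). For two neighbours of `r` of which the first
has a neighbour at distance two, the colours can be arranged so that these invariants differ
(`exists_isPair`), and all vertices other than `r` keep an edge of colour 1
(`IsFamily.exists_one_of_dist`, `IsFamily.exists_one_of_adj`). A suitable choice of paths and pairs
always exists (`exists_isLayout`) and yields the bound (`IsLayout.distinguishingIndex_le`).

Minimality of the degree of `r` is used repeatedly: a neighbour of `r` with no neighbour at distance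
two is adjacent to all other neighbours of `r`, and the obstruction to telling two neighbours apart
is a pair of adjacent twins of minimal degree. If such twins exist, one of them is taken as the
root, which removes the obstruction. Complete graphs, minimal degree one and 2-regular graphs are
coloured directly where this construction does not apply. -/

namespace SimpleGraph

/-! ### Symmetric colour functions, independence bounds and canonical parents -/

variable {V : Type*} {G : SimpleGraph V}

/-- The automorphism `φ` preserves the colouring of the edges of `G` given by `c`. -/
def Preserves (c : V → V → ℕ) (φ : G ≃g G) : Prop :=
  ∀ v w, G.Adj v w → c (φ v) (φ w) = c v w

theorem distinguishingIndex_le_of_colouring {k : ℕ} (c : V → V → ℕ)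
    (hc : ∀ v w, G.Adj v w → c v w = c w v) (hk : ∀ v w, G.Adj v w → c v w < k)
    (hφ : ∀ φ : G ≃g G, Preserves c φ → ∀ v, φ v = v) :
    G.distinguishingIndex ≤ (k : ℕ∞) := by
  refine iInf₂_le k ⟨EdgeLabeling.mk (fun v w h ↦ ⟨c v w, hk v w h⟩) ?_, ?_⟩
  · intro v w h
    simp [hc v w h]
  · intro φ h
    ext v
    refine hφ φ (fun v w hvw ↦ ?_) v
    exact congrArg Fin.val (h ⟨s(v, w), hvw⟩)

/-- Every independent set of vertices contained in `C` has at most `m` elements. -/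
def IndepBound (G : SimpleGraph V) (C : Set V) (m : ℕ) : Prop :=
  ∀ s : Finset V, ↑s ⊆ C → (∀ a ∈ s, ∀ b ∈ s, ¬ G.Adj a b) → s.card ≤ m

theorem IndepBound.mono {C D : Set V} {m : ℕ} (h : IndepBound G D m) (hCD : C ⊆ D) :
    IndepBound G C m := fun s hs ↦ h s (hs.trans hCD)

theorem IndFree.indepBound {n : ℕ} (h : G.IndFree (star n)) (hn : 0 < n) (v : V) :
    IndepBound G (G.neighborSet v) (n - 1) := by
  intro s hs hind
  by_contra hlt
  have hle : n ≤ s.card := by omega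
  obtain ⟨t, hts, htc⟩ := Finset.exists_subset_card_eq hle
  refine h ⟨?_⟩
  let e := t.equivFinOfCardEq htc
  have hmem : ∀ i, (e.symm i : V) ∈ s := fun i ↦ hts (e.symm i).2
  have hadj : ∀ i, G.Adj v (e.symm i : V) := fun i ↦ hs (hmem i)
  refine ⟨⟨Sum.elim (fun _ ↦ v) (fun i ↦ (e.symm i : V)), ?_⟩, ?_⟩
  · rintro (a | a) (b | b) hab
    · rw [Subsingleton.elim a b]
    · exact absurd hab (hadj b).ne
    · exact absurd hab (hadj a).ne'
    · simpa using hab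
  · rintro (a | a) (b | b)
    · exact iff_of_false G.irrefl (by simp)
    · exact iff_of_true (hadj b) (by simp)
    · exact iff_of_true (hadj a).symm (by simp)
    · exact iff_of_false (hind _ (hmem a) _ (hmem b)) (by simp)

theorem Iso.dist_eq {W : Type*} {H : SimpleGraph W} (φ : G ≃g H) (hG : G.Connected)
    (hH : H.Connected) (v w : V) : H.dist (φ v) (φ w) = G.dist v w := by
  apply le_antisymm
  · obtain ⟨p, hp⟩ := hG.exists_walk_length_eq_dist v w
    rw [← hp]
    simpa using dist_le (p.map φ.toHom)
  · obtain ⟨p, hp⟩ := hH.exists_walk_length_eq_dist (φ v) (φ w)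
    rw [← hp]
    have := dist_le (p.map φ.symm.toHom)
    simpa using this

/-- A choice of a parent, one step closer to the root `r`, for every vertex other than `r`,
depending only on the distance to the root and on the neighbours that are closer to it. -/
structure IsParent (G : SimpleGraph V) (r : V) (par : V → V) : Prop where
  adj : ∀ w, w ≠ r → G.Adj (par w) w
  dist : ∀ w, w ≠ r → G.dist r w = G.dist r (par w) + 1
  congr : ∀ w w', G.dist r w = G.dist r w' →
    (∀ v, G.dist r w = G.dist r v + 1 → (G.Adj v w ↔ G.Adj v w')) → par w = par w'

theorem Connected.exists_adj_dist (hG : G.Connected) {r w : V} (h : w ≠ r) :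
    ∃ v, G.Adj v w ∧ G.dist r w = G.dist r v + 1 := by
  obtain ⟨p, hp⟩ := hG.exists_walk_length_eq_dist w r
  cases p with
  | nil => exact absurd rfl h
  | cons hadj q =>
    rename_i v
    refine ⟨v, hadj.symm, ?_⟩
    have h1 := dist_le q
    have h2 := hadj.diff_dist_adj (u := r)
    simp only [Walk.length_cons] at hp
    rw [dist_comm] at hp h1
    omega

/-- The choice is made for the set of nearer neighbours and not for the vertex, so vertices with the
same set get the same parent. -/
theorem Connected.exists_isParent (hG : G.Connected) (r : V) : ∃ par, IsParent G r par := by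
  classical
  let up : V → Set V := fun w ↦ {v | G.Adj v w ∧ G.dist r w = G.dist r v + 1}
  let sel : Set V → V := fun S ↦ if h : S.Nonempty then h.some else r
  have hsel : ∀ w, w ≠ r → sel (up w) ∈ up w := by
    intro w hw
    have hne : (up w).Nonempty := hG.exists_adj_dist hw
    simp only [sel, dif_pos hne]
    exact hne.some_mem
  refine ⟨fun w ↦ sel (up w), fun w hw ↦ (hsel w hw).1, fun w hw ↦ (hsel w hw).2, ?_⟩
  intro w w' hd hv
  congr 1
  ext v
  simp only [up, Set.mem_ofPred_eq, ← hd]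
  constructor
  · rintro ⟨h1, h2⟩
    exact ⟨(hv v h2).1 h1, h2⟩
  · rintro ⟨h1, h2⟩
    exact ⟨(hv v h2).2 h1, h2⟩

/-! ### Rigid colourings of a finite set from a partition into paths -/

/-- The colours `g` of the vertices in `C` and `h` of the edges inside `C` are preserved by no
automorphism that maps `C` into itself and moves an element of `C`. -/
def RigidOn (G : SimpleGraph V) (C : Set V) (g : V → ℕ) (h : V → V → ℕ) : Prop :=
  ∀ φ : G ≃g G, (∀ x ∈ C, φ x ∈ C ∧ g (φ x) = g x) →
    (∀ x ∈ C, ∀ y ∈ C, G.Adj x y → h (φ x) (φ y) = h x y) → ∀ x ∈ C, φ x = x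

theorem rigidOn_of_injOn {C : Set V} {g : V → ℕ} (hg : Set.InjOn g C) (h : V → V → ℕ) :
    RigidOn G C g h := fun _ h1 _ x hx ↦ hg (h1 x hx).1 hx (h1 x hx).2

/-- A colouring of the vertices and edges inside `C` obtained from a partition of `C` into at most
`m` paths. The vertices with a positive colour are the first vertices of the paths. -/
structure IsPathColouring (G : SimpleGraph V) (C : Set V) (m : ℕ) (g : V → ℕ) (h : V → V → ℕ) :
    Prop where
  le : ∀ x, g x ≤ m
  inj : ∀ x ∈ C, ∀ y ∈ C, g x = g y → g x ≠ 0 → x = y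
  symm : ∀ x y, h x y = h y x
  le_one : ∀ x y, h x y ≤ 1
  -- `z` is the predecessor of `x` on its path. Other edges of colour 1 at `z` are harmless if they
  -- lead to a start of a path or to a vertex of smaller rank.
  next : ∃ rank : V → ℕ, ∀ x ∈ C, g x = 0 → ∃ z ∈ C, rank z < rank x ∧ G.Adj z x ∧ h z x = 1 ∧
    ∀ y ∈ C, G.Adj z y → h z y = 1 → g y = 0 → y = x ∨ rank y < rank x
  -- Not needed for rigidity; with `one` it keeps edges of colour 1 at the vertices other than the
  -- root.
  nbr : ∀ x ∈ C, ∀ y ∈ C, G.Adj x y → ∃ z ∈ C, G.Adj x z ∧ h x z = 1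
  one : C.Nonempty → ∃ x ∈ C, g x = 1

/-- Starts of paths are fixed by their colours. For the others, induct on the rank: the predecessor
of `x` is fixed, so `φ x` is `x` or has smaller rank. In the second case `φ x` is itself fixed, and
injectivity gives `φ x = x`. -/
theorem IsPathColouring.rigidOn {C : Set V} {m : ℕ} {g : V → ℕ} {h : V → V → ℕ}
    (H : IsPathColouring G C m g h) : RigidOn G C g h := by
  intro φ h1 h2
  obtain ⟨rank, hrank⟩ := H.next
  intro x
  induction hk : rank x using Nat.strong_induction_on generalizing x with
  | _ k ih =>
    intro hx
    by_cases hg : g x = 0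
    · obtain ⟨z, hz, hzx, hadj, hh, hy⟩ := hrank x hx hg
      have hφz := ih _ (hk ▸ hzx) z rfl hz
      have hadj' : G.Adj z (φ x) := by rw [← hφz]; exact φ.map_adj_iff.2 hadj
      have hh' : h z (φ x) = 1 := by
        have := h2 z hz x hx hadj
        rw [hφz, hh] at this
        exact this
      rcases hy (φ x) (h1 x hx).1 hadj' hh' ((h1 x hx).2.trans hg) with h | h
      · exact h
      · exact φ.injective (ih _ (hk ▸ h) (φ x) rfl (h1 x hx).1)
    · exact H.inj _ (h1 x hx).1 _ hx (h1 x hx).2 (by rwa [(h1 x hx).2])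

/-- Prepending neighbours must stop because `C` is finite. All neighbours in `C` of the final start
lie on the path, so deleting the path lowers the independence bound by one. -/
theorem exists_stuck_path [DecidableEq V] (C : Finset V) (a : V) (t : List V) (hnd : (a :: t).Nodup)
    (hC : ∀ x ∈ a :: t, x ∈ C) (hch : (a :: t).IsChain G.Adj) :
    ∃ b s, (b :: s).Nodup ∧ (∀ x ∈ b :: s, x ∈ C) ∧ (b :: s).IsChain G.Adj ∧
      ∀ y ∈ C, G.Adj b y → y ∈ b :: s := by
  induction hk : C.card - (a :: t).length using Nat.strong_induction_on generalizing a t with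
  | _ k ih =>
    by_cases hst : ∀ y ∈ C, G.Adj a y → y ∈ a :: t
    · exact ⟨a, t, hnd, hC, hch, hst⟩
    · push Not at hst
      obtain ⟨y, hyC, hay, hy⟩ := hst
      have hnd' : (y :: a :: t).Nodup := List.nodup_cons.2 ⟨hy, hnd⟩
      have hC' : ∀ x ∈ y :: a :: t, x ∈ C := by
        intro x hx
        rcases List.mem_cons.1 hx with rfl | hx
        · exact hyC
        · exact hC x hx
      have hlen : (y :: a :: t).length ≤ C.card := by
        rw [← List.toFinset_card_of_nodup hnd']
        exact Finset.card_le_card fun x hx ↦ hC' x (List.mem_toFinset.1 hx)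
      refine ih _ ?_ y (a :: t) hnd' hC' (List.isChain_cons_cons.2 ⟨hay.symm, hch⟩) rfl
      simp only [List.length_cons] at hk hlen ⊢
      omega

/-- Delete a stuck path with start `b`. An independent set of the remaining vertices stays
independent when `b` is added, so `m - 1` paths suffice for the rest. -/
theorem exists_isPathColouring (C : Finset V) (m : ℕ) (hα : IndepBound G ↑C m) :
    ∃ g h, IsPathColouring G ↑C m g h := by
  classical
  induction hk : C.card using Nat.strong_induction_on generalizing C m with
  | _ k ih =>
    rcases C.eq_empty_or_nonempty with rfl | ⟨a₀, ha₀⟩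
    · exact ⟨fun _ ↦ 0, fun _ _ ↦ 0, by constructor <;> simp⟩
    obtain ⟨b, s, hnd, hsub, hch, hst⟩ := exists_stuck_path (G := G) C a₀ [] (by simp)
      (by simpa using ha₀) (by simp)
    set l := b :: s with hl
    have hbl : b ∈ l := by simp [hl]
    set C' := C.filter (· ∉ l) with hC'
    have hmem' : ∀ x, x ∈ C' ↔ x ∈ C ∧ x ∉ l := fun x ↦ by simp [hC']
    have hm : 1 ≤ m := by simpa using hα {a₀} (by simpa using ha₀) (by simp)
    have hα' : IndepBound G ↑C' (m - 1) := by
      intro t ht hind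
      have hbt : b ∉ t := fun hb ↦ ((hmem' b).1 (ht hb)).2 hbl
      have hnb : ∀ y ∈ t, ¬ G.Adj b y := fun y hy hby ↦
        ((hmem' y).1 (ht hy)).2 (hst y ((hmem' y).1 (ht hy)).1 hby)
      have := hα (insert b t) (by
        intro x hx
        rcases Finset.mem_insert.1 (Finset.mem_coe.1 hx) with rfl | hx
        · exact hsub _ hbl
        · exact ((hmem' x).1 (ht hx)).1) (by
        intro x hx y hy
        rcases Finset.mem_insert.1 hx with hxb | hx <;> rcases Finset.mem_insert.1 hy with hyb | hy
        · rw [hxb, hyb]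
          exact G.irrefl
        · rw [hxb]
          exact hnb y hy
        · rw [hyb]
          exact fun h ↦ hnb x hx h.symm
        · exact hind x hx y hy)
      rw [Finset.card_insert_of_notMem hbt] at this
      omega
    have hlt : C'.card < k := by
      rw [← hk]
      exact Finset.card_lt_card ⟨Finset.filter_subset _ _,
        fun h ↦ ((hmem' b).1 (h (hsub b hbl))).2 hbl⟩
    obtain ⟨g', h', H'⟩ := ih _ hlt C' (m - 1) hα' rfl
    obtain ⟨rank', hrank'⟩ := H'.next
    let g : V → ℕ := fun x ↦ if x ∈ l then (if x = b then 1 else 0)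
      else if g' x = 0 then 0 else g' x + 1
    -- Edges between the new path and the starts of later paths also get colour 1. This serves `nbr`
    -- and does not disturb `next`, which ignores vertices of positive colour.
    let h : V → V → ℕ := fun x y ↦
      if x ∈ l then
        if y ∈ l then (if l.idxOf x + 1 = l.idxOf y ∨ l.idxOf y + 1 = l.idxOf x then 1 else 0)
        else if g' y = 0 then 0 else 1
      else if y ∈ l then (if g' x = 0 then 0 else 1) else h' x y
    let rank : V → ℕ := fun x ↦ if x ∈ l then l.idxOf x else rank' x + l.length
    have hb0 : l.idxOf b = 0 := by simp [hl]
    have hidx : ∀ x ∈ l, l.idxOf x < l.length := fun x hx ↦ List.idxOf_lt_length_of_mem hx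
    have hget : ∀ i (hi : i < l.length), l.idxOf l[i] = i := fun i hi ↦ hnd.idxOf_getElem i hi
    have hinj : ∀ x ∈ l, ∀ y ∈ l, l.idxOf x = l.idxOf y → x = y := by
      intro x hx y hy hxy
      have := List.getElem_idxOf (hidx x hx)
      rw [← this, ← List.getElem_idxOf (hidx y hy)]
      simp [hxy]
    have hadjl : ∀ i (hi : i + 1 < l.length), G.Adj (l[i]'(by omega)) l[i + 1] := fun i hi ↦
      List.isChain_iff_getElem.1 hch i hi
    refine ⟨g, h, ?_⟩
    constructor
    · intro x
      have := H'.le x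
      simp only [g]
      split_ifs <;> omega
    · intro x hx y hy hxy hx0
      simp only [g] at hxy hx0
      have hx' := (hmem' x)
      have hy' := (hmem' y)
      split_ifs at hxy hx0 <;> try omega
      · simp_all
      · exact H'.inj x (hx'.2 ⟨hx, ‹_›⟩) y (hy'.2 ⟨hy, ‹_›⟩) (by omega) ‹_›
    · intro x y
      have := H'.symm x y
      simp only [h]
      split_ifs <;> first | rfl | omega
    · intro x y
      have := H'.le_one x y
      simp only [h]
      split_ifs <;> omega
    · refine ⟨rank, fun x hx hgx ↦ ?_⟩
      by_cases hxl : x ∈ l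
      · have hxb : x ≠ b := by
          rintro rfl
          simp [g, hxl] at hgx
        have hpos : l.idxOf x ≠ 0 := fun h0 ↦ hxb (hinj x hxl b hbl (h0.trans hb0.symm))
        obtain ⟨i, hi⟩ := Nat.exists_eq_succ_of_ne_zero hpos
        have hix := hidx x hxl
        have hil : i + 1 < l.length := by omega
        have hxe : l[i + 1] = x := by
          rw [← List.getElem_idxOf hix]
          simp [hi]
        have hzl : l[i]'(by omega) ∈ l := List.getElem_mem _
        have hzi : l.idxOf (l[i]'(by omega)) = i := hget i (by omega)
        refine ⟨l[i]'(by omega), hsub _ hzl, ?_, ?_, ?_, ?_⟩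
        · simp only [rank, if_pos hzl, if_pos hxl]
          omega
        · have := hadjl i hil
          rwa [hxe] at this
        · simp only [h, if_pos hzl, if_pos hxl]
          rw [if_pos]
          omega
        · intro y hy hadj hh hgy
          by_cases hyl : y ∈ l
          · simp only [h, if_pos hzl, if_pos hyl] at hh
            split_ifs at hh with hcase
            rcases hcase with hc | hc
            · left
              exact hinj y hyl x hxl (by omega)
            · right
              simp only [rank, if_pos hyl, if_pos hxl]
              omega
          · simp only [h, if_pos hzl, if_neg hyl] at hh
            simp only [g, if_neg hyl] at hgy
            split_ifs at hh hgy
      · have hx' := (hmem' x).2 ⟨hx, hxl⟩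
        have hgx' : g' x = 0 := by
          simp only [g, if_neg hxl] at hgx
          split_ifs at hgx with h
          exact h
        obtain ⟨z, hz, hzx, hadj, hh, hy⟩ := hrank' x hx' hgx'
        have hzl := ((hmem' z).1 hz).2
        refine ⟨z, ((hmem' z).1 hz).1, ?_, hadj, ?_, ?_⟩
        · simp only [rank, if_neg hzl, if_neg hxl]
          omega
        · simpa only [h, if_neg hzl, if_neg hxl] using hh
        · intro y hyC hzy hhy hgy
          by_cases hyl : y ∈ l
          · right
            have := hidx y hyl
            simp only [rank, if_pos hyl, if_neg hxl]
            omega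
          · have hgy' : g' y = 0 := by
              simp only [g, if_neg hyl] at hgy
              split_ifs at hgy with h
              exact h
            simp only [h, if_neg hzl, if_neg hyl] at hhy
            simp only [rank, if_neg hxl, if_neg hyl]
            rcases hy y ((hmem' y).2 ⟨hyC, hyl⟩) hzy hhy hgy' with h | h
            · exact Or.inl h
            · right
              omega
    · intro x hx y hy hxy
      by_cases hxl : x ∈ l
      · have hix := hidx x hxl
        have hstep : ∀ j (hj : j < l.length), (j + 1 = l.idxOf x ∨ l.idxOf x + 1 = j) →
            ∃ z ∈ (↑C : Set V), G.Adj x z ∧ h x z = 1 := by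
          intro j hj hjx
          have hzl : l[j] ∈ l := List.getElem_mem _
          refine ⟨l[j], hsub _ hzl, ?_, ?_⟩
          · have hxe : l[l.idxOf x] = x := List.getElem_idxOf hix
            rcases hjx with hjx | hjx
            · have := hadjl j (by omega)
              simp only [hjx, hxe] at this
              exact this.symm
            · have := hadjl (l.idxOf x) (by omega)
              simp only [hjx, hxe] at this
              exact this
          · simp only [h, if_pos hzl, if_pos hxl, hget j hj]
            rw [if_pos (by omega)]
        by_cases h0 : l.idxOf x = 0
        · have hxb : x = b := hinj x hxl b hbl (h0.trans hb0.symm)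
          have hyl : y ∈ l := hst y hy (hxb ▸ hxy)
          have hiy := hidx y hyl
          have : l.idxOf y ≠ 0 := fun h ↦ hxy.ne (hinj x hxl y hyl (h0.trans h.symm))
          exact hstep 1 (by omega) (by omega)
        · exact hstep (l.idxOf x - 1) (by omega) (by omega)
      · have hx' := (hmem' x).2 ⟨hx, hxl⟩
        by_cases hnb : ∃ y ∈ C', G.Adj x y
        · obtain ⟨y', hy', hxy'⟩ := hnb
          obtain ⟨z, hz, hxz, hh⟩ := H'.nbr x hx' y' hy' hxy'
          refine ⟨z, ((hmem' z).1 hz).1, hxz, ?_⟩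
          simpa only [h, if_neg hxl, if_neg ((hmem' z).1 hz).2] using hh
        · have hyl : y ∈ l := by
            by_contra hyl
            exact hnb ⟨y, (hmem' y).2 ⟨hy, hyl⟩, hxy⟩
          refine ⟨y, hy, hxy, ?_⟩
          -- A vertex without neighbours in `C'` has no predecessor, so it is the start of its path
          -- and its edges to `l` have colour 1.
          have hg' : g' x ≠ 0 := by
            intro h0
            obtain ⟨z, hz, -, hadj, -⟩ := hrank' x hx' h0
            exact hnb ⟨z, hz, hadj.symm⟩
          simp [h, hxl, hyl, hg']
    · intro _
      exact ⟨b, hsub b hbl, by simp [g, hbl]⟩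

end SimpleGraph

/-! ### Colourings assembled along the parent map -/

namespace SimpleGraph

variable {V : Type*} {G : SimpleGraph V}

/-- The vertices whose parent is `v`. -/
def children (r : V) (par : V → V) (v : V) : Set V := {w | w ≠ r ∧ par w = v}

open Classical in
/-- The colouring of the edges given by the colour `g v w` of the edge from `v` to its child `w`,
the colour `h v x y` of the edge between the children `x`, `y` of `v`, and the colour `f v w` of all
other edges. -/
noncomputable def treeColouring (r : V) (par : V → V) (g : V → V → ℕ) (h : V → V → V → ℕ)
    (f : V → V → ℕ) (v w : V) : ℕ :=
  if w ≠ r ∧ par w = v then g v w else if v ≠ r ∧ par v = w then g w v else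
    if v ≠ r ∧ w ≠ r ∧ par v = par w then h (par v) v w else f v w

section treeColouring

variable {r : V} {par : V → V} {g : V → V → ℕ} {h : V → V → V → ℕ} {f : V → V → ℕ}

theorem IsParent.asymm (hp : IsParent G r par) {v w : V} (hv : v ≠ r) (hw : w ≠ r)
    (h1 : par v = w) : par w ≠ v := by
  intro h2
  have a := hp.dist v hv
  have b := hp.dist w hw
  rw [h1] at a
  rw [h2] at b
  omega

theorem IsParent.ne_of_sibling (hp : IsParent G r par) {v w : V} (hv : v ≠ r) (hw : w ≠ r)
    (h1 : par v = par w) : par v ≠ w := by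
  intro h2
  have a := hp.dist v hv
  have b := hp.dist w hw
  rw [h2] at a
  rw [← h1, h2] at b
  omega

theorem treeColouring_child {v w : V} (hw : w ∈ children r par v) :
    treeColouring r par g h f v w = g v w := if_pos hw

theorem treeColouring_sibling (hp : IsParent G r par) {u v w : V} (hv : v ∈ children r par u)
    (hw : w ∈ children r par u) : treeColouring r par g h f v w = h u v w := by
  have h1 : par v = par w := hv.2.trans hw.2.symm
  rw [treeColouring, if_neg fun h2 ↦ hp.ne_of_sibling hw.1 hv.1 h1.symm h2.2,
    if_neg fun h2 ↦ hp.ne_of_sibling hv.1 hw.1 h1 h2.2, if_pos ⟨hv.1, hw.1, h1⟩, hv.2]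

theorem treeColouring_free {v w : V} (h1 : w ∉ children r par v) (h2 : v ∉ children r par w)
    (h3 : v ≠ r → w ≠ r → par v ≠ par w) : treeColouring r par g h f v w = f v w := by
  rw [treeColouring, if_neg (show ¬ (w ≠ r ∧ par w = v) from h1),
    if_neg (show ¬ (v ≠ r ∧ par v = w) from h2), if_neg fun h4 ↦ h3 h4.1 h4.2.1 h4.2.2]

theorem treeColouring_comm (hp : IsParent G r par) (hh : ∀ u v w, h u v w = h u w v)
    (hf : ∀ v w, f v w = f w v) (v w : V) :
    treeColouring r par g h f v w = treeColouring r par g h f w v := by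
  unfold treeColouring
  by_cases h1 : w ≠ r ∧ par w = v
  · rw [if_pos h1]
    rcases eq_or_ne v r with hv | hv
    · rw [if_neg fun h2 ↦ h2.1 hv, if_pos h1]
    · rw [if_neg fun h2 ↦ hp.asymm h1.1 hv h1.2 h2.2, if_pos h1]
  · rw [if_neg h1]
    by_cases h2 : v ≠ r ∧ par v = w
    · rw [if_pos h2, if_pos h2]
    · rw [if_neg h2, if_neg h2, if_neg h1]
      by_cases h3 : v ≠ r ∧ w ≠ r ∧ par v = par w
      · rw [if_pos h3, if_pos ⟨h3.2.1, h3.1, h3.2.2.symm⟩, hh, h3.2.2]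
      · rw [if_neg h3, if_neg fun h4 ↦ h3 ⟨h4.2.1, h4.1, h4.2.2.symm⟩, hf]

theorem mem_children_root (hG : G.Connected) (hp : IsParent G r par) {x : V} :
    x ∈ children r par r ↔ G.Adj r x := by
  constructor
  · rintro ⟨h1, h2⟩
    have := hp.adj x h1
    rwa [h2] at this
  · intro hx
    refine ⟨hx.ne', ?_⟩
    have h1 := hp.dist x hx.ne'
    rw [dist_eq_one_iff_adj.2 hx] at h1
    exact (hG.dist_eq_zero_iff.1 (by omega)).symm

/-- Induction on the distance to `r`. If the nearer levels are fixed, a vertex and its image have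
the same nearer neighbours and hence the same parent, so `φ` permutes siblings and rigidity applies.
The level of the neighbours of `r` is supplied by `hX`, since the children of `r` are not assumed to
be coloured rigidly. -/
theorem eq_of_fixes_neighbors (hG : G.Connected) (hp : IsParent G r par) (φ : G ≃g G)
    (hφ : Preserves (treeColouring r par g h f) φ) (hr : φ r = r)
    (hX : ∀ x, G.Adj r x → φ x = x)
    (hrig : ∀ v, v ≠ r → RigidOn G (children r par v) (g v) (h v)) : ∀ v, φ v = v := by
  have hdist : ∀ v, G.dist r (φ v) = G.dist r v := fun v ↦ by
    conv_lhs => rw [← hr]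
    exact φ.dist_eq hG hG r v
  suffices H : ∀ k, ∀ v, G.dist r v ≤ k → φ v = v from fun v ↦ H _ v le_rfl
  intro k
  induction k with
  | zero =>
    intro v hv
    rw [← hG.dist_eq_zero_iff.1 (Nat.le_zero.1 hv), hr]
  | succ k ih =>
    intro w hw
    rcases Nat.lt_or_ge (G.dist r w) (k + 1) with hlt | hge
    · exact ih w (by omega)
    have hwr : w ≠ r := by
      rintro rfl
      simp at hge
    have hd := hp.dist w hwr
    rcases eq_or_ne (par w) r with hpr | hpr
    · have := hp.adj w hwr
      rw [hpr] at this
      exact hX w this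
    have hpar : ∀ x, G.dist r x = k + 1 → par (φ x) = par x := by
      intro x hx
      refine (hp.congr x (φ x) (hdist x).symm fun v hv ↦ ?_).symm
      have : φ v = v := ih v (by omega)
      conv_rhs => rw [← this]
      exact φ.map_adj_iff.symm
    have hne : ∀ x, x ≠ r → φ x ≠ r := fun x hx h0 ↦ hx (φ.injective (h0.trans hr.symm))
    have hlev : ∀ x ∈ children r par (par w), G.dist r x = k + 1 := by
      intro x hx
      have := hp.dist x hx.1
      rw [hx.2] at this
      omega
    have hmem : ∀ x ∈ children r par (par w), φ x ∈ children r par (par w) := fun x hx ↦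
      ⟨hne x hx.1, (hpar x (hlev x hx)).trans hx.2⟩
    have hpw : φ (par w) = par w := ih _ (by omega)
    refine hrig (par w) hpr φ (fun x hx ↦ ⟨hmem x hx, ?_⟩) ?_ w ⟨hwr, rfl⟩
    · have hadj := hp.adj x hx.1
      rw [hx.2] at hadj
      have := hφ _ _ hadj
      rwa [hpw, treeColouring_child (hmem x hx), treeColouring_child hx] at this
    · intro x hx y hy hxy
      have := hφ _ _ hxy
      rwa [treeColouring_sibling hp (hmem x hx) (hmem y hy), treeColouring_sibling hp hx hy] at this

theorem IsParent.adj_of_mem (hp : IsParent G r par) {v w : V} (hw : w ∈ children r par v) :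
    G.Adj v w := by
  have := hp.adj w hw.1
  rwa [hw.2] at this

theorem IsParent.dist_of_mem (hp : IsParent G r par) {v w : V} (hw : w ∈ children r par v) :
    G.dist r w = G.dist r v + 1 := by
  have := hp.dist w hw.1
  rwa [hw.2] at this

theorem IsParent.finite_children [G.LocallyFinite] (hp : IsParent G r par) (v : V) :
    (children r par v).Finite :=
  (Set.toFinite (G.neighborSet v)).subset fun _ hw ↦ hp.adj_of_mem hw

theorem Connected.dist_le_of_adj (hG : G.Connected) (r : V) {v w : V} (h : G.Adj v w) :
    G.dist r w ≤ G.dist r v + 1 := by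
  have h1 := hG.dist_triangle (u := r) (v := v) (w := w)
  rw [dist_eq_one_iff_adj.2 h] at h1
  exact h1

/-- The parent of `v` is two levels nearer than the vertices in `C`, so it can be added to any
independent subset of `C` among the neighbours of `v`. -/
theorem IsParent.indepBound_children {n : ℕ} (hp : IsParent G r par) (hG : G.Connected)
    (hfree : G.IndFree (star n)) (hn : 2 < n) {v : V} (hv : v ≠ r) {C : Set V}
    (hC : ∀ w ∈ C, G.Adj v w ∧ G.dist r w = G.dist r v + 1) : IndepBound G C (n - 2) := by
  classical
  intro s hs hind
  have hd := hp.dist v hv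
  have hnadj : ∀ w ∈ s, ¬ G.Adj (par v) w := fun w hw hadj ↦ by
    have h1 := (hC w (hs hw)).2
    have h2 := hG.dist_le_of_adj r hadj
    omega
  have hnot : par v ∉ s := fun hmem ↦ by
    have := (hC _ (hs hmem)).2
    omega
  have := hfree.indepBound (by omega) v (insert (par v) s) (by
    intro x hx
    rcases Finset.mem_insert.1 (Finset.mem_coe.1 hx) with rfl | hx
    · exact (hp.adj v hv).symm
    · exact (hC x (hs hx)).1) (by
    intro a ha b hb
    rcases Finset.mem_insert.1 ha with ha' | ha <;> rcases Finset.mem_insert.1 hb with hb' | hb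
    · rw [ha', hb']
      exact G.irrefl
    · rw [ha']
      exact hnadj b hb
    · rw [hb']
      exact fun h ↦ hnadj a ha h.symm
    · exact hind a ha b hb)
  rw [Finset.card_insert_of_notMem hnot] at this
  omega

theorem IsParent.exists_isPathColouring [G.LocallyFinite] {n : ℕ} (hp : IsParent G r par)
    (hG : G.Connected) (hfree : G.IndFree (star n)) (hn : 2 < n) {v : V} (hv : v ≠ r) :
    ∃ g h, IsPathColouring G (children r par v) (n - 2) g h := by
  have hfin := hp.finite_children v
  have := SimpleGraph.exists_isPathColouring (G := G) hfin.toFinset (n - 2) (by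
    rw [hfin.coe_toFinset]
    exact hp.indepBound_children hG hfree hn hv fun w hw ↦ ⟨hp.adj_of_mem hw, hp.dist_of_mem hw⟩)
  rwa [hfin.coe_toFinset] at this

end treeColouring

/-! ### Configurations at the neighbours of the root -/

/-- The neighbours of `x` at distance two from the root. -/
def upper (G : SimpleGraph V) (r x : V) : Set V := {c | G.Adj x c ∧ G.dist r c = 2}

/-- The colours of the edges from a vertex to its children (`g`) and between its children (`h`), and
the other neighbours of the vertex that are joined to it by an edge of colour zero (`fl`). -/
structure Config (V : Type*) where
  g : V → ℕ
  h : V → V → ℕ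
  fl : Set V

/-- A configuration at a neighbour `x` of the root that can be used in the main construction. -/
structure Config.Good (κ : Config V) (G : SimpleGraph V) (r : V) (par : V → V) (n : ℕ) (x : V) :
    Prop where
  rigid : RigidOn G (children r par x) κ.g κ.h
  lt : ∀ y, κ.g y < n - 1
  symm : ∀ y z, κ.h y z = κ.h z y
  le_one : ∀ y z, κ.h y z ≤ 1
  fl_sub : κ.fl ⊆ upper G r x \ children r par x
  -- Each alternative leads to an edge of colour 1 at `c`. Edges between vertices at distance at
  -- least two are never flagged. In the last case minimality of the degree gives `c` the same
  -- neighbours as `r`.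
  one : ∀ c ∈ children r par x, κ.g c = 1 ∨ (∃ c' ∈ children r par x, G.Adj c c' ∧ κ.h c c' = 1) ∨
    (∃ c' ∉ children r par x, G.Adj c c' ∧ 2 ≤ G.dist r c') ∨ ∀ c', G.Adj c c' → G.Adj r c'
  -- An edge of colour 1 at `x` itself, for use when `x` forms a path alone. With only one vertex at
  -- distance two, its edge may have to receive colour 0.
  big : 2 ≤ (upper G r x).ncard →
    (∃ c ∈ children r par x, κ.g c = 1) ∨ ∃ c ∈ upper G r x \ children r par x, c ∉ κ.fl

/-- The vertices at distance two from the root joined to `x` by an edge of colour zero. -/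
def Config.zeros (κ : Config V) (r : V) (par : V → V) (x : V) : Set V :=
  {c | c ∈ children r par x ∧ κ.g c = 0} ∪ κ.fl

/-- The configurations at `u` and `w` cannot be exchanged by an automorphism. -/
def Config.Distinct (κ κ' : Config V) (G : SimpleGraph V) (r : V) (par : V → V) (u w : V) : Prop :=
  (upper G r u).ncard ≠ (upper G r w).ncard ∨
  (κ.zeros r par u).ncard ≠ (κ'.zeros r par w).ncard ∨
  (upper G r u = children r par u ∧ upper G r w = children r par w ∧
    (∀ c ∈ children r par u, ∀ c' ∈ children r par u, G.Adj c c' → κ.h c c' ≠ 0) ∧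
    ∃ c ∈ children r par w, ∃ c' ∈ children r par w, G.Adj c c' ∧ κ'.h c c' = 0)

end SimpleGraph

/-! ### Telling two neighbours of the root apart -/

namespace SimpleGraph

variable {V : Type*} {G : SimpleGraph V} {r : V} {par : V → V} {n : ℕ}

theorem exists_enumeration {C : Set V} (hC : C.Finite) :
    ∃ e : V → ℕ, Set.InjOn e C ∧ (∀ c ∈ C, e c < C.ncard) ∧ ∀ i < C.ncard, ∃ c ∈ C, e c = i := by
  classical
  have hcard : hC.toFinset.card = C.ncard := (Set.ncard_eq_toFinset_card C hC).symm
  let E := hC.toFinset.equivFinOfCardEq hcard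
  refine ⟨fun c ↦ if h : c ∈ hC.toFinset then E ⟨c, h⟩ else 0, ?_, ?_, ?_⟩
  · intro x hx y hy hxy
    have hx' := hC.mem_toFinset.2 hx
    have hy' := hC.mem_toFinset.2 hy
    simp only [dif_pos hx', dif_pos hy'] at hxy
    simpa using E.injective (Fin.ext hxy)
  · intro c hc
    simp only [dif_pos (hC.mem_toFinset.2 hc)]
    exact (E _).2
  · intro i hi
    refine ⟨E.symm ⟨i, hi⟩, hC.mem_toFinset.1 (E.symm ⟨i, hi⟩).2, ?_⟩
    simp

theorem exists_enumeration_one {C : Set V} (hC : C.Finite) {a : V} (ha : a ∈ C)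
    (h2 : 2 ≤ C.ncard) : ∃ e : V → ℕ, Set.InjOn e C ∧ (∀ c ∈ C, e c < C.ncard) ∧ e a = 1 := by
  obtain ⟨e, he1, he2, -⟩ := exists_enumeration hC
  refine ⟨fun c ↦ Equiv.swap (e a) 1 (e c), fun x hx y hy hxy ↦ he1 hx hy
    ((Equiv.swap (e a) 1).injective hxy), fun c hc ↦ ?_, by simp⟩
  have h3 := he2 a ha
  have h4 := he2 c hc
  simp only [Equiv.swap_apply_def]
  split_ifs <;> omega

theorem children_subset_upper (hp : IsParent G r par) {x : V} (hx : G.Adj r x) :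
    children r par x ⊆ upper G r x := fun _ hc ↦
  ⟨hp.adj_of_mem hc, by rw [hp.dist_of_mem hc, dist_eq_one_iff_adj.2 hx]⟩

theorem adj_root_or_two_le_dist (hG : G.Connected) {c c' : V} (hc : G.dist r c = 2)
    (h : G.Adj c c') : G.Adj r c' ∨ 2 ≤ G.dist r c' := by
  have := hG.dist_le_of_adj r h.symm
  rcases Nat.lt_or_ge (G.dist r c') 2 with h1 | h1
  · left
    exact dist_eq_one_iff_adj.1 (by omega)
  · exact Or.inr h1

theorem children_trichotomy (hG : G.Connected) (hp : IsParent G r par) {x c : V}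
    (hx : G.Adj r x) (hc : c ∈ children r par x) : (∃ c' ∈ children r par x, G.Adj c c') ∨
      (∃ c' ∉ children r par x, G.Adj c c' ∧ 2 ≤ G.dist r c') ∨
      ∀ c', G.Adj c c' → G.Adj r c' := by
  by_cases h1 : ∃ c' ∈ children r par x, G.Adj c c'
  · exact Or.inl h1
  by_cases h2 : ∃ c', G.Adj c c' ∧ 2 ≤ G.dist r c'
  · obtain ⟨c', h3, h4⟩ := h2
    exact Or.inr (Or.inl ⟨c', fun h ↦ h1 ⟨c', h, h3⟩, h3, h4⟩)
  · exact Or.inr (Or.inr fun c' h ↦ (adj_root_or_two_le_dist hG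
      (children_subset_upper hp hx hc).2 h).resolve_right fun h' ↦ h2 ⟨c', h, h'⟩)

theorem big_of_one {x : V} {g : V → ℕ} {fl : Set V} (hs : fl.Subsingleton)
    (h1 : (children r par x).Nonempty → ∃ c ∈ children r par x, g c = 1)
    (h2 : 2 ≤ (upper G r x).ncard) :
    (∃ c ∈ children r par x, g c = 1) ∨ ∃ c ∈ upper G r x \ children r par x, c ∉ fl := by
  by_cases hne : (children r par x).Nonempty
  · exact Or.inl (h1 hne)
  · right
    rw [Set.not_nonempty_iff_eq_empty] at hne
    rw [hne, Set.sdiff_empty]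
    obtain ⟨a, ha, b, hb, hab⟩ := (Set.one_lt_ncard (Set.finite_of_ncard_pos (by omega))).1 h2
    by_cases haf : a ∈ fl
    · exact ⟨b, hb, fun hbf ↦ hab (hs haf hbf)⟩
    · exact ⟨a, ha, haf⟩

theorem Config.good_of_nbr (hG : G.Connected) (hp : IsParent G r par) {x : V} (hx : G.Adj r x)
    {κ : Config V} (rigid : RigidOn G (children r par x) κ.g κ.h) (lt : ∀ y, κ.g y < n - 1)
    (symm : ∀ y z, κ.h y z = κ.h z y) (le_one : ∀ y z, κ.h y z ≤ 1)
    (fl_sub : κ.fl ⊆ upper G r x \ children r par x)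
    (nbr : ∀ c ∈ children r par x, ∀ c' ∈ children r par x, G.Adj c c' →
      ∃ z ∈ children r par x, G.Adj c z ∧ κ.h c z = 1)
    (big : 2 ≤ (upper G r x).ncard →
      (∃ c ∈ children r par x, κ.g c = 1) ∨ ∃ c ∈ upper G r x \ children r par x, c ∉ κ.fl) :
    κ.Good G r par n x := by
  refine ⟨rigid, lt, symm, le_one, fl_sub, fun c hc ↦ ?_, big⟩
  rcases children_trichotomy hG hp hx hc with ⟨c', h1, h2⟩ | h | h
  · exact Or.inr (Or.inl (nbr c hc c' h1 h2))
  · exact Or.inr (Or.inr (Or.inl h))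
  · exact Or.inr (Or.inr (Or.inr h))

theorem IsPathColouring.good (hG : G.Connected) (hp : IsParent G r par) (hn : 2 < n) {x : V}
    (hx : G.Adj r x) {g : V → ℕ} {h : V → V → ℕ}
    (H : IsPathColouring G (children r par x) (n - 2) g h) {fl : Set V}
    (fl_sub : fl ⊆ upper G r x \ children r par x) (fl_sing : fl.Subsingleton) :
    (Config.mk g h fl).Good G r par n x :=
  Config.good_of_nbr hG hp hx H.rigidOn (fun y ↦ by have := H.le y; simp only; omega) H.symm
    H.le_one fl_sub H.nbr (big_of_one fl_sing H.one)

theorem RigidOn.comp {C : Set V} {g : V → ℕ} {h : V → V → ℕ} (H : RigidOn G C g h) {σ : ℕ → ℕ}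
    (hσ : Function.Injective σ) : RigidOn G C (fun x ↦ σ (g x)) h := fun φ h1 h2 ↦
  H φ (fun x hx ↦ ⟨(h1 x hx).1, hσ (h1 x hx).2⟩) h2

/-- Positive colours do not repeat on `C`, so at most `m` vertices have one. -/
theorem IsPathColouring.two_le_ncard_zero {C : Set V} (hC : C.Finite) {m : ℕ} {g : V → ℕ}
    {h : V → V → ℕ} (H : IsPathColouring G C m g h) (hm : m + 2 ≤ C.ncard) :
    2 ≤ {c | c ∈ C ∧ g c = 0}.ncard := by
  have h1 : C ⊆ {c | c ∈ C ∧ g c = 0} ∪ {c | c ∈ C ∧ g c ≠ 0} := by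
    intro c hc
    by_cases h0 : g c = 0
    · exact Or.inl ⟨hc, h0⟩
    · exact Or.inr ⟨hc, h0⟩
  have hf1 : {c | c ∈ C ∧ g c = 0}.Finite := hC.subset fun c hc ↦ hc.1
  have hf2 : {c | c ∈ C ∧ g c ≠ 0}.Finite := hC.subset fun c hc ↦ hc.1
  have h2 : {c | c ∈ C ∧ g c ≠ 0}.ncard ≤ m := by
    have := Set.ncard_le_ncard_of_injOn (s := {c | c ∈ C ∧ g c ≠ 0}) (t := ↑(Finset.Icc 1 m)) g
      (fun c hc ↦ by
        have h3 := H.le c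
        have h4 := hc.2
        simp only [Finset.coe_Icc, Set.mem_Icc]
        omega)
      (fun c hc c' hc' hcc ↦ H.inj c hc.1 c' hc'.1 hcc hc.2) (Finset.finite_toSet _)
    rwa [Set.ncard_coe_finset, Nat.card_Icc, Nat.add_sub_cancel] at this
  have h3 := Set.ncard_le_ncard h1 (hf1.union hf2)
  have h4 := Set.ncard_union_le {c | c ∈ C ∧ g c = 0} {c | c ∈ C ∧ g c ≠ 0}
  omega

/-- Configurations at two neighbours `u`, `w` of the root that tell `u` and `w` apart. -/
structure Config.IsPair (κ κ' : Config V) (G : SimpleGraph V) (r : V) (par : V → V) (n : ℕ)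
    (u w : V) : Prop where
  left : κ.Good G r par n u
  right : κ'.Good G r par n w
  distinct : κ.Distinct κ' G r par u w
  -- The last three conditions protect a vertex at distance two with the same neighbours as `r`,
  -- whose edges of colour 1 might otherwise all be lost to flags.
  fl : κ.fl = ∅ ∨ κ'.fl = ∅
  one_right : κ.fl.Nonempty → (children r par w).Nonempty → ∃ c ∈ children r par w, κ'.g c = 1
  one_left : κ'.fl.Nonempty → (children r par u).Nonempty → ∃ c ∈ children r par u, κ.g c = 1

variable [G.LocallyFinite]

theorem finite_upper (x : V) : (upper G r x).Finite :=
  (Set.toFinite (G.neighborSet x)).subset fun _ hc ↦ hc.1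

/-- Flagging `c` raises the number of zero edges by one, so one of the two choices avoids `k`. -/
theorem exists_flag_ncard_ne (hp : IsParent G r par) {u c : V} (g : V → ℕ) (h : V → V → ℕ)
    (hc : c ∈ upper G r u \ children r par u) (k : ℕ) :
    ∃ fl : Set V, (fl = ∅ ∨ fl = {c}) ∧ ((Config.mk g h fl).zeros r par u).ncard ≠ k := by
  by_cases hk : ((Config.mk g h ∅).zeros r par u).ncard = k
  · refine ⟨{c}, Or.inr rfl, ?_⟩
    rw [← hk]
    have : (Config.mk g h {c}).zeros r par u = insert c ((Config.mk g h ∅).zeros r par u) := by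
      simp [Config.zeros]
    have hnot : c ∉ (Config.mk g h ∅).zeros r par u := by
      rintro (hmem | hmem)
      · exact hc.2 hmem.1
      · exact hmem
    have hfin : ((Config.mk g h ∅).zeros r par u).Finite := by
      refine (hp.finite_children u).subset ?_
      rintro y (hy | hy)
      · exact hy.1
      · exact absurd hy (Set.notMem_empty y)
    rw [this, Set.ncard_insert_of_notMem hnot hfin]
    omega
  · exact ⟨∅, Or.inl rfl, hk⟩

/-- The edge from `u` to the non-child `c` plays no role in rigidity, so its colour is free to
adjust the number of zero edges at `u`. Both orders are recorded because the free vertex may belong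
to the second member of a pair. -/
theorem exists_isPair_of_free (hn : 2 < n) (hG : G.Connected) (hfree : G.IndFree (star n))
    (hp : IsParent G r par) {u w c : V} (hu : G.Adj r u) (hw : G.Adj r w)
    (hc : c ∈ upper G r u \ children r par u) :
    ∃ κ κ' : Config V, κ.IsPair κ' G r par n u w ∧ κ'.IsPair κ G r par n w u := by
  obtain ⟨g, h, H⟩ := hp.exists_isPathColouring hG hfree hn hu.ne'
  obtain ⟨g', h', H'⟩ := hp.exists_isPathColouring hG hfree hn hw.ne'
  obtain ⟨fl, hfl, hne⟩ := exists_flag_ncard_ne hp g h hc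
    ((Config.mk g' h' ∅).zeros r par w).ncard
  have hsub : fl ⊆ upper G r u \ children r par u := by
    rcases hfl with rfl | rfl
    · exact Set.empty_subset _
    · exact Set.singleton_subset_iff.2 hc
  have hsing : fl.Subsingleton := by
    rcases hfl with rfl | rfl
    · exact Set.subsingleton_empty
    · exact Set.subsingleton_singleton
  have h1 := H.good hG hp hn hu hsub hsing
  have h2 := H'.good hG hp hn hw (Set.empty_subset _) Set.subsingleton_empty
  exact ⟨⟨g, h, fl⟩, ⟨g', h', ∅⟩,
    ⟨h1, h2, Or.inr (Or.inl hne), Or.inr rfl, fun _ ↦ H'.one, fun h ↦ absurd rfl h.ne_empty⟩,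
    ⟨h2, h1, Or.inr (Or.inl hne.symm), Or.inl rfl, fun h ↦ absurd rfl h.ne_empty, fun _ ↦ H'.one⟩⟩

/-- Since `a` is not adjacent to `u`, failure for both vertices forces, by minimality of the degree
of `r`, that the neighbours of `a` are `b` and those of `r` except `u`, and likewise for `b`. Then
`a` and `b` are adjacent twins of minimal degree. In the other case of `htw`, the vertex `t` would
be adjacent to `a`, which is at distance two. -/
theorem exists_not_bad (hp : IsParent G r par)
    (hmin : ∀ v, G.degree r ≤ G.degree v)
    (htw : (∃ t, G.Adj r t ∧ upper G r t = ∅) ∨ ∀ a b, G.Adj a b → G.degree a = G.degree r →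
      ¬ ∀ c, c ≠ a → c ≠ b → (G.Adj a c ↔ G.Adj b c))
    {u w a b : V} (hu : G.Adj r u) (hw : G.Adj r w) (huw : u ≠ w) (hune : (upper G r u).Nonempty)
    (hue : upper G r u = children r par u) (ha : a ∈ children r par w)
    (hb : b ∈ children r par w) (hab : G.Adj a b) :
    (∃ c, G.Adj b c ∧ c ≠ a ∧ ¬ G.Adj r c) ∨ ∃ c, G.Adj a c ∧ c ≠ b ∧ ¬ G.Adj r c := by
  classical
  by_contra! hcon
  obtain ⟨hbadb, hbada⟩ := hcon
  have key : ∀ a b, a ∈ children r par w → (∀ c, G.Adj a c → c ≠ b → G.Adj r c) →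
      G.degree a = G.degree r ∧ ∀ c, G.Adj a c ↔ c = b ∨ c ≠ u ∧ G.Adj r c := by
    intro a b ha hbad
    have hua : ¬ G.Adj u a := fun h ↦ by
      have : a ∈ upper G r u := ⟨h, (children_subset_upper hp hw ha).2⟩
      rw [hue] at this
      exact huw (this.2.symm.trans ha.2)
    have hsub : G.neighborFinset a ⊆ insert b ((G.neighborFinset r).erase u) := by
      intro c hc
      rw [mem_neighborFinset] at hc
      rw [Finset.mem_insert, Finset.mem_erase, mem_neighborFinset]
      by_cases hcb : c = b
      · exact Or.inl hcb
      · refine Or.inr ⟨?_, hbad c hc hcb⟩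
        rintro rfl
        exact hua hc.symm
    have hcard : (insert b ((G.neighborFinset r).erase u)).card ≤ G.degree r := by
      refine (Finset.card_insert_le _ _).trans ?_
      rw [Finset.card_erase_of_mem (by simpa using hu), card_neighborFinset_eq_degree]
      have : 0 < G.degree r := (G.degree_pos_iff_exists_adj r).2 ⟨u, hu⟩
      omega
    have heq := Finset.eq_of_subset_of_card_le hsub (by
      rw [card_neighborFinset_eq_degree]
      exact hcard.trans (hmin a))
    refine ⟨le_antisymm ?_ (hmin a), fun c ↦ ?_⟩
    · rw [← card_neighborFinset_eq_degree, heq]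
      exact hcard
    · rw [← mem_neighborFinset, heq, Finset.mem_insert, Finset.mem_erase, mem_neighborFinset]
  have hA := key a b ha hbada
  have hB := key b a hb hbadb
  rcases htw with ⟨t, ht, hte⟩ | htw
  · have htu : t ≠ u := by
      rintro rfl
      exact hune.ne_empty hte
    have : a ∈ upper G r t :=
      ⟨((hA.2 t).2 (Or.inr ⟨htu, ht⟩)).symm, (children_subset_upper hp hw ha).2⟩
    rw [hte] at this
    exact this
  · refine htw a b hab hA.1 fun c hca hcb ↦ ?_
    rw [hA.2, hB.2]
    simp [hca, hcb]

theorem exists_isPair_of_children (hn : 2 < n) (hG : G.Connected) (hfree : G.IndFree (star n))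
    (hp : IsParent G r par) (hmin : ∀ v, G.degree r ≤ G.degree v)
    (htw : (∃ t, G.Adj r t ∧ upper G r t = ∅) ∨ ∀ a b, G.Adj a b → G.degree a = G.degree r →
      ¬ ∀ c, c ≠ a → c ≠ b → (G.Adj a c ↔ G.Adj b c))
    {u w : V} (hu : G.Adj r u) (hw : G.Adj r w) (huw : u ≠ w) (hune : (upper G r u).Nonempty)
    (hue : upper G r u = children r par u) (hwe : upper G r w = children r par w)
    (hcard : (upper G r u).ncard = (upper G r w).ncard) :
    ∃ κ κ' : Config V, κ.IsPair κ' G r par n u w := by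
  classical
  have hfu := hp.finite_children u
  have hfw := hp.finite_children w
  have hcu : (children r par u).ncard = (children r par w).ncard := by rw [← hue, ← hwe, hcard]
  have hpos : 0 < (children r par u).ncard := by
    rw [Set.ncard_pos hfu, ← hue]
    exact hune
  have noflag : ∀ {κ κ' : Config V}, κ.fl = ∅ → κ'.fl = ∅ → κ.Good G r par n u →
      κ'.Good G r par n w → κ.Distinct κ' G r par u w → κ.IsPair κ' G r par n u w := by
    intro κ κ' h1 h2 h3 h4 h5
    exact ⟨h3, h4, h5, Or.inl h1, fun h ↦ absurd h1 h.ne_empty, fun h ↦ absurd h2 h.ne_empty⟩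
  rcases Nat.lt_or_ge (children r par w).ncard (n - 1) with hm | hm
  -- At most `n - 2` children: distinct colours from 1 upwards at `u` and from 0 upwards at `w` give
  -- no zero edge against one.
  · obtain ⟨e, he1, he2, he3⟩ := exists_enumeration hfu
    obtain ⟨e', he1', he2', he3'⟩ := exists_enumeration hfw
    let κ : Config V := ⟨fun y ↦ if y ∈ children r par u then e y + 1 else 0, fun _ _ ↦ 1, ∅⟩
    let κ' : Config V := ⟨fun y ↦ if y ∈ children r par w then e' y else 0, fun _ _ ↦ 1, ∅⟩
    have hg : ∀ y ∈ children r par u, κ.g y = e y + 1 := fun y hy ↦ if_pos hy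
    have hg' : ∀ y ∈ children r par w, κ'.g y = e' y := fun y hy ↦ if_pos hy
    refine ⟨κ, κ', noflag rfl rfl ?_ ?_ ?_⟩
    · refine Config.good_of_nbr hG hp hu (rigidOn_of_injOn (fun x hx y hy hxy ↦ ?_) _) (fun y ↦ ?_)
        (fun _ _ ↦ rfl) (fun _ _ ↦ le_rfl) (Set.empty_subset _)
        (fun c _ c' hc' h ↦ ⟨c', hc', h, rfl⟩) (fun _ ↦ ?_)
      · rw [hg x hx, hg y hy] at hxy
        exact he1 hx hy (by omega)
      · simp only [κ]
        split_ifs with hy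
        · have := he2 y hy
          omega
        · omega
      · obtain ⟨c, hc, hc0⟩ := he3 0 hpos
        exact Or.inl ⟨c, hc, by rw [hg c hc, hc0]⟩
    · refine Config.good_of_nbr hG hp hw (rigidOn_of_injOn (fun x hx y hy hxy ↦ ?_) _) (fun y ↦ ?_)
        (fun _ _ ↦ rfl) (fun _ _ ↦ le_rfl) (Set.empty_subset _)
        (fun c _ c' hc' h ↦ ⟨c', hc', h, rfl⟩) (fun h2 ↦ ?_)
      · rw [hg' x hx, hg' y hy] at hxy
        exact he1' hx hy hxy
      · simp only [κ']
        split_ifs with hy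
        · have := he2' y hy
          omega
        · omega
      · rw [hwe] at h2
        obtain ⟨c, hc, hc0⟩ := he3' 1 (by omega)
        exact Or.inl ⟨c, hc, by rw [hg' c hc, hc0]⟩
    · refine Or.inr (Or.inl ?_)
      have h1 : κ.zeros r par u = ∅ := by
        refine Set.eq_empty_iff_forall_notMem.2 ?_
        rintro c (⟨hc, hc0⟩ | hc)
        · rw [hg c hc] at hc0
          omega
        · exact hc
      rw [h1, Set.ncard_empty]
      obtain ⟨c, hc, hc0⟩ := he3' 0 (by omega)
      have hcz : c ∈ κ'.zeros r par w := Or.inl ⟨hc, by rw [hg' c hc, hc0]⟩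
      have hfz : (κ'.zeros r par w).Finite := by
        simp only [Config.zeros, κ', Set.union_empty]
        exact hfw.subset fun c hc ↦ hc.1
      exact ((Set.ncard_pos hfz).2 ⟨c, hcz⟩).ne
  rcases Nat.eq_or_lt_of_le hm with hm | hm
  -- Exactly `n - 1` children: distinct colours use up all of `0, …, n - 2` on both sides. The
  -- children of `w` are too many to be independent, so an edge `ab` between them can get colour 0
  -- while all sibling edges at `u` get 1. The edge from `w` to `a` gets colour 1, and `b` is chosen
  -- with a further neighbour not adjacent to `r`.
  · obtain ⟨a, ha, b, hb, hab, hbad⟩ : ∃ a ∈ children r par w, ∃ b ∈ children r par w,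
        G.Adj a b ∧ ∃ c, G.Adj b c ∧ c ≠ a ∧ ¬ G.Adj r c := by
      have hind := hp.indepBound_children hG hfree hn hw.ne' (C := children r par w) fun c hc ↦
        ⟨hp.adj_of_mem hc, hp.dist_of_mem hc⟩
      by_contra hcon
      have := hind hfw.toFinset (by simp) (fun a ha b hb hab ↦ hcon ?_)
      · rw [← Set.ncard_eq_toFinset_card _ hfw] at this
        omega
      · rw [hfw.mem_toFinset] at ha hb
        rcases exists_not_bad hp hmin htw hu hw huw hune hue ha hb hab with h | h
        · exact ⟨a, ha, b, hb, hab, h⟩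
        · exact ⟨b, hb, a, ha, hab.symm, h⟩
    obtain ⟨e, he1, he2, he3⟩ := exists_enumeration hfu
    obtain ⟨e', he1', he2', he3'⟩ := exists_enumeration_one hfw ha (by omega)
    let κ : Config V := ⟨fun y ↦ if y ∈ children r par u then e y else 0, fun _ _ ↦ 1, ∅⟩
    let κ' : Config V := ⟨fun y ↦ if y ∈ children r par w then e' y else 0,
      fun y z ↦ if (y = a ∧ z = b) ∨ (y = b ∧ z = a) then 0 else 1, ∅⟩
    have hg : ∀ y ∈ children r par u, κ.g y = e y := fun y hy ↦ if_pos hy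
    have hg' : ∀ y ∈ children r par w, κ'.g y = e' y := fun y hy ↦ if_pos hy
    refine ⟨κ, κ', noflag rfl rfl ?_ ?_ ?_⟩
    · refine Config.good_of_nbr hG hp hu (rigidOn_of_injOn (fun x hx y hy hxy ↦ ?_) _) (fun y ↦ ?_)
        (fun _ _ ↦ rfl) (fun _ _ ↦ le_rfl) (Set.empty_subset _)
        (fun c _ c' hc' h ↦ ⟨c', hc', h, rfl⟩) (fun _ ↦ ?_)
      · rw [hg x hx, hg y hy] at hxy
        exact he1 hx hy (by omega)
      · simp only [κ]
        split_ifs with hy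
        · have := he2 y hy
          omega
        · omega
      · obtain ⟨c, hc, hc0⟩ := he3 1 (by omega)
        exact Or.inl ⟨c, hc, by rw [hg c hc, hc0]⟩
    · refine ⟨rigidOn_of_injOn (fun x hx y hy hxy ↦ ?_) _, fun y ↦ ?_, fun y z ↦ ?_, fun y z ↦ ?_,
        Set.empty_subset _, fun c hc ↦ ?_,
        fun _ ↦ Or.inl ⟨a, ha, by rw [hg' a ha, he3']⟩⟩
      · rw [hg' x hx, hg' y hy] at hxy
        exact he1' hx hy hxy
      · simp only [κ']
        split_ifs with hy
        · have := he2' y hy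
          omega
        · omega
      · simp only [κ']
        congr 1
        simp only [eq_iff_iff]
        tauto
      · simp only [κ']
        split_ifs <;> omega
      · rcases eq_or_ne c a with rfl | hca
        · exact Or.inl (by rw [hg' c hc, he3'])
        · right
          have hone : ∀ c', (c = b → c' ≠ a) → κ'.h c c' = 1 := by
            intro c' hcc
            refine if_neg ?_
            rintro (⟨h1, -⟩ | ⟨h1, h2⟩)
            · exact hca h1
            · exact hcc h1 h2
          rcases eq_or_ne c b with rfl | hcb
          · obtain ⟨c', h1, h2, h3⟩ := hbad
            by_cases h4 : c' ∈ children r par w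
            · exact Or.inl ⟨c', h4, h1, hone c' fun _ ↦ h2⟩
            · exact Or.inr (Or.inl ⟨c', h4, h1, (adj_root_or_two_le_dist hG
                (children_subset_upper hp hw hc).2 h1).resolve_left h3⟩)
          · rcases children_trichotomy hG hp hw hc with ⟨c', h1, h2⟩ | h
            · exact Or.inl ⟨c', h1, h2, hone c' fun h ↦ absurd h hcb⟩
            · exact Or.inr h
    · refine Or.inr (Or.inr ⟨hue, hwe, fun _ _ _ _ _ ↦ one_ne_zero, a, ha, b, hb, hab, ?_⟩)
      exact if_pos (Or.inl ⟨rfl, rfl⟩)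
  -- At least `n` children: a path colouring has two zero edges or more at `u`; exchanging the
  -- colours 0 and 1 at `w` leaves at most one there.
  · obtain ⟨g, h, H⟩ := hp.exists_isPathColouring hG hfree hn hu.ne'
    obtain ⟨g', h', H'⟩ := hp.exists_isPathColouring hG hfree hn hw.ne'
    have h0 := H.two_le_ncard_zero hfu (by omega)
    have h0' := H'.two_le_ncard_zero hfw (by omega)
    refine ⟨⟨g, h, ∅⟩, ⟨fun y ↦ Equiv.swap 0 1 (g' y), h', ∅⟩, noflag rfl rfl
      (H.good hG hp hn hu (Set.empty_subset _) Set.subsingleton_empty) ?_ ?_⟩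
    · refine Config.good_of_nbr hG hp hw (H'.rigidOn.comp (Equiv.injective _)) (fun y ↦ ?_)
        H'.symm H'.le_one (Set.empty_subset _) H'.nbr (fun _ ↦ ?_)
      · have := H'.le y
        simp only [Equiv.swap_apply_def]
        split_ifs <;> omega
      · obtain ⟨c, hc, hc0⟩ := Set.nonempty_of_ncard_ne_zero
          (s := {c | c ∈ children r par w ∧ g' c = 0}) (by omega)
        exact Or.inl ⟨c, hc, by simp [hc0]⟩
    · refine Or.inr (Or.inl ?_)
      have h2 : ((Config.mk (fun y ↦ Equiv.swap 0 1 (g' y)) h' ∅).zeros r par w).ncard ≤ 1 := by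
        have hz : ∀ c ∈ (Config.mk (fun y ↦ Equiv.swap 0 1 (g' y)) h' ∅).zeros r par w,
            c ∈ children r par w ∧ g' c = 1 := by
          rintro c (⟨hc, hc0⟩ | hc)
          · refine ⟨hc, ?_⟩
            have := congrArg (Equiv.swap 0 1) hc0
            simpa using this
          · exact absurd hc (Set.notMem_empty c)
        rw [Set.ncard_le_one (hfw.subset fun c hc ↦ (hz c hc).1)]
        intro c hc c' hc'
        refine H'.inj c (hz c hc).1 c' (hz c' hc').1 ?_ ?_
        · rw [(hz c hc).2, (hz c' hc').2]
        · rw [(hz c hc).2]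
          exact one_ne_zero
      have h3 : (Config.mk g h ∅).zeros r par u = {c | c ∈ children r par u ∧ g c = 0} := by
        simp [Config.zeros]
      rw [h3]
      omega

theorem exists_isPair (hn : 2 < n) (hG : G.Connected) (hfree : G.IndFree (star n))
    (hp : IsParent G r par) (hmin : ∀ v, G.degree r ≤ G.degree v)
    (htw : (∃ t, G.Adj r t ∧ upper G r t = ∅) ∨ ∀ a b, G.Adj a b → G.degree a = G.degree r →
      ¬ ∀ c, c ≠ a → c ≠ b → (G.Adj a c ↔ G.Adj b c))
    {u w : V} (hu : G.Adj r u) (hw : G.Adj r w) (huw : u ≠ w) (hune : (upper G r u).Nonempty) :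
    ∃ κ κ' : Config V, κ.IsPair κ' G r par n u w := by
  by_cases h1 : ∃ c, c ∈ upper G r u \ children r par u
  · obtain ⟨c, hc⟩ := h1
    obtain ⟨κ, κ', h, -⟩ := exists_isPair_of_free hn hG hfree hp hu hw hc
    exact ⟨κ, κ', h⟩
  by_cases h2 : ∃ c, c ∈ upper G r w \ children r par w
  · obtain ⟨c, hc⟩ := h2
    obtain ⟨κ, κ', -, h⟩ := exists_isPair_of_free hn hG hfree hp hw hu hc
    exact ⟨κ', κ, h⟩
  have hue : upper G r u = children r par u :=
    (Set.sdiff_eq_empty.1 (Set.eq_empty_iff_forall_notMem.2 (not_exists.1 h1))).antisymm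
      (children_subset_upper hp hu)
  have hwe : upper G r w = children r par w :=
    (Set.sdiff_eq_empty.1 (Set.eq_empty_iff_forall_notMem.2 (not_exists.1 h2))).antisymm
      (children_subset_upper hp hw)
  by_cases hcard : (upper G r u).ncard = (upper G r w).ncard
  · exact exists_isPair_of_children hn hG hfree hp hmin htw hu hw huw hune hue hwe hcard
  · obtain ⟨g, h, H⟩ := hp.exists_isPathColouring hG hfree hn hu.ne'
    obtain ⟨g', h', H'⟩ := hp.exists_isPathColouring hG hfree hn hw.ne'
    exact ⟨⟨g, h, ∅⟩, ⟨g', h', ∅⟩,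
      H.good hG hp hn hu (Set.empty_subset _) Set.subsingleton_empty,
      H'.good hG hp hn hw (Set.empty_subset _) Set.subsingleton_empty, Or.inl hcard, Or.inl rfl,
      fun h ↦ absurd rfl h.ne_empty, fun h ↦ absurd rfl h.ne_empty⟩

end SimpleGraph

/-! ### The colouring given by a family of configurations -/

namespace SimpleGraph

variable {V : Type*} {G : SimpleGraph V} {r : V} {par : V → V} {n : ℕ}

/-- A partial matching `Pr` of the neighbours of the root. -/
structure IsPairing (G : SimpleGraph V) (r : V) (n : ℕ) (Pr : V → V → Prop) : Prop where
  adj_left : ∀ {u w}, Pr u w → G.Adj r u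
  adj_right : ∀ {u w}, Pr u w → G.Adj r w
  ne : ∀ {u w}, Pr u w → u ≠ w
  upper_left : ∀ {u w}, Pr u w → (upper G r u).Nonempty
  unique_right : ∀ {u w w'}, Pr u w → Pr u w' → w = w'
  unique_left : ∀ {u u' w}, Pr u w → Pr u' w → u = u'
  disj : ∀ {u w x}, Pr u w → ¬ Pr w x
  -- Needed for a vertex at distance two with the same two neighbours `u`, `w` as the root.
  eq_three : ∀ {u w}, Pr u w → (∀ x, G.Adj r x → x = u ∨ x = w) → n = 3

/-- A choice of configurations at all vertices. -/
structure IsFamily (G : SimpleGraph V) (r : V) (par : V → V) (n : ℕ) (Pr : V → V → Prop)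
    (cfg : V → Config V) : Prop where
  path : ∀ v, 2 ≤ G.dist r v →
    IsPathColouring G (children r par v) (n - 2) (cfg v).g (cfg v).h
  fl : ∀ v, ¬ G.Adj r v → (cfg v).fl = ∅
  good : ∀ x, G.Adj r x → (cfg x).Good G r par n x
  unpaired : ∀ x, G.Adj r x → (∀ w, ¬ Pr x w) → (∀ u, ¬ Pr u x) →
    (cfg x).fl = ∅ ∧ IsPathColouring G (children r par x) (n - 2) (cfg x).g (cfg x).h
  pair : ∀ u w, Pr u w → (cfg u).IsPair (cfg w) G r par n u w
  root_symm : ∀ x y, (cfg r).h x y = (cfg r).h y x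
  root_le_one : ∀ x y, (cfg r).h x y ≤ 1
  root_lt : ∀ x, (cfg r).g x < n - 1

open Classical in
/-- The colouring given by a choice of configurations. -/
noncomputable def familyColouring (r : V) (par : V → V) (cfg : V → Config V) : V → V → ℕ :=
  treeColouring r par (fun v ↦ (cfg v).g) (fun v ↦ (cfg v).h)
    (fun v w ↦ if w ∈ (cfg v).fl ∨ v ∈ (cfg w).fl then 0 else 1)

theorem exists_isFamily [G.LocallyFinite] (hn : 2 < n) (hG : G.Connected)
    (hfree : G.IndFree (star n)) (hp : IsParent G r par) (hmin : ∀ v, G.degree r ≤ G.degree v)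
    (htw : (∃ t, G.Adj r t ∧ upper G r t = ∅) ∨ ∀ a b, G.Adj a b → G.degree a = G.degree r →
      ¬ ∀ c, c ≠ a → c ≠ b → (G.Adj a c ↔ G.Adj b c))
    {Pr : V → V → Prop} (hPr : IsPairing G r n Pr) (κ₀ : Config V) (hfl : κ₀.fl = ∅)
    (hsymm : ∀ x y, κ₀.h x y = κ₀.h y x) (hone : ∀ x y, κ₀.h x y ≤ 1)
    (hlt : ∀ x, κ₀.g x < n - 1) :
    ∃ cfg, cfg r = κ₀ ∧ IsFamily G r par n Pr cfg := by
  classical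
  have h1 : ∀ v, ∃ κ : Config V, (v = r → κ = κ₀) ∧ (v ≠ r → κ.fl = ∅ ∧
      IsPathColouring G (children r par v) (n - 2) κ.g κ.h) := by
    intro v
    rcases eq_or_ne v r with hv | hv
    · exact ⟨κ₀, fun _ ↦ rfl, fun h ↦ absurd hv h⟩
    · obtain ⟨g, h, H⟩ := hp.exists_isPathColouring hG hfree hn hv
      exact ⟨⟨g, h, ∅⟩, fun h ↦ absurd h hv, fun _ ↦ ⟨rfl, H⟩⟩
  choose base hbr hbase using h1
  have h2 : ∀ u w, ∃ κκ : Config V × Config V, Pr u w → κκ.1.IsPair κκ.2 G r par n u w := by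
    intro u w
    by_cases h : Pr u w
    · obtain ⟨κ, κ', H⟩ := exists_isPair hn hG hfree hp hmin htw (hPr.adj_left h)
        (hPr.adj_right h) (hPr.ne h) (hPr.upper_left h)
      exact ⟨⟨κ, κ'⟩, fun _ ↦ H⟩
    · exact ⟨⟨κ₀, κ₀⟩, fun h' ↦ absurd h' h⟩
  choose P hP using h2
  let cfg : V → Config V := fun x ↦ if h : ∃ w, Pr x w then (P x h.choose).1 else
    if h : ∃ u, Pr u x then (P h.choose x).2 else base x
  have hcl : ∀ u w, Pr u w → cfg u = (P u w).1 := by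
    intro u w h
    have hex : ∃ w, Pr u w := ⟨w, h⟩
    have : hex.choose = w := hPr.unique_right hex.choose_spec h
    simp only [cfg, dif_pos hex, this]
  have hcr : ∀ u w, Pr u w → cfg w = (P u w).2 := by
    intro u w h
    have hex : ∃ u, Pr u w := ⟨u, h⟩
    have hnex : ¬ ∃ x, Pr w x := fun ⟨x, hx⟩ ↦ hPr.disj h hx
    have : hex.choose = u := hPr.unique_left hex.choose_spec h
    simp only [cfg, dif_pos hex, dif_neg hnex, this]
  have hcb : ∀ x, (∀ w, ¬ Pr x w) → (∀ u, ¬ Pr u x) → cfg x = base x := by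
    intro x h1 h2
    simp only [cfg, dif_neg (not_exists.2 h1), dif_neg (not_exists.2 h2)]
  have hnadj : ∀ v, ¬ G.Adj r v → cfg v = base v := fun v hv ↦
    hcb v (fun w h ↦ hv (hPr.adj_left h)) (fun u h ↦ hv (hPr.adj_right h))
  have hcfgr : cfg r = κ₀ := by rw [hnadj r G.irrefl, hbr r rfl]
  have hpair : ∀ u w, Pr u w → (cfg u).IsPair (cfg w) G r par n u w := by
    intro u w h
    rw [hcl u w h, hcr u w h]
    exact hP u w h
  refine ⟨cfg, hcfgr, ?_, ?_, ?_, ?_, hpair, ?_, ?_, ?_⟩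
  · intro v hv
    rw [hnadj v fun h ↦ by rw [dist_eq_one_iff_adj.2 h] at hv; omega]
    refine (hbase v ?_).2
    rintro rfl
    simp at hv
  · intro v hv
    rw [hnadj v hv]
    rcases eq_or_ne v r with h | h
    · rw [hbr v h, hfl]
    · exact (hbase v h).1
  · intro x hx
    by_cases h3 : ∃ w, Pr x w
    · obtain ⟨w, hw⟩ := h3
      exact (hpair x w hw).left
    by_cases h4 : ∃ u, Pr u x
    · obtain ⟨u, hu⟩ := h4
      exact (hpair u x hu).right
    · rw [hcb x (not_exists.1 h3) (not_exists.1 h4)]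
      obtain ⟨h5, h6⟩ := hbase x hx.ne'
      refine h6.good hG hp hn hx (fl := (base x).fl) ?_ ?_
      · rw [h5]
        exact Set.empty_subset _
      · rw [h5]
        exact Set.subsingleton_empty
  · intro x hx h3 h4
    rw [hcb x h3 h4]
    exact hbase x hx.ne'
  all_goals rwa [hcfgr]

namespace IsFamily

variable {Pr : V → V → Prop} {cfg : V → Config V}

theorem comm (F : IsFamily G r par n Pr cfg) (hG : G.Connected) (hp : IsParent G r par)
    (v w : V) : familyColouring r par cfg v w = familyColouring r par cfg w v := by
  classical
  refine treeColouring_comm hp (fun u x y ↦ ?_) (fun x y ↦ by simp only [or_comm]) v w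
  rcases Nat.lt_or_ge (G.dist r u) 2 with h | h
  · by_cases hu : G.Adj r u
    · exact (F.good u hu).symm x y
    · have h0 : G.dist r u = 0 := by
        have : G.dist r u ≠ 1 := fun h ↦ hu (dist_eq_one_iff_adj.1 h)
        omega
      rw [← hG.dist_eq_zero_iff.1 h0]
      exact F.root_symm x y
  · exact (F.path u h).symm x y

theorem lt (F : IsFamily G r par n Pr cfg) (hG : G.Connected) (hn : 2 < n)
    (v w : V) : familyColouring r par cfg v w < n - 1 := by
  classical
  have hu : ∀ u, (∀ x, (cfg u).g x < n - 1) ∧ ∀ x y, (cfg u).h x y ≤ 1 := by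
    intro u
    rcases Nat.lt_or_ge (G.dist r u) 2 with h | h
    · by_cases hu : G.Adj r u
      · exact ⟨(F.good u hu).lt, (F.good u hu).le_one⟩
      · have h0 : G.dist r u = 0 := by
          have : G.dist r u ≠ 1 := fun h ↦ hu (dist_eq_one_iff_adj.1 h)
          omega
        rw [← hG.dist_eq_zero_iff.1 h0]
        exact ⟨F.root_lt, F.root_le_one⟩
    · refine ⟨fun x ↦ ?_, (F.path u h).le_one⟩
      have := (F.path u h).le x
      omega
  unfold familyColouring treeColouring
  dsimp only
  split_ifs
  · exact (hu v).1 w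
  · exact (hu w).1 v
  · have := (hu (par v)).2 v w
    omega
  · omega
  · omega

theorem free_eq (hG : G.Connected) (hp : IsParent G r par) (F : IsFamily G r par n Pr cfg)
    {x c : V} (hx : G.Adj r x) (hc : c ∈ upper G r x \ children r par x) :
    (c ∈ (cfg x).fl → familyColouring r par cfg x c = 0) ∧
      (c ∉ (cfg x).fl → familyColouring r par cfg x c = 1) := by
  classical
  have hcd := hc.1.2
  have hxd : G.dist r x = 1 := dist_eq_one_iff_adj.2 hx
  have hcr : ¬ G.Adj r c := fun h ↦ by
    rw [dist_eq_one_iff_adj.2 h] at hcd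
    omega
  have hfree : familyColouring r par cfg x c =
      if c ∈ (cfg x).fl ∨ x ∈ (cfg c).fl then 0 else 1 := by
    refine treeColouring_free hc.2 (fun h ↦ ?_) (fun _ h1 h2 ↦ ?_)
    · have := hp.dist_of_mem h
      omega
    · have := hp.dist c h1
      rw [← h2, ((mem_children_root hG hp).2 hx).2, dist_self] at this
      omega
  rw [hfree, F.fl c hcr]
  constructor <;> intro h <;> simp [h]

/-- If `w` has children, the start of one of their paths serves. Otherwise every edge of `w` except
the one to its parent leads to a sibling or is free, and free edges have colour 1 unless flagged. -/
theorem exists_one_of_dist [G.LocallyFinite] (F : IsFamily G r par n Pr cfg) (hn : 2 < n)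
    (hG : G.Connected) (hfree : G.IndFree (star n)) (hp : IsParent G r par)
    (hmin : ∀ v, G.degree r ≤ G.degree v) (hd : 2 ≤ G.degree r) (hPr : IsPairing G r n Pr)
    {w : V} (hw : 2 ≤ G.dist r w) :
    ∃ v, G.Adj w v ∧ familyColouring r par cfg w v = 1 := by
  classical
  have hwr : w ≠ r := by
    rintro rfl
    simp at hw
  have hwadj : ¬ G.Adj r w := fun h ↦ by
    rw [dist_eq_one_iff_adj.2 h] at hw
    omega
  have hwp : w ∈ children r par (par w) := ⟨hwr, rfl⟩
  have hpd := hp.dist w hwr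
  have hchild : ∀ {v c}, c ∈ children r par v → familyColouring r par cfg v c = (cfg v).g c :=
    fun h ↦ treeColouring_child h
  by_cases hne : (children r par w).Nonempty
  · obtain ⟨c, hc, hc1⟩ := (F.path w hw).one hne
    exact ⟨c, hp.adj_of_mem hc, by rw [hchild hc, hc1]⟩
  rw [Set.not_nonempty_iff_eq_empty] at hne
  have hfreeone : ∀ v, v ∉ children r par (par w) → v ≠ par w → 2 ≤ G.dist r w → v ≠ r →
      w ∉ (cfg v).fl → familyColouring r par cfg w v = 1 := by
    intro v h1 h2 h3 h4 h5
    have : familyColouring r par cfg w v =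
        if v ∈ (cfg w).fl ∨ w ∈ (cfg v).fl then 0 else 1 := by
      refine treeColouring_free ?_ (fun h ↦ h2 h.2.symm) (fun _ _ h ↦ h1 ⟨h4, h.symm⟩)
      rw [hne]
      exact Set.notMem_empty v
    rw [this, F.fl w hwadj]
    simp [h5]
  have hsib : ∀ c ∈ children r par (par w), (cfg (par w)).h w c = 1 →
      familyColouring r par cfg w c = 1 := by
    intro c hc h1
    rw [← h1]
    exact treeColouring_sibling hp hwp hc
  have hnr : ∀ v, G.Adj w v → v ≠ r := by
    rintro v h rfl
    exact hwadj h.symm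
  rcases Nat.lt_or_ge 2 (G.dist r w) with h3 | h3
  · have hpath := F.path (par w) (by omega)
    obtain ⟨v, hv, hvp⟩ : ∃ v, G.Adj w v ∧ v ≠ par w := by
      have h2 : 1 < (G.neighborFinset w).card := by
        rw [card_neighborFinset_eq_degree]
        exact lt_of_lt_of_le hd (hmin w)
      obtain ⟨v, hv, hne⟩ := Finset.exists_mem_ne h2 (par w)
      exact ⟨v, by simpa using hv, hne⟩
    by_cases hvc : v ∈ children r par (par w)
    · obtain ⟨z, hz, hwz, h1⟩ := hpath.nbr w hwp v hvc hv
      exact ⟨z, hwz, hsib z hz h1⟩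
    · refine ⟨v, hv, hfreeone v hvc hvp hw (hnr v hv) fun hfl ↦ ?_⟩
      by_cases hva : G.Adj r v
      · have := ((F.good v hva).fl_sub hfl).1.2
        omega
      · rw [F.fl v hva] at hfl
        exact hfl
  have hw2 : G.dist r w = 2 := by omega
  have hrp : G.Adj r (par w) := dist_eq_one_iff_adj.1 (by omega)
  rcases (F.good _ hrp).one w hwp with h | ⟨c, hc, hwc, h⟩ | ⟨c, hc, hwc, h⟩ | h
  · refine ⟨par w, hp.adj_of_mem hwp |>.symm, ?_⟩
    rw [F.comm hG hp, hchild hwp, h]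
  · exact ⟨c, hwc, hsib c hc h⟩
  · refine ⟨c, hwc, hfreeone c hc (fun h' ↦ ?_) hw (hnr c hwc) fun hfl ↦ ?_⟩
    · rw [h'] at h
      omega
    · rw [F.fl c fun h' ↦ by rw [dist_eq_one_iff_adj.2 h'] at h; omega] at hfl
      exact hfl
  -- By minimality of the degree, `w` and `r` have the same neighbours. Without an edge of colour 1,
  -- `w` is flagged by every neighbour of `r` except its parent. Only one member of a pair carries
  -- flags, and unpaired vertices carry none, so each of these neighbours is the partner of the
  -- parent. Hence `r` has exactly two neighbours and `n = 3`.
  · by_contra hcon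
    have hnb : G.neighborFinset w = G.neighborFinset r := by
      refine Finset.eq_of_subset_of_card_le (fun c hc ↦ ?_) ?_
      · rw [mem_neighborFinset] at hc ⊢
        exact h c hc
      · rw [card_neighborFinset_eq_degree, card_neighborFinset_eq_degree]
        exact hmin w
    have hX : ∀ x, G.Adj r x → G.Adj w x := fun x hx ↦ by
      rw [← mem_neighborFinset, hnb, mem_neighborFinset]
      exact hx
    have hflag : ∀ x, G.Adj r x → x ≠ par w → w ∈ (cfg x).fl := by
      intro x hx hxp
      by_contra hfl
      refine hcon ⟨x, hX x hx, hfreeone x (fun h' ↦ ?_) hxp hw hx.ne' hfl⟩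
      have h1 := hp.dist_of_mem h'
      rw [dist_eq_one_iff_adj.2 hx] at h1
      omega
    have hpart : ∀ x, G.Adj r x → x ≠ par w → Pr x (par w) ∨ Pr (par w) x := by
      intro x hx hxp
      have hfx := hflag x hx hxp
      by_cases h3 : ∃ y, Pr x y
      · obtain ⟨y, hy⟩ := h3
        have hyp : y = par w := by
          by_contra hyp
          have hfy := hflag y (hPr.adj_right hy) hyp
          rcases (F.pair x y hy).fl with h | h
          · rw [h] at hfx
            exact hfx
          · rw [h] at hfy
            exact hfy
        exact Or.inl (hyp ▸ hy)
      by_cases h4 : ∃ y, Pr y x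
      · obtain ⟨y, hy⟩ := h4
        have hyp : y = par w := by
          by_contra hyp
          have hfy := hflag y (hPr.adj_left hy) hyp
          rcases (F.pair y x hy).fl with h | h
          · rw [h] at hfy
            exact hfy
          · rw [h] at hfx
            exact hfx
        exact Or.inr (hyp ▸ hy)
      · rw [(F.unpaired x hx (not_exists.1 h3) (not_exists.1 h4)).1] at hfx
        exact absurd hfx (Set.notMem_empty w)
    obtain ⟨x, hx, hxp⟩ : ∃ x, G.Adj r x ∧ x ≠ par w := by
      have h2 : 1 < (G.neighborFinset r).card := by
        rw [card_neighborFinset_eq_degree]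
        exact hd
      obtain ⟨v, hv, hne⟩ := Finset.exists_mem_ne h2 (par w)
      exact ⟨v, by simpa using hv, hne⟩
    -- For `n = 3` siblings are pairwise adjacent, but all neighbours of `w` are at distance one. So
    -- `w` is an only child, and the edge of colour 1 from its parent leads to it.
    have hfin : n = 3 → (∃ c ∈ children r par (par w), (cfg (par w)).g c = 1) → False := by
      rintro hn3 ⟨c, hc, hc1⟩
      have hcw : c = w := by
        by_contra hcw
        have hind := hp.indepBound_children hG hfree hn hrp.ne' (C := children r par (par w))
          fun c hc ↦ ⟨hp.adj_of_mem hc, hp.dist_of_mem hc⟩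
        have hnadj : ¬ G.Adj w c := fun h' ↦ by
          have h1 := hp.dist_of_mem hc
          rw [dist_eq_one_iff_adj.2 (h c h')] at h1
          omega
        have := hind {c, w} (by
          intro y hy
          rcases Finset.mem_insert.1 (Finset.mem_coe.1 hy) with rfl | hy
          · exact hc
          · rw [Finset.mem_singleton.1 hy]
            exact hwp) (by
          intro a ha b hb
          simp only [Finset.mem_insert, Finset.mem_singleton] at ha hb
          rcases ha with rfl | rfl <;> rcases hb with rfl | rfl
          · exact G.irrefl
          · exact fun h ↦ hnadj h.symm
          · exact hnadj
          · exact G.irrefl)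
        rw [Finset.card_pair hcw] at this
        omega
      rw [hcw] at hc1
      refine hcon ⟨par w, (hp.adj_of_mem hwp).symm, ?_⟩
      rw [F.comm hG hp, hchild hwp, hc1]
    rcases hpart x hx hxp with hxw | hxw
    · refine hfin (hPr.eq_three hxw fun y hy ↦ ?_)
        ((F.pair _ _ hxw).one_right ⟨w, hflag x hx hxp⟩ ⟨w, hwp⟩)
      by_cases hyp : y = par w
      · exact Or.inr hyp
      · rcases hpart y hy hyp with h' | h'
        · exact Or.inl (hPr.unique_left h' hxw)
        · exact absurd h' (hPr.disj hxw)
    · refine hfin (hPr.eq_three hxw fun y hy ↦ ?_)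
        ((F.pair _ _ hxw).one_left ⟨w, hflag x hx hxp⟩ ⟨w, hwp⟩)
      by_cases hyp : y = par w
      · exact Or.inl hyp
      · rcases hpart y hy hyp with h' | h'
        · exact absurd hxw (hPr.disj h')
        · exact Or.inr (hPr.unique_right h' hxw)

theorem exists_one_of_adj (F : IsFamily G r par n Pr cfg) (hG : G.Connected)
    (hp : IsParent G r par) {x : V} (hx : G.Adj r x) (hne : (upper G r x).Nonempty)
    (h : 2 ≤ (upper G r x).ncard ∨ ((∀ w, ¬ Pr x w) ∧ ∀ u, ¬ Pr u x)) :
    ∃ v, G.Adj x v ∧ familyColouring r par cfg x v = 1 := by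
  have key : (∃ c ∈ children r par x, (cfg x).g c = 1) ∨
      ∃ c ∈ upper G r x \ children r par x, c ∉ (cfg x).fl := by
    rcases h with h | ⟨h1, h2⟩
    · exact (F.good x hx).big h
    · obtain ⟨h3, h4⟩ := F.unpaired x hx h1 h2
      by_cases hc : (children r par x).Nonempty
      · exact Or.inl (h4.one hc)
      · right
        rw [Set.not_nonempty_iff_eq_empty] at hc
        obtain ⟨c, hcu⟩ := hne
        exact ⟨c, ⟨hcu, by simp [hc]⟩, by simp [h3]⟩
  rcases key with ⟨c, hc, h1⟩ | ⟨c, hc, h1⟩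
  · exact ⟨c, hp.adj_of_mem hc, by rw [← h1]; exact treeColouring_child hc⟩
  · exact ⟨c, hc.1.1, (free_eq hG hp F hx hc).2 h1⟩

end IsFamily

/-! ### Labels of the neighbours of the root -/

/-- An invariant of `x` under the automorphisms that preserve the colouring `c` and fix `r`. -/
noncomputable def label (G : SimpleGraph V) (r : V) (c : V → V → ℕ) (x : V) : ℕ × ℕ × Prop :=
  ((upper G r x).ncard, {y | y ∈ upper G r x ∧ c x y = 0}.ncard,
    ∃ y ∈ upper G r x, ∃ z ∈ upper G r x, G.Adj y z ∧ c y z = 0)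

theorem label_apply (hG : G.Connected) {c : V → V → ℕ} {φ : G ≃g G} (hφ : Preserves c φ)
    (hr : φ r = r) (x : V) : label G r c (φ x) = label G r c x := by
  have hdist : ∀ v, G.dist r (φ v) = G.dist r v := fun v ↦ by
    conv_lhs => rw [← hr]
    exact φ.dist_eq hG hG r v
  have hup : ∀ y, φ y ∈ upper G r (φ x) ↔ y ∈ upper G r x := fun y ↦ by
    simp only [upper, Set.mem_ofPred_eq, hdist, φ.map_adj_iff]
  have h1 : upper G r (φ x) = φ '' upper G r x := by
    ext y
    obtain ⟨y, rfl⟩ := φ.surjective y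
    rw [hup, φ.injective.mem_set_image]
  have h2 : {y | y ∈ upper G r (φ x) ∧ c (φ x) y = 0} =
      φ '' {y | y ∈ upper G r x ∧ c x y = 0} := by
    ext y
    obtain ⟨y, rfl⟩ := φ.surjective y
    rw [φ.injective.mem_set_image]
    simp only [Set.mem_ofPred_eq, hup]
    refine and_congr_right fun hy ↦ ?_
    rw [hφ x y hy.1]
  have h3 : (∃ y ∈ upper G r (φ x), ∃ z ∈ upper G r (φ x), G.Adj y z ∧ c y z = 0) ↔
      ∃ y ∈ upper G r x, ∃ z ∈ upper G r x, G.Adj y z ∧ c y z = 0 := by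
    constructor
    · rintro ⟨y, hy, z, hz, hyz, h0⟩
      obtain ⟨y, rfl⟩ := φ.surjective y
      obtain ⟨z, rfl⟩ := φ.surjective z
      rw [φ.map_adj_iff] at hyz
      exact ⟨y, (hup y).1 hy, z, (hup z).1 hz, hyz, by rw [← hφ y z hyz, h0]⟩
    · rintro ⟨y, hy, z, hz, hyz, h0⟩
      exact ⟨φ y, (hup y).2 hy, φ z, (hup z).2 hz, φ.map_adj_iff.2 hyz, by rw [hφ y z hyz, h0]⟩
  unfold label
  rw [h2, propext h3, h1, Set.ncard_image_of_injective _ φ.injective,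
    Set.ncard_image_of_injective _ φ.injective]

/-- By `free_eq`, `zeros` is exactly the set counted by the second component. In the third
alternative of `Distinct` all upper neighbours are children, so the edges between them carry the
colours `h`. -/
theorem IsFamily.label_ne {Pr : V → V → Prop} {cfg : V → Config V}
    (F : IsFamily G r par n Pr cfg) (hG : G.Connected) (hp : IsParent G r par)
    (hPr : IsPairing G r n Pr) {u w : V} (h : Pr u w) :
    label G r (familyColouring r par cfg) u ≠ label G r (familyColouring r par cfg) w := by
  have hz : ∀ x, G.Adj r x → {y | y ∈ upper G r x ∧ familyColouring r par cfg x y = 0} =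
      (cfg x).zeros r par x := by
    intro x hx
    ext y
    by_cases hy : y ∈ children r par x
    · have h1 : familyColouring r par cfg x y = (cfg x).g y := treeColouring_child hy
      have h2 : y ∉ (cfg x).fl := fun h ↦ ((F.good x hx).fl_sub h).2 hy
      simp [Config.zeros, h1, hy, h2, children_subset_upper hp hx hy]
    · simp only [Config.zeros, Set.mem_union, Set.mem_ofPred_eq, hy, false_and, false_or]
      constructor
      · rintro ⟨h1, h2⟩
        by_contra h3
        rw [(free_eq hG hp F hx ⟨h1, hy⟩).2 h3] at h2
        omega
      · intro h1
        have h2 := (F.good x hx).fl_sub h1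
        exact ⟨h2.1, (free_eq hG hp F hx h2).1 h1⟩
  intro heq
  simp only [label, Prod.mk.injEq, eq_iff_iff, hz u (hPr.adj_left h), hz w (hPr.adj_right h)] at heq
  rcases (F.pair u w h).distinct with h1 | h1 | ⟨h1, h2, h3, c, hc, c', hc', hcc, h4⟩
  · exact h1 heq.1
  · exact h1 heq.2.1
  · obtain ⟨y, hy, z, hz, hyz, h0⟩ := heq.2.2.2 ⟨c, h2 ▸ hc, c', h2 ▸ hc', hcc, by
      rw [← h4]
      exact treeColouring_sibling hp hc hc'⟩
    rw [h1] at hy hz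
    have h5 : familyColouring r par cfg y z = (cfg u).h y z := treeColouring_sibling hp hy hz
    exact h3 y hy z hz hyz (h5.symm.trans h0)

end SimpleGraph

/-! ### Automorphisms of a system of disjoint paths -/

namespace SimpleGraph

section PathSystem

variable {V : Type*}

/-- `x` and `y` are consecutive in one of the lists in `L`. -/
def Consec (L : List (List V)) (x y : V) : Prop :=
  ∃ l ∈ L, ∃ i, (l[i]? = some x ∧ l[i + 1]? = some y) ∨ (l[i]? = some y ∧ l[i + 1]? = some x)

theorem Consec.symm {L : List (List V)} {x y : V} (h : Consec L x y) : Consec L y x := by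
  obtain ⟨l, hl, i, h⟩ := h
  exact ⟨l, hl, i, h.symm⟩

/-- `l` lists the vertices of a connected component of `R`, which is a path. -/
structure IsPathComponent (R : V → V → Prop) (l : List V) : Prop where
  nodup : l.Nodup
  rel_iff : ∀ i x, l[i]? = some x → ∀ y,
    R x y ↔ l[i + 1]? = some y ∨ ∃ j, j + 1 = i ∧ l[j]? = some y

theorem IsPathComponent.reverse {R : V → V → Prop} {l : List V} (h : IsPathComponent R l) :
    IsPathComponent R l.reverse := by
  refine ⟨List.nodup_reverse.2 h.nodup, fun i x hi y ↦ ?_⟩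
  have hil : i < l.length := by
    have := (List.getElem?_eq_some_iff.1 hi).1
    simpa using this
  rw [List.getElem?_reverse hil] at hi
  rw [h.rel_iff _ x hi y, or_comm]
  refine or_congr ?_ ?_
  · constructor
    · rintro ⟨j, hj, hy⟩
      rw [List.getElem?_reverse (by omega)]
      rwa [show l.length - 1 - (i + 1) = j by omega]
    · intro hy
      have hlt : i + 1 < l.length := by
        have := (List.getElem?_eq_some_iff.1 hy).1
        simpa using this
      rw [List.getElem?_reverse hlt] at hy
      exact ⟨_, by omega, hy⟩
  · constructor
    · intro hy
      have hlt := (List.getElem?_eq_some_iff.1 hy).1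
      refine ⟨i - 1, by omega, ?_⟩
      rw [List.getElem?_reverse (by omega)]
      rwa [show l.length - 1 - (i - 1) = l.length - 1 - i + 1 by omega]
    · rintro ⟨j, rfl, hy⟩
      rw [List.getElem?_reverse (by omega)] at hy
      rwa [show l.length - 1 - (j + 1) + 1 = l.length - 1 - j by omega]

/-- Follow the list: the image of the next vertex is related to the image of the current one and, by
injectivity, is not the image of the previous one. -/
theorem IsPathComponent.map {R : V → V → Prop} {φ : V → V} (hφ : Function.Injective φ)
    (hR : ∀ x y, R x y → R (φ x) (φ y)) {l l' : List V} (hl : IsPathComponent R l)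
    (hl' : IsPathComponent R l') {a : V} (ha : l[0]? = some a) (ha' : l'[0]? = some (φ a)) :
    ∀ (i : ℕ) (x : V), l[i]? = some x → l'[i]? = some (φ x) := by
  intro i
  induction i using Nat.strong_induction_on with
  | _ i ih =>
    intro x hx
    cases i with
    | zero =>
      rw [ha] at hx
      rw [← Option.some_injective _ hx, ha']
    | succ i =>
      have hlt := (List.getElem?_eq_some_iff.1 hx).1
      have hi : l[i]? = some l[i] := List.getElem?_eq_getElem (by omega)
      have h1 := ih i (by omega) _ hi
      have h2 := hR _ _ ((hl.rel_iff i _ hi x).2 (Or.inl hx))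
      rcases (hl'.rel_iff i _ h1 _).1 h2 with h | ⟨j, rfl, hj⟩
      · exact h
      · exfalso
        have hj' : l[j]? = some l[j] := List.getElem?_eq_getElem (by omega)
        have h3 := ih j (by omega) _ hj'
        rw [h3] at hj
        have h4 := hφ (Option.some_injective _ hj)
        rw [← h4] at hx
        have := hl.nodup.getElem_inj_iff.1 (List.getElem?_eq_some_iff.1 hx).2
        omega

theorem eq_of_mem_of_nodup_flatten {L : List (List V)} (h : L.flatten.Nodup) {l l' : List V}
    (hl : l ∈ L) (hl' : l' ∈ L) {x : V} (hx : x ∈ l) (hx' : x ∈ l') : l = l' := by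
  by_contra hne
  have h2 := (List.nodup_flatten.1 h).2
  have : Std.Symm (List.Disjoint (α := V)) := ⟨fun _ _ h ↦ h.symm⟩
  exact h2.forall hl hl' hne hx hx'

theorem isPathComponent_of_mem {L : List (List V)} (h : L.flatten.Nodup) {l : List V}
    (hl : l ∈ L) : IsPathComponent (Consec L) l := by
  have hnd : l.Nodup := (List.nodup_flatten.1 h).1 l hl
  refine ⟨hnd, fun i x hi y ↦ ⟨?_, ?_⟩⟩
  · rintro ⟨l', hl', j, ⟨h1, h2⟩ | ⟨h1, h2⟩⟩
    · obtain rfl := eq_of_mem_of_nodup_flatten h hl hl' (List.mem_of_getElem? hi)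
        (List.mem_of_getElem? h1)
      obtain ⟨hi1, hi2⟩ := List.getElem?_eq_some_iff.1 hi
      obtain ⟨hj1, hj2⟩ := List.getElem?_eq_some_iff.1 h1
      obtain rfl : i = j := hnd.getElem_inj_iff.1 (hi2.trans hj2.symm)
      exact Or.inl h2
    · obtain rfl := eq_of_mem_of_nodup_flatten h hl hl' (List.mem_of_getElem? hi)
        (List.mem_of_getElem? h2)
      obtain ⟨hi1, hi2⟩ := List.getElem?_eq_some_iff.1 hi
      obtain ⟨hj1, hj2⟩ := List.getElem?_eq_some_iff.1 h2
      have : i = j + 1 := hnd.getElem_inj_iff.1 (hi2.trans hj2.symm)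
      exact Or.inr ⟨j, this.symm, h1⟩
  · rintro (h1 | ⟨j, rfl, h1⟩)
    · exact ⟨l, hl, i, Or.inl ⟨hi, h1⟩⟩
    · exact ⟨l, hl, j, Or.inr ⟨h1, hi⟩⟩

/-- Paths go to paths of the same length and ends to ends, so it remains to exclude reversing a path
and moving it to another. For the latter it is enough that one end of one path differs in label from
both ends of the other. -/
theorem fixes_of_path_system {L : List (List V)} (h : L.flatten.Nodup) {α : Type*} (lab : V → α)
    (φ : V ≃ V) (hX : ∀ x ∈ L.flatten, φ x ∈ L.flatten)
    (hR : ∀ x y, Consec L (φ x) (φ y) ↔ Consec L x y)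
    (hlab : ∀ x ∈ L.flatten, lab (φ x) = lab x)
    (hself : ∀ l ∈ L, ∀ a b, l.head? = some a → l.getLast? = some b → a ≠ b → lab a ≠ lab b)
    (hpair : ∀ l ∈ L, ∀ l' ∈ L, l ≠ l' → l.length = l'.length → ∀ a b a' b', l.head? = some a →
      l.getLast? = some b → l'.head? = some a' → l'.getLast? = some b' →
      (lab a ≠ lab a' ∧ lab a ≠ lab b') ∨ (lab a' ≠ lab a ∧ lab a' ≠ lab b)) :
    ∀ x ∈ L.flatten, φ x = x := by
  intro x hx
  obtain ⟨l, hl, hxl⟩ := List.mem_flatten.1 hx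
  have hlpos : 0 < l.length := List.length_pos_of_mem hxl
  have hcl := isPathComponent_of_mem h hl
  have ha : l[0]? = some l[0] := List.getElem?_eq_getElem hlpos
  set a := l[0] with hadef
  have hal : a ∈ l := List.getElem_mem _
  have haL : a ∈ L.flatten := List.mem_flatten.2 ⟨l, hl, hal⟩
  obtain ⟨l', hl', hal'⟩ := List.mem_flatten.1 (hX a haL)
  have hcl' := isPathComponent_of_mem h hl'
  obtain ⟨j, hjlt, hj⟩ := List.getElem_of_mem hal'
  have hj' : l'[j]? = some (φ a) := by rw [List.getElem?_eq_getElem hjlt, hj]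
  -- An inner vertex of a path has two neighbours on it, but the first vertex `a` has at most one.
  have hend : j = 0 ∨ j + 1 = l'.length := by
    by_contra hcon
    push Not at hcon
    obtain ⟨k, rfl⟩ := Nat.exists_eq_succ_of_ne_zero hcon.1
    have hk1 : k < l'.length := by omega
    have hk2 : k + 1 + 1 < l'.length := by omega
    have h1 : Consec L (φ a) l'[k] := (hcl'.rel_iff _ _ hj' _).2
      (Or.inr ⟨k, rfl, List.getElem?_eq_getElem hk1⟩)
    have h2 : Consec L (φ a) l'[k + 1 + 1] := (hcl'.rel_iff _ _ hj' _).2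
      (Or.inl (List.getElem?_eq_getElem hk2))
    have key : ∀ y, Consec L (φ a) y → l[1]? = some (φ.symm y) := by
      intro y hy
      rw [← φ.apply_symm_apply y, hR, hcl.rel_iff _ _ ha] at hy
      rcases hy with hy | ⟨i, hi, -⟩
      · exact hy
      · omega
    have h3 := (key _ h1).symm.trans (key _ h2)
    have h4 := φ.symm.injective (Option.some_injective _ h3)
    have := hcl'.nodup.getElem_inj_iff.1 h4
    omega
  have hinv : ∀ x y, Consec L x y → Consec L (φ.symm x) (φ.symm y) := by
    intro x y hxy
    rw [← hR]
    simpa using hxy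
  have hmain : ∀ m, IsPathComponent (Consec L) m → m[0]? = some (φ a) →
      ∀ (i : ℕ) (x : V), l[i]? = some x → m[i]? = some (φ x) := fun m hm hm0 ↦
    hcl.map φ.injective (fun x y ↦ (hR x y).2) hm ha hm0
  have hlen : ∀ m, IsPathComponent (Consec L) m → m[0]? = some (φ a) → l.length = m.length := by
    intro m hm hm0
    have h1 := hmain m hm hm0
    have h2 := hm.map φ.symm.injective hinv hcl hm0 (by simpa using ha)
    apply le_antisymm
    · have := h1 (l.length - 1) _ (List.getElem?_eq_getElem (by omega))
      have := (List.getElem?_eq_some_iff.1 this).1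
      omega
    · have hmpos := (List.getElem?_eq_some_iff.1 hm0).1
      have := h2 (m.length - 1) _ (List.getElem?_eq_getElem (by omega))
      have := (List.getElem?_eq_some_iff.1 this).1
      omega
  have hhead : ∀ m : List V, m.head? = m[0]? := fun m ↦ List.head?_eq_getElem?
  have hlast : ∀ m : List V, m.getLast? = m[m.length - 1]? := fun m ↦ List.getLast?_eq_getElem?
  set b := l[l.length - 1] with hbdef
  have hb : l[l.length - 1]? = some b := List.getElem?_eq_getElem (by omega)
  have hbL : b ∈ L.flatten := List.mem_flatten.2 ⟨l, hl, List.getElem_mem _⟩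
  have hl'pos : 0 < l'.length := by omega
  have ha' : l'[0]? = some l'[0] := List.getElem?_eq_getElem hl'pos
  have hb' : l'[l'.length - 1]? = some l'[l'.length - 1] := List.getElem?_eq_getElem (by omega)
  rcases hend with rfl | hend
  · have hlen' := hlen l' hcl' hj'
    by_cases hll : l = l'
    · subst hll
      obtain ⟨i, hi⟩ := List.mem_iff_getElem?.1 hxl
      have h5 := hmain l hcl hj' i x hi
      rw [hi] at h5
      exact (Option.some_injective _ h5).symm
    · exfalso
      have h6 : l'[0] = φ a := hj
      have h7 : lab a = lab l'[0] := by rw [h6, hlab a haL]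
      rcases hpair l hl l' hl' hll hlen' a b _ _ ((hhead l).trans ha) ((hlast l).trans hb)
        ((hhead l').trans ha') ((hlast l').trans hb') with h8 | h8
      · exact h8.1 h7
      · exact h8.1 h7.symm
  · have hr0 : l'.reverse[0]? = some (φ a) := by
      rw [List.getElem?_reverse hl'pos, ← hj']
      congr 1
      omega
    have hlen' : l.length = l'.length := by
      simpa using hlen _ hcl'.reverse hr0
    have h9 : l'[l'.length - 1] = φ a := by
      rw [← Option.some_inj, ← hb', ← hj']
      congr 1
      omega
    have h10 : l'[0] = φ b := by
      have h5 := hmain _ hcl'.reverse hr0 _ _ hb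
      rw [List.getElem?_reverse (by omega), hlen', Nat.sub_self, ha'] at h5
      exact Option.some_injective _ h5
    by_cases hll : l = l'
    · subst hll
      by_cases hab : a = b
      · have h11 : l.length = 1 := by
          have := hcl.nodup.getElem_inj_iff.1 hab
          omega
        obtain ⟨y, hy⟩ := List.length_eq_one_iff.1 h11
        have h12 : x = a := by
          simp only [hadef]
          simp only [hy, List.mem_singleton] at hxl ⊢
          simp [hxl]
        rw [h12, ← h9, ← hbdef, hab]
      · exfalso
        refine hself l hl a b ((hhead l).trans ha) ((hlast l).trans hb) hab ?_
        rw [hbdef, h9, hlab a haL]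
    · exfalso
      have h7 : lab a = lab l'[l'.length - 1] := by rw [h9, hlab a haL]
      have h8 : lab b = lab l'[0] := by rw [h10, hlab b hbL]
      rcases hpair l hl l' hl' hll hlen' a b _ _ ((hhead l).trans ha) ((hlast l).trans hb)
        ((hhead l').trans ha') ((hlast l').trans hb') with h11 | h11
      · exact h11.2 h7
      · exact h11.2 h8.symm

end PathSystem

/-! ### Layouts and the colouring they give -/

/-- The lists in `L` are paths in `G` that partition `X`. -/
structure IsPathCover {V : Type*} (G : SimpleGraph V) (L : List (List V)) (X : Set V) : Prop where
  ne_nil : ∀ l ∈ L, l ≠ []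
  chain : ∀ l ∈ L, l.IsChain G.Adj
  nodup : L.flatten.Nodup
  mem_iff : ∀ x, x ∈ L.flatten ↔ x ∈ X

theorem IsPathCover.adj_of_consec {V : Type*} {G : SimpleGraph V} {L : List (List V)} {X : Set V}
    (H : IsPathCover G L X) {x y : V} (h : Consec L x y) : G.Adj x y ∧ x ∈ X ∧ y ∈ X := by
  obtain ⟨l, hl, i, h⟩ := h
  have key : ∀ x y, l[i]? = some x ∧ l[i + 1]? = some y → G.Adj x y ∧ x ∈ X ∧ y ∈ X := by
    rintro x y ⟨h1, h2⟩
    obtain ⟨h3, h4⟩ := List.getElem?_eq_some_iff.1 h1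
    obtain ⟨h5, h6⟩ := List.getElem?_eq_some_iff.1 h2
    have := List.isChain_iff_getElem.1 (H.chain l hl) i h5
    rw [h4, h6] at this
    exact ⟨this, (H.mem_iff x).1 (List.mem_flatten.2 ⟨l, hl, List.mem_of_getElem? h1⟩),
      (H.mem_iff y).1 (List.mem_flatten.2 ⟨l, hl, List.mem_of_getElem? h2⟩)⟩
  rcases h with h | h
  · exact key x y h
  · obtain ⟨h1, h2, h3⟩ := key y x h
    exact ⟨h1.symm, h3, h2⟩

variable {V : Type*} {G : SimpleGraph V} {r : V} {n : ℕ}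

/-- `a` and `b` have different labels. -/
def Distinguished (G : SimpleGraph V) (r : V) (Pr : V → V → Prop) (a b : V) : Prop :=
  (upper G r a).ncard ≠ (upper G r b).ncard ∨ Pr a b ∨ Pr b a

/-- A partition of the neighbours of the root into paths that leads to a distinguishing
colouring. The edges from the root to the first vertices of the paths in `os` get pairwise different
colours. -/
structure IsLayout (G : SimpleGraph V) (r : V) (n : ℕ) (Pr : V → V → Prop)
    (zs os : List (List V)) : Prop where
  pairing : IsPairing G r n Pr
  cover : IsPathCover G (zs ++ os) (G.neighborSet r)
  -- One path for each of the colours `2, …, n - 2`; all other edges at the root get colour 0.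
  length_le : os.length ≤ n - 3
  -- A path with one vertex has no path edge of colour 1, so its vertex needs such an edge towards
  -- distance two.
  single : ∀ x, [x] ∈ zs ++ os → (upper G r x).Nonempty ∧
    (2 ≤ (upper G r x).ncard ∨ ((∀ w, ¬ Pr x w) ∧ ∀ u, ¬ Pr u x))
  ends : ∀ l ∈ zs, ∀ a b, l.head? = some a → l.getLast? = some b → a ≠ b →
    Distinguished G r Pr a b
  lists : ∀ l ∈ zs, ∀ l' ∈ zs, l ≠ l' → l.length = l'.length →
    ∃ a a', l = [a] ∧ l' = [a'] ∧ Distinguished G r Pr a a'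

theorem IsLayout.distinguishingIndex_le [G.LocallyFinite] {Pr : V → V → Prop}
    {zs os : List (List V)} (H : IsLayout G r n Pr zs os) (hn : 2 < n) (hG : G.Connected)
    (hfree : G.IndFree (star n)) (hmin : ∀ v, G.degree r ≤ G.degree v) (hd : 2 ≤ G.degree r)
    (htw : (∃ t, G.Adj r t ∧ upper G r t = ∅) ∨ ∀ a b, G.Adj a b → G.degree a = G.degree r →
      ¬ ∀ c, c ≠ a → c ≠ b → (G.Adj a c ↔ G.Adj b c)) :
    G.distinguishingIndex ≤ ((n - 1 : ℕ) : ℕ∞) := by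
  classical
  obtain ⟨par, hp⟩ := hG.exists_isParent r
  set L := zs ++ os with hL
  have hC := H.cover
  let IsHead : V → ℕ → Prop := fun x i ↦ ∃ l, os[i]? = some l ∧ l.head? = some x
  -- The shift by 2 keeps colour 1 away from the root.
  let g₀ : V → ℕ := fun x ↦ if h : ∃ i, IsHead x i then h.choose + 2 else 0
  let h₀ : V → V → ℕ := fun x y ↦ if Consec L x y then 1 else 0
  have hg₀ : ∀ x, g₀ x ≠ 0 → ∃ i, IsHead x i ∧ g₀ x = i + 2 := by
    intro x hx
    by_cases h : ∃ i, IsHead x i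
    · exact ⟨h.choose, h.choose_spec, dif_pos h⟩
    · exact absurd (dif_neg h) hx
  have hg₀' : ∀ x i, IsHead x i → g₀ x ≠ 0 := by
    intro x i hi
    have h : ∃ i, IsHead x i := ⟨i, hi⟩
    have : g₀ x = h.choose + 2 := dif_pos h
    omega
  have hginj : ∀ x y, g₀ x ≠ 0 → g₀ x = g₀ y → x = y := by
    intro x y hx hxy
    obtain ⟨i, ⟨l, h1, h2⟩, h3⟩ := hg₀ x hx
    obtain ⟨j, ⟨l', h4, h5⟩, h6⟩ := hg₀ y (hxy ▸ hx)
    obtain rfl : i = j := by omega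
    rw [h1] at h4
    obtain rfl := Option.some_injective _ h4
    rw [h2] at h5
    exact Option.some_injective _ h5
  obtain ⟨cfg, hcfg, F⟩ := exists_isFamily hn hG hfree hp hmin htw H.pairing ⟨g₀, h₀, ∅⟩ rfl
    (fun x y ↦ by
      have : Consec L x y ↔ Consec L y x := ⟨Consec.symm, Consec.symm⟩
      simp only [h₀, this])
    (fun x y ↦ by simp only [h₀]; split_ifs <;> omega)
    (fun x ↦ by
      by_cases hx : g₀ x = 0
      · simp only [hx]
        omega
      · obtain ⟨i, ⟨l, h1, -⟩, h2⟩ := hg₀ x hx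
        have := (List.getElem?_eq_some_iff.1 h1).1
        have := H.length_le
        simp only [h2]
        omega)
  set c := familyColouring r par cfg with hc
  have hcr : ∀ x, G.Adj r x → c r x = g₀ x := fun x hx ↦ by
    have : c r x = (cfg r).g x := treeColouring_child ((mem_children_root hG hp).2 hx)
    rw [this, hcfg]
  have hcX : ∀ x y, G.Adj r x → G.Adj r y → c x y = h₀ x y := fun x y hx hy ↦ by
    have : c x y = (cfg r).h x y := treeColouring_sibling hp ((mem_children_root hG hp).2 hx)
      ((mem_children_root hG hp).2 hy)
    rw [this, hcfg]
  have hone : ∀ v, v ≠ r → ∃ w, G.Adj v w ∧ c v w = 1 := by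
    intro v hv
    by_cases hrv : G.Adj r v
    · obtain ⟨l, hl, hvl⟩ := List.mem_flatten.1 ((hC.mem_iff v).2 hrv)
      obtain ⟨i, hi, hiv⟩ := List.getElem_of_mem hvl
      have hi' : l[i]? = some v := by rw [List.getElem?_eq_getElem hi, hiv]
      have hcon : ∀ w, Consec L v w → ∃ w, G.Adj v w ∧ c v w = 1 := by
        intro w hw
        obtain ⟨h1, h2, h3⟩ := hC.adj_of_consec hw
        exact ⟨w, h1, by rw [hcX v w h2 h3]; exact if_pos hw⟩
      rcases Nat.lt_or_ge (i + 1) l.length with h1 | h1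
      · exact hcon l[i + 1] ⟨l, hl, i, Or.inl ⟨hi', List.getElem?_eq_getElem h1⟩⟩
      rcases Nat.eq_zero_or_pos i with rfl | h2
      · have hl1 : l.length = 1 := by omega
        obtain ⟨y, rfl⟩ := List.length_eq_one_iff.1 hl1
        obtain rfl : v = y := by simpa using hvl
        obtain ⟨h3, h4⟩ := H.single v hl
        exact F.exists_one_of_adj hG hp hrv h3 h4
      · obtain ⟨j, rfl⟩ := Nat.exists_eq_succ_of_ne_zero h2.ne'
        exact hcon (l[j]'(by omega)) ⟨l, hl, j, Or.inr ⟨List.getElem?_eq_getElem (by omega), hi'⟩⟩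
    · refine F.exists_one_of_dist hn hG hfree hp hmin hd H.pairing ?_
      have h1 : G.dist r v ≠ 1 := fun h ↦ hrv (dist_eq_one_iff_adj.1 h)
      have h2 : G.dist r v ≠ 0 := fun h ↦ hv (hG.dist_eq_zero_iff.1 h).symm
      omega
  refine distinguishingIndex_le_of_colouring c (fun v w _ ↦ F.comm hG hp v w)
    (fun v w _ ↦ F.lt hG hn v w) fun φ hφ ↦ ?_
  -- Every other vertex has an edge of colour 1 by `hone`; the root has none.
  have hr : φ r = r := by
    by_contra hne
    obtain ⟨w, hw, hw1⟩ := hone _ hne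
    obtain ⟨w, rfl⟩ := φ.surjective w
    rw [φ.map_adj_iff] at hw
    rw [hφ r w hw, hcr w hw] at hw1
    obtain ⟨i, -, hi⟩ := hg₀ w (by omega)
    omega
  have hadj : ∀ x, G.Adj r (φ x) ↔ G.Adj r x := fun x ↦ by
    conv_lhs => rw [← hr]
    exact φ.map_adj_iff
  have hgφ : ∀ x, G.Adj r x → g₀ (φ x) = g₀ x := by
    intro x hx
    have := hφ r x hx
    rwa [hr, hcr x hx, hcr _ ((hadj x).2 hx)] at this
  have hR : ∀ x y, Consec L (φ x) (φ y) ↔ Consec L x y := by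
    have h1 : ∀ x y, Consec L x y ↔ G.Adj x y ∧ G.Adj r x ∧ G.Adj r y ∧ c x y = 1 := by
      intro x y
      constructor
      · intro h
        obtain ⟨h1, h2, h3⟩ := hC.adj_of_consec h
        exact ⟨h1, h2, h3, by rw [hcX x y h2 h3]; exact if_pos h⟩
      · rintro ⟨h1, h2, h3, h4⟩
        rw [hcX x y h2 h3] at h4
        by_contra h5
        simp [h₀, h5] at h4
    intro x y
    rw [h1, h1, φ.map_adj_iff, hadj, hadj]
    refine and_congr_right fun h2 ↦ ?_
    rw [hφ x y h2]
  have hlabne : ∀ a b, Distinguished G r Pr a b → label G r c a ≠ label G r c b := by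
    rintro a b (h | h | h)
    · exact fun heq ↦ h (congrArg Prod.fst heq)
    · exact F.label_ne hG hp H.pairing h
    · exact (F.label_ne hG hp H.pairing h).symm
  have hos : ∀ l ∈ os, ∀ a, l.head? = some a → g₀ a ≠ 0 := by
    intro l hl a ha
    obtain ⟨i, hi⟩ := List.mem_iff_getElem?.1 hl
    exact hg₀' a i ⟨l, hi, ha⟩
  have hsep : ∀ l ∈ os, ∀ l' ∈ L, l ≠ l' → ∀ a x, l.head? = some a → x ∈ l' →
      (g₀ a, label G r c a) ≠ (g₀ x, label G r c x) := by
    intro l hl l' hl' hne a x ha hx heq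
    have : a = x := hginj a x (hos l hl a ha) (congrArg Prod.fst heq)
    subst this
    exact hne (eq_of_mem_of_nodup_flatten hC.nodup (List.mem_append_right _ hl) hl'
      (List.mem_of_mem_head? ha) hx)
  have hfix : ∀ x ∈ L.flatten, φ x = x := by
    refine fixes_of_path_system hC.nodup (fun x ↦ (g₀ x, label G r c x)) φ.toEquiv ?_ hR ?_ ?_ ?_
    · intro x hx
      exact (hC.mem_iff _).2 ((hadj x).2 ((hC.mem_iff x).1 hx))
    · intro x hx
      have h1 := hgφ x ((hC.mem_iff x).1 hx)
      have h2 := label_apply hG hφ hr x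
      exact Prod.ext h1 h2
    · intro l hl a b ha hb hab heq
      rcases List.mem_append.1 hl with hl | hl
      · exact hlabne a b (H.ends l hl a b ha hb hab) (congrArg Prod.snd heq)
      · exact hab (hginj a b (hos l hl a ha) (congrArg Prod.fst heq))
    · intro l hl l' hl' hne hlen a b a' b' ha hb ha' hb'
      rcases List.mem_append.1 hl with h1 | h1
      · rcases List.mem_append.1 hl' with h2 | h2
        · obtain ⟨x, x', rfl, rfl, h3⟩ := H.lists l h1 l' h2 hne hlen
          simp only [List.head?_cons, Option.some.injEq, List.getLast?_singleton] at ha hb ha' hb'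
          subst ha hb ha' hb'
          have h4 := hlabne _ _ h3
          exact Or.inl ⟨fun heq ↦ h4 (congrArg Prod.snd heq), fun heq ↦ h4 (congrArg Prod.snd heq)⟩
        · exact Or.inr ⟨hsep l' h2 l hl hne.symm a' a ha' (List.mem_of_mem_head? ha),
            hsep l' h2 l hl hne.symm a' b ha' (List.mem_of_getLast? hb)⟩
      · exact Or.inl ⟨hsep l h1 l' hl' hne a a' ha (List.mem_of_mem_head? ha'),
          hsep l h1 l' hl' hne a b' ha (List.mem_of_getLast? hb')⟩
  refine eq_of_fixes_neighbors hG hp φ hφ hr (fun x hx ↦ hfix x ((hC.mem_iff x).2 hx)) fun v hv ↦ ?_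
  by_cases hrv : G.Adj r v
  · exact (F.good v hrv).rigid
  · refine (F.path v ?_).rigidOn
    have h1 : G.dist r v ≠ 1 := fun h ↦ hrv (dist_eq_one_iff_adj.1 h)
    have h2 : G.dist r v ≠ 0 := fun h ↦ hv (hG.dist_eq_zero_iff.1 h).symm
    omega

end SimpleGraph

/-! ### Reduced path covers and degree counts -/

namespace SimpleGraph

variable {V : Type*} {G : SimpleGraph V} {r : V} {n : ℕ}

theorem ne_of_two_le_length {l : List V} (hl : l.Nodup) (h2 : 2 ≤ l.length) {a b : V}
    (ha : l.head? = some a) (hb : l.getLast? = some b) : a ≠ b := by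
  rintro rfl
  rw [List.head?_eq_getElem?, List.getElem?_eq_some_iff] at ha
  rw [List.getLast?_eq_getElem?, List.getElem?_eq_some_iff] at hb
  obtain ⟨_, ha⟩ := ha
  obtain ⟨_, hb⟩ := hb
  have := hl.getElem_inj_iff.1 (ha.trans hb.symm)
  omega

theorem exists_head_last {l : List V} (hl : l ≠ []) :
    ∃ a b, l.head? = some a ∧ l.getLast? = some b :=
  ⟨l.head hl, l.getLast hl, List.head?_eq_some_head hl, List.getLast?_eq_some_getLast hl⟩

namespace IsPathCover

variable {L L' : List (List V)} {X : Set V}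

theorem perm (H : IsPathCover G L X) (h : L.Perm L') : IsPathCover G L' X where
  ne_nil l hl := H.ne_nil l (h.mem_iff.2 hl)
  chain l hl := H.chain l (h.mem_iff.2 hl)
  nodup := h.flatten.nodup_iff.1 H.nodup
  mem_iff x := by rw [← H.mem_iff, h.flatten.mem_iff]

theorem reverse_head {l : List V} (H : IsPathCover G (l :: L) X) :
    IsPathCover G (l.reverse :: L) X := by
  have hperm : (l.reverse :: L).flatten.Perm (l :: L).flatten := by
    simp only [List.flatten_cons]
    exact l.reverse_perm.append_right _
  refine ⟨?_, ?_, hperm.nodup_iff.2 H.nodup, fun x ↦ by rw [← H.mem_iff, hperm.mem_iff]⟩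
  · intro m hm
    rcases List.mem_cons.1 hm with rfl | hm
    · simpa using H.ne_nil l (by simp)
    · exact H.ne_nil m (List.mem_cons_of_mem _ hm)
  · intro m hm
    rcases List.mem_cons.1 hm with rfl | hm
    · rw [List.isChain_reverse]
      exact (H.chain l (by simp)).imp fun _ _ h ↦ h.symm
    · exact H.chain m (List.mem_cons_of_mem _ hm)

theorem merge {l l' : List V} (H : IsPathCover G (l :: l' :: L) X) {a b : V}
    (ha : l.getLast? = some a) (hb : l'.head? = some b) (hab : G.Adj a b) :
    IsPathCover G ((l ++ l') :: L) X := by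
  have hfl : ((l ++ l') :: L).flatten = (l :: l' :: L).flatten := by simp
  refine ⟨?_, ?_, hfl ▸ H.nodup, fun x ↦ by rw [← H.mem_iff, hfl]⟩
  · intro m hm
    rcases List.mem_cons.1 hm with rfl | hm
    · simp [H.ne_nil l (by simp)]
    · exact H.ne_nil m (by simp [hm])
  · intro m hm
    rcases List.mem_cons.1 hm with rfl | hm
    · refine List.isChain_append.2 ⟨H.chain l (by simp), H.chain l' (by simp), ?_⟩
      intro x hx y hy
      rw [ha] at hx
      rw [hb] at hy
      rw [← Option.some_injective _ hx, ← Option.some_injective _ hy]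
      exact hab
    · exact H.chain m (by simp [hm])

end IsPathCover

/-- A partition of `X` into paths such that two ends of different paths are never adjacent. -/
structure IsReducedCover (G : SimpleGraph V) (L : List (List V)) (X : Set V) : Prop
    extends IsPathCover G L X where
  not_adj : ∀ l ∈ L, ∀ l' ∈ L, l ≠ l' → ∀ a b, (l.head? = some a ∨ l.getLast? = some a) →
    (l'.head? = some b ∨ l'.getLast? = some b) → ¬ G.Adj a b

theorem IsReducedCover.perm {L L' : List (List V)} {X : Set V} (H : IsReducedCover G L X)
    (h : L.Perm L') : IsReducedCover G L' X where
  toIsPathCover := H.toIsPathCover.perm h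
  not_adj l hl l' hl' := H.not_adj l (h.mem_iff.2 hl) l' (h.mem_iff.2 hl')

/-- Start from one-vertex paths and join two paths whenever ends of them are adjacent; each join
lowers the number of paths. -/
theorem exists_isReducedCover {X : Set V} (hX : X.Finite) : ∃ L, IsReducedCover G L X := by
  classical
  have hinit : ∃ L, IsPathCover G L X := by
    refine ⟨hX.toFinset.toList.map fun x ↦ [x], ?_, ?_, ?_, ?_⟩
    · simp
    · simp
    · have : (hX.toFinset.toList.map fun x ↦ [x]).flatten = hX.toFinset.toList := by
        rw [← List.flatMap_def]
        simp
      rw [this]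
      exact Finset.nodup_toList _
    · intro x
      simp
  obtain ⟨L, hL⟩ := hinit
  induction hk : L.length using Nat.strong_induction_on generalizing L with
  | _ k ih =>
    by_cases hred : ∀ l ∈ L, ∀ l' ∈ L, l ≠ l' → ∀ a b,
        (l.head? = some a ∨ l.getLast? = some a) → (l'.head? = some b ∨ l'.getLast? = some b) →
        ¬ G.Adj a b
    · exact ⟨L, hL, hred⟩
    push Not at hred
    obtain ⟨l, hl, l', hl', hne, a, b, ha, hb, hab⟩ := hred
    have hl'e : l' ∈ L.erase l := (List.mem_erase_of_ne hne.symm).2 hl'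
    have hperm : L.Perm (l :: l' :: (L.erase l).erase l') :=
      (List.perm_cons_erase hl).trans ((List.perm_cons_erase hl'e).cons l)
    set R := (L.erase l).erase l'
    have hlen : L.length = R.length + 2 := by simpa using hperm.length_eq
    have h1 : IsPathCover G (l :: l' :: R) X := hL.perm hperm
    have h2 : ∃ m, IsPathCover G (m :: l' :: R) X ∧ m.getLast? = some a := by
      rcases ha with ha | ha
      · exact ⟨l.reverse, h1.reverse_head, by simpa using ha⟩
      · exact ⟨l, h1, ha⟩
    obtain ⟨m, h2, hm⟩ := h2
    have h3 : ∃ m', IsPathCover G (m :: m' :: R) X ∧ m'.head? = some b := by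
      rcases hb with hb | hb
      · exact ⟨l', h2, hb⟩
      · exact ⟨l'.reverse,
          (h2.perm (List.Perm.swap _ _ _)).reverse_head.perm (List.Perm.swap _ _ _),
          by simpa using hb⟩
    obtain ⟨m', h3, hm'⟩ := h3
    exact ih _ (by simp only [List.length_cons]; omega) ((m ++ m') :: R) (h3.merge hm hm' hab) rfl

theorem IsPathCover.exists_heads {L : List (List V)} {X : Set V} (H : IsPathCover G L X) :
    ∃ s : Finset V, s.card = L.length ∧ ∀ a ∈ s, a ∈ X ∧ ∃ l ∈ L, l.head? = some a := by
  classical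
  rcases eq_or_ne L [] with rfl | hL
  · exact ⟨∅, by simp⟩
  obtain ⟨l₀, hl₀⟩ := List.exists_mem_of_ne_nil _ hL
  obtain ⟨x₀, -⟩ := List.exists_mem_of_ne_nil _ (H.ne_nil l₀ hl₀)
  let f : List V → V := fun l ↦ l.head?.getD x₀
  have hf : ∀ l ∈ L, l.head? = some (f l) := by
    intro l hl
    obtain ⟨a, -, ha, -⟩ := exists_head_last (H.ne_nil l hl)
    simp [f, ha]
  have hnd : L.Nodup := by
    refine ((List.nodup_flatten.1 H.nodup).2.imp_of_mem ?_)
    rintro a b ha - hab rfl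
    obtain ⟨x, hx⟩ := List.exists_mem_of_ne_nil _ (H.ne_nil a ha)
    exact hab hx hx
  have hinj : ∀ l ∈ L, ∀ l' ∈ L, f l = f l' → l = l' := by
    intro l hl l' hl' hll
    refine eq_of_mem_of_nodup_flatten H.nodup hl hl' (List.mem_of_mem_head? (hf l hl)) ?_
    rw [hll]
    exact List.mem_of_mem_head? (hf l' hl')
  refine ⟨(L.map f).toFinset, ?_, ?_⟩
  · rw [List.toFinset_card_of_nodup (hnd.map_on hinj), List.length_map]
  · intro a ha
    obtain ⟨l, hl, rfl⟩ := List.mem_map.1 (List.mem_toFinset.1 ha)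
    exact ⟨(H.mem_iff _).1 (List.mem_flatten.2 ⟨l, hl, List.mem_of_mem_head? (hf l hl)⟩),
      l, hl, hf l hl⟩

theorem IsReducedCover.not_adj_heads {L : List (List V)} {X : Set V} (H : IsReducedCover G L X)
    {a b : V} (ha : ∃ l ∈ L, l.head? = some a) (hb : ∃ l ∈ L, l.head? = some b) :
    ¬ G.Adj a b := by
  obtain ⟨l, hl, ha⟩ := ha
  obtain ⟨l', hl', hb⟩ := hb
  by_cases hll : l = l'
  · subst hll
    rw [ha] at hb
    rw [Option.some_injective _ hb]
    exact G.irrefl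
  · exact H.not_adj l hl l' hl' hll a b (Or.inl ha) (Or.inl hb)

theorem IsReducedCover.length_le {L : List (List V)} {X : Set V} (H : IsReducedCover G L X)
    {m : ℕ} (hX : IndepBound G X m) : L.length ≤ m := by
  obtain ⟨s, hs, hsX⟩ := H.exists_heads
  rw [← hs]
  exact hX s (fun a ha ↦ (hsX a ha).1) fun a ha b hb ↦
    H.not_adj_heads (hsX a ha).2 (hsX b hb).2

section Pairing

theorem isPairing_false : IsPairing G r n fun _ _ ↦ False := by
  constructor <;> simp

theorem isPairing_two [G.LocallyFinite] (hd : 2 ≤ G.degree r) (h3 : G.degree r = 2 → n = 3)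
    {y z b b' : V} (hy : G.Adj r y) (hz : G.Adj r z) (hb : G.Adj r b) (hb' : G.Adj r b')
    (hyz : y ≠ z) (hbb : b ≠ b') (hyb : y ≠ b) (hyb' : y ≠ b') (hzb : z ≠ b) (hzb' : z ≠ b')
    (huy : (upper G r y).Nonempty) (hub : (upper G r b).Nonempty) :
    IsPairing G r n fun u w ↦ (u = y ∧ w = z) ∨ (u = b ∧ w = b') where
  adj_left := by rintro u w (⟨rfl, rfl⟩ | ⟨rfl, rfl⟩) <;> assumption
  adj_right := by rintro u w (⟨rfl, rfl⟩ | ⟨rfl, rfl⟩) <;> assumption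
  ne := by rintro u w (⟨rfl, rfl⟩ | ⟨rfl, rfl⟩) <;> assumption
  upper_left := by rintro u w (⟨rfl, rfl⟩ | ⟨rfl, rfl⟩) <;> assumption
  unique_right := by
    rintro u w w' (⟨rfl, rfl⟩ | ⟨rfl, rfl⟩) (⟨h1, rfl⟩ | ⟨h1, rfl⟩)
    · rfl
    · exact absurd h1 hyb
    · exact absurd h1.symm hyb
    · rfl
  unique_left := by
    rintro u u' w (⟨rfl, rfl⟩ | ⟨rfl, rfl⟩) (⟨rfl, h1⟩ | ⟨rfl, h1⟩)
    · rfl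
    · exact absurd h1 hzb'
    · exact absurd h1.symm hzb'
    · rfl
  disj := by
    rintro u w x (⟨rfl, rfl⟩ | ⟨rfl, rfl⟩) (⟨h1, rfl⟩ | ⟨h1, rfl⟩)
    · exact hyz h1.symm
    · exact hzb h1
    · exact hyb' h1.symm
    · exact hbb h1.symm
  eq_three := by
    classical
    intro u w _ hX
    refine h3 (le_antisymm ?_ hd)
    rw [← card_neighborFinset_eq_degree]
    refine (Finset.card_le_card (t := {u, w}) fun x hx ↦ ?_).trans Finset.card_le_two
    simpa using hX x (by simpa using hx)

theorem isPairing_one [G.LocallyFinite] (hd : 2 ≤ G.degree r) (h3 : G.degree r = 2 → n = 3)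
    {y z : V} (hy : G.Adj r y) (hz : G.Adj r z) (hyz : y ≠ z) (huy : (upper G r y).Nonempty) :
    IsPairing G r n fun u w ↦ u = y ∧ w = z where
  adj_left := by rintro u w ⟨rfl, rfl⟩; assumption
  adj_right := by rintro u w ⟨rfl, rfl⟩; assumption
  ne := by rintro u w ⟨rfl, rfl⟩; assumption
  upper_left := by rintro u w ⟨rfl, rfl⟩; assumption
  unique_right := by rintro u w w' ⟨rfl, rfl⟩ ⟨-, rfl⟩; rfl
  unique_left := by rintro u u' w ⟨rfl, rfl⟩ ⟨rfl, -⟩; rfl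
  disj := by rintro u w x ⟨rfl, rfl⟩ ⟨h1, -⟩; exact hyz h1.symm
  eq_three := by
    classical
    intro u w _ hX
    refine h3 (le_antisymm ?_ hd)
    rw [← card_neighborFinset_eq_degree]
    refine (Finset.card_le_card (t := {u, w}) fun x hx ↦ ?_).trans Finset.card_le_two
    simpa using hX x (by simpa using hx)

end Pairing

variable [G.LocallyFinite]

/-- The neighbours of `t` lie among `r` and the neighbours of `r` other than `t`. These are
`G.degree r` vertices, so by minimality `t` is adjacent to all of them. -/
theorem adj_of_upper_eq_empty (hG : G.Connected) (hmin : ∀ v, G.degree r ≤ G.degree v) {t x : V}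
    (ht : G.Adj r t) (hte : upper G r t = ∅) (hx : G.Adj r x) (hxt : x ≠ t) : G.Adj t x := by
  classical
  have hsub : G.neighborFinset t ⊆ insert r ((G.neighborFinset r).erase t) := by
    intro c hc
    rw [mem_neighborFinset] at hc
    rw [Finset.mem_insert, Finset.mem_erase, mem_neighborFinset]
    have h1 := hG.dist_le_of_adj r hc
    rw [dist_eq_one_iff_adj.2 ht] at h1
    have h2 : G.dist r c ≠ 2 := fun h ↦ by
      have : c ∈ upper G r t := ⟨hc, h⟩
      rw [hte] at this
      exact this
    by_cases h0 : G.dist r c = 0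
    · exact Or.inl (hG.dist_eq_zero_iff.1 h0).symm
    · exact Or.inr ⟨hc.ne', dist_eq_one_iff_adj.1 (by omega)⟩
  have hpos : 0 < G.degree r := (G.degree_pos_iff_exists_adj r).2 ⟨t, ht⟩
  have heq := Finset.eq_of_subset_of_card_le hsub (by
    refine (Finset.card_insert_le _ _).trans ?_
    rw [Finset.card_erase_of_mem (by simpa using ht), card_neighborFinset_eq_degree,
      card_neighborFinset_eq_degree]
    have := hmin t
    omega)
  rw [← mem_neighborFinset, heq, Finset.mem_insert, Finset.mem_erase, mem_neighborFinset]
  exact Or.inr ⟨hxt, hx⟩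

/-- A neighbour of `x` is `r`, a neighbour of `r` outside `S`, or at distance two. Large `S` thus
forces many neighbours at distance two. -/
theorem card_le_ncard_upper (hG : G.Connected) {x : V} (hx : G.Adj r x)
    {S : Finset V} (hS : ∀ s ∈ S, G.Adj r s) (hxS : ∀ s ∈ S, ¬ G.Adj x s) :
    G.degree x + S.card ≤ (upper G r x).ncard + G.degree r + 1 := by
  classical
  have hfin : (upper G r x).Finite := finite_upper x
  have hsub : G.neighborFinset x ⊆
      insert r ((G.neighborFinset r \ S) ∪ hfin.toFinset) := by
    intro c hc
    rw [mem_neighborFinset] at hc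
    have h1 := hG.dist_le_of_adj r hc
    rw [dist_eq_one_iff_adj.2 hx] at h1
    simp only [Finset.mem_insert, Finset.mem_union, Finset.mem_sdiff, mem_neighborFinset,
      hfin.mem_toFinset]
    by_cases h0 : G.dist r c = 0
    · exact Or.inl (hG.dist_eq_zero_iff.1 h0).symm
    by_cases h2 : G.dist r c = 2
    · exact Or.inr (Or.inr ⟨hc, h2⟩)
    · exact Or.inr (Or.inl ⟨dist_eq_one_iff_adj.1 (by omega), fun h ↦ hxS c h hc⟩)
  have h1 := Finset.card_le_card hsub
  have h2 := Finset.card_insert_le r ((G.neighborFinset r \ S) ∪ hfin.toFinset)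
  have h3 := Finset.card_union_le (G.neighborFinset r \ S) hfin.toFinset
  have hSr : S ⊆ G.neighborFinset r := fun s hs ↦ by simpa using hS s hs
  have h4 := Finset.card_sdiff_add_card_eq_card hSr
  rw [card_neighborFinset_eq_degree] at h1 h4
  rw [Set.ncard_eq_toFinset_card _ hfin]
  omega

theorem IsPathCover.length_le_degree {L : List (List V)} {X : Set V} (H : IsPathCover G L X)
    (hX : X ⊆ G.neighborSet r) : L.length ≤ G.degree r := by
  obtain ⟨s, hs, hsX⟩ := H.exists_heads
  rw [← hs, ← card_neighborFinset_eq_degree]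
  exact Finset.card_le_card fun a ha ↦ by simpa using hX (hsX a ha).1

end SimpleGraph

/-! ### Existence of layouts -/

namespace SimpleGraph

variable {V : Type*} {G : SimpleGraph V} {r : V} {n : ℕ}

theorem IsPathCover.append_clique {l t : List V} {L : List (List V)} {X Y : Set V}
    (H : IsPathCover G (l :: L) X) (ht : t ≠ []) (htn : t.Nodup) (htX : ∀ x ∈ t, x ∉ X)
    (hY : ∀ x, x ∈ Y ↔ x ∈ X ∨ x ∈ t) (hadj : ∀ x ∈ t, ∀ y ∈ Y, y ≠ x → G.Adj x y) :
    IsPathCover G ((l ++ t) :: L) Y := by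
  have hperm : ((l ++ t) :: L).flatten.Perm ((l :: L).flatten ++ t) := by
    simp only [List.flatten_cons, List.append_assoc]
    exact List.perm_append_comm.append_left l
  have hlX : ∀ x ∈ l, x ∈ X := fun x hx ↦ (H.mem_iff x).1 (by simp [hx])
  refine ⟨?_, ?_, ?_, ?_⟩
  · intro m hm
    rcases List.mem_cons.1 hm with rfl | hm
    · simp [ht]
    · exact H.ne_nil m (by simp [hm])
  · intro m hm
    rcases List.mem_cons.1 hm with rfl | hm
    · refine List.isChain_append.2 ⟨H.chain l (by simp), ?_, ?_⟩
      · refine List.Pairwise.isChain (htn.imp_of_mem fun {a b} ha hb hab ↦ ?_)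
        exact hadj a ha b ((hY b).2 (Or.inr hb)) hab.symm
      · intro x hx y hy
        have hxl := hlX x (List.mem_of_getLast? hx)
        have hyt := List.mem_of_mem_head? hy
        exact (hadj y hyt x ((hY x).2 (Or.inl hxl)) fun h ↦ htX y hyt (h ▸ hxl)).symm
    · exact H.chain m (by simp [hm])
  · rw [hperm.nodup_iff, List.nodup_append]
    refine ⟨H.nodup, htn, ?_⟩
    rintro a ha b hb rfl
    exact htX a hb ((H.mem_iff a).1 ha)
  · intro x
    rw [hperm.mem_iff, List.mem_append, H.mem_iff, hY]

theorem exists_isLayout_of_length_le {L : List (List V)} (H : IsPathCover G L (G.neighborSet r))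
    (hup : ∀ x, G.Adj r x → (upper G r x).Nonempty) (hL : L.length ≤ n - 3) :
    ∃ Pr zs os, IsLayout G r n Pr zs os := by
  refine ⟨fun _ _ ↦ False, [], L, isPairing_false, H, hL, fun x hx ↦ ⟨hup x ?_,
    Or.inr ⟨fun _ ↦ id, fun _ ↦ id⟩⟩, by simp, by simp⟩
  exact (H.mem_iff x).1 (List.mem_flatten.2 ⟨[x], hx, by simp⟩)

variable [G.LocallyFinite]

/-- The neighbours `t` of `r` without neighbours at distance two are adjacent to all other
neighbours of `r`, so they can be appended to any path. An end in `t` and an end outside it have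
different numbers of neighbours at distance two. If the cover of the remaining neighbours has `n -
1` paths, `t` also links two of them into one, whose ends are then paired. -/
theorem exists_isLayout_of_twin (hn : 2 < n) (hG : G.Connected) (hfree : G.IndFree (star n))
    (hmin : ∀ v, G.degree r ≤ G.degree v) (hd : 2 ≤ G.degree r)
    (hT : ∃ t, G.Adj r t ∧ upper G r t = ∅) (hne : ∃ x, G.Adj r x ∧ (upper G r x).Nonempty) :
    ∃ Pr zs os, IsLayout G r n Pr zs os := by
  classical
  set X : Set V := {x | G.Adj r x ∧ (upper G r x).Nonempty} with hX
  have hXN : X ⊆ G.neighborSet r := fun x hx ↦ hx.1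
  obtain ⟨L, H⟩ := exists_isReducedCover (G := G) ((Set.toFinite (G.neighborSet r)).subset hXN)
  have hlen := H.length_le ((hfree.indepBound (by omega) r).mono hXN)
  set t := ((G.neighborFinset r).filter fun x ↦ upper G r x = ∅).toList with ht
  have hmt : ∀ x, x ∈ t ↔ G.Adj r x ∧ upper G r x = ∅ := fun x ↦ by simp [ht]
  obtain ⟨t₀, ht₀⟩ := hT
  have htne : t ≠ [] := List.ne_nil_of_mem ((hmt t₀).2 ht₀)
  have htX : ∀ x ∈ t, x ∉ X := fun x hx h ↦ h.2.ne_empty ((hmt x).1 hx).2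
  have hY : ∀ x, x ∈ G.neighborSet r ↔ x ∈ X ∨ x ∈ t := by
    intro x
    rw [hmt, mem_neighborSet]
    constructor
    · intro h
      rcases (upper G r x).eq_empty_or_nonempty with h1 | h1
      · exact Or.inr ⟨h, h1⟩
      · exact Or.inl ⟨h, h1⟩
    · rintro (h | h)
      · exact h.1
      · exact h.1
  have hadj : ∀ x ∈ t, ∀ y ∈ G.neighborSet r, y ≠ x → G.Adj x y := fun x hx y hy hyx ↦
    adj_of_upper_eq_empty hG hmin ((hmt x).1 hx).1 ((hmt x).1 hx).2 hy hyx
  obtain ⟨t₁, t₂, ht₁, ht₂⟩ := exists_head_last htne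
  have htpos : 0 < t.length := List.length_pos_of_ne_nil htne
  rcases L with _ | ⟨l, L⟩
  · obtain ⟨x, hx⟩ := hne
    have := (H.mem_iff x).2 hx
    simp at this
  have hcov := H.append_clique htne (Finset.nodup_toList _) htX hY hadj
  have hlne := H.ne_nil l (by simp)
  have hlpos : 0 < l.length := List.length_pos_of_ne_nil hlne
  obtain ⟨y, -, hy, -⟩ := exists_head_last hlne
  have hyl : y ∈ l := List.mem_of_mem_head? hy
  have hyX : y ∈ X := (H.mem_iff y).1 (by simp [hyl])
  have hsingle : ∀ x, [x] ∈ L → x ∈ X ∧ x ∈ L.flatten := by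
    intro x hx
    have h1 : x ∈ L.flatten := List.mem_flatten.2 ⟨[x], hx, by simp⟩
    exact ⟨(H.mem_iff x).1 (by simp only [List.flatten_cons, List.mem_append, h1, or_true]), h1⟩
  rcases Nat.lt_or_ge L.length (n - 2) with hL | hL
  · refine ⟨fun _ _ ↦ False, [l ++ t], L, isPairing_false, hcov, by omega, ?_, ?_, ?_⟩
    · intro x hx
      rcases List.mem_cons.1 hx with hx | hx
      · have := congrArg List.length hx
        simp only [List.length_append, List.length_singleton] at this
        omega
      · exact ⟨(hsingle x hx).1.2, Or.inr ⟨fun _ ↦ id, fun _ ↦ id⟩⟩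
    · intro m hm a b ha hb _
      obtain rfl := List.mem_singleton.1 hm
      rw [List.head?_append_of_ne_nil _ hlne, hy] at ha
      rw [List.getLast?_append_of_ne_nil _ htne, ht₂] at hb
      obtain rfl := Option.some_injective _ ha
      obtain rfl := Option.some_injective _ hb
      left
      rw [((hmt _).1 (List.mem_of_getLast? ht₂)).2, Set.ncard_empty]
      exact ((Set.ncard_pos (finite_upper _)).2 hyX.2).ne'
    · intro m hm m' hm' hmm
      rw [List.mem_singleton.1 hm, List.mem_singleton.1 hm'] at hmm
      exact absurd rfl hmm
  · rcases L with _ | ⟨l', L⟩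
    · simp only [List.length_nil] at hL
      omega
    have hl'ne := H.ne_nil l' (by simp)
    obtain ⟨b₁, z, hb₁, hz⟩ := exists_head_last hl'ne
    have hzl : z ∈ l' := List.mem_of_getLast? hz
    have hzX : z ∈ X := (H.mem_iff z).1 (by simp [hzl])
    have hb₁X : b₁ ∈ X := (H.mem_iff b₁).1 (by simp [List.mem_of_mem_head? hb₁])
    have hcov' : IsPathCover G ((l ++ t ++ l') :: L) (G.neighborSet r) := by
      refine hcov.merge (a := t₂) (b := b₁) ?_ hb₁ ?_
      · rw [List.getLast?_append_of_ne_nil _ htne, ht₂]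
      · have h2 := List.mem_of_getLast? ht₂
        exact hadj t₂ h2 b₁ hb₁X.1 fun h ↦ htX t₂ h2 (h ▸ hb₁X)
    have hnd := H.nodup
    simp only [List.flatten_cons] at hnd
    have hd1 := List.disjoint_of_nodup_append hnd
    have hd2 := List.disjoint_of_nodup_append (List.nodup_append.1 hnd).2.1
    have hyz : y ≠ z := fun h ↦ hd1 hyl (List.mem_append_left _ (h ▸ hzl))
    have hdeg : G.degree r = 2 → n = 3 := by
      intro h2
      obtain ⟨s, hs, hsX⟩ := H.exists_heads
      have hts : t₀ ∉ s := fun h ↦ htX t₀ ((hmt t₀).2 ht₀) (hsX t₀ h).1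
      have h4 : (insert t₀ s).card ≤ G.degree r := by
        rw [← card_neighborFinset_eq_degree]
        refine Finset.card_le_card fun x hx ↦ ?_
        rcases Finset.mem_insert.1 hx with rfl | hx
        · simpa using ht₀.1
        · simpa using (hsX x hx).1.1
      rw [Finset.card_insert_of_notMem hts, hs] at h4
      simp only [List.length_cons] at h4 hL
      omega
    refine ⟨fun u w ↦ u = y ∧ w = z, [l ++ t ++ l'], L,
      isPairing_one hd hdeg hyX.1 hzX.1 hyz hyX.2, hcov', ?_, ?_, ?_, ?_⟩
    · simp only [List.length_cons] at hlen
      omega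
    · intro x hx
      rcases List.mem_cons.1 hx with hx | hx
      · have := congrArg List.length hx
        simp only [List.length_append, List.length_singleton] at this
        omega
      · have hx' := (hsingle x (List.mem_cons_of_mem _ hx)).1
        have hxL : x ∈ L.flatten := List.mem_flatten.2 ⟨[x], hx, by simp⟩
        have hxy : x ≠ y := fun h ↦ hd1 hyl (List.mem_append_right _ (h ▸ hxL))
        have hxz : x ≠ z := fun h ↦ hd2 hzl (h ▸ hxL)
        exact ⟨hx'.2, Or.inr ⟨fun w h ↦ hxy h.1, fun u h ↦ hxz h.2⟩⟩
    · intro m hm a b ha hb _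
      obtain rfl := List.mem_singleton.1 hm
      rw [List.append_assoc, List.head?_append_of_ne_nil _ hlne, hy] at ha
      rw [List.getLast?_append_of_ne_nil _ hl'ne, hz] at hb
      obtain rfl := Option.some_injective _ ha
      obtain rfl := Option.some_injective _ hb
      exact Or.inr (Or.inl ⟨rfl, rfl⟩)
    · intro m hm m' hm' hmm
      rw [List.mem_singleton.1 hm, List.mem_singleton.1 hm'] at hmm
      exact absurd rfl hmm

/-- Only `l` lacks a colour of its own; pairing its two ends, if they differ, orients it. -/
theorem exists_isLayout_of_length_eq {l : List V} {L : List (List V)} (hn : 2 < n)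
    (hd : 2 ≤ G.degree r) (H : IsPathCover G (l :: L) (G.neighborSet r))
    (hup : ∀ x, G.Adj r x → (upper G r x).Nonempty) (hL : L.length = n - 3) :
    ∃ Pr zs os, IsLayout G r n Pr zs os := by
  classical
  have hlne := H.ne_nil l (by simp)
  have hmem : ∀ x ∈ l, G.Adj r x := fun x hx ↦ (H.mem_iff x).1 (by simp [hx])
  have hmemL : ∀ x, [x] ∈ l :: L → G.Adj r x := fun x hx ↦
    (H.mem_iff x).1 (List.mem_flatten.2 ⟨[x], hx, by simp⟩)
  obtain ⟨y, z, hy, hz⟩ := exists_head_last hlne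
  have hyl := List.mem_of_mem_head? hy
  have hzl := List.mem_of_getLast? hz
  have hnd := H.nodup
  simp only [List.flatten_cons] at hnd
  have hdis := List.disjoint_of_nodup_append hnd
  have hlnd : l.Nodup := (List.nodup_append.1 hnd).1
  have hlists : ∀ Pr : V → V → Prop, ∀ m ∈ [l], ∀ m' ∈ [l], m ≠ m' → m.length = m'.length →
      ∃ a a', m = [a] ∧ m' = [a'] ∧ Distinguished G r Pr a a' := by
    intro Pr m hm m' hm' hmm
    rw [List.mem_singleton.1 hm, List.mem_singleton.1 hm'] at hmm
    exact absurd rfl hmm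
  by_cases hyz : y = z
  · refine ⟨fun _ _ ↦ False, [l], L, isPairing_false, H, hL.le, fun x hx ↦ ⟨hup x (hmemL x hx),
      Or.inr ⟨fun _ ↦ id, fun _ ↦ id⟩⟩, ?_, hlists _⟩
    intro m hm a b ha hb hab
    obtain rfl := List.mem_singleton.1 hm
    rw [hy] at ha
    rw [hz] at hb
    exact absurd ((Option.some_injective _ ha).symm.trans
      (hyz.trans (Option.some_injective _ hb))) hab
  have hdeg : G.degree r = 2 → n = 3 := by
    intro h2
    obtain ⟨s, hs, hsX⟩ := H.exists_heads
    have hzs : z ∉ s := by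
      intro h
      obtain ⟨m, hm, hmz⟩ := (hsX z h).2
      obtain rfl := eq_of_mem_of_nodup_flatten H.nodup hm (by simp : l ∈ l :: L)
        (List.mem_of_mem_head? hmz) hzl
      rw [hy] at hmz
      exact hyz (Option.some_injective _ hmz)
    have h4 : (insert z s).card ≤ G.degree r := by
      rw [← card_neighborFinset_eq_degree]
      refine Finset.card_le_card fun x hx ↦ ?_
      rcases Finset.mem_insert.1 hx with rfl | hx
      · simpa using hmem _ hzl
      · simpa using (hsX x hx).1
    rw [Finset.card_insert_of_notMem hzs, hs] at h4
    simp only [List.length_cons] at h4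
    omega
  refine ⟨fun u w ↦ u = y ∧ w = z, [l], L,
    isPairing_one hd hdeg (hmem y hyl) (hmem z hzl) hyz (hup y (hmem y hyl)), H, hL.le, ?_, ?_,
    hlists _⟩
  · intro x hx
    refine ⟨hup x (hmemL x hx), Or.inr ?_⟩
    rcases List.mem_cons.1 hx with hx | hx
    · rw [← hx] at hy hz
      simp only [List.head?_cons, List.getLast?_singleton, Option.some.injEq] at hy hz
      exact absurd (hy.symm.trans hz) hyz
    · have hxL : x ∈ L.flatten := List.mem_flatten.2 ⟨[x], hx, by simp⟩
      exact ⟨fun w h ↦ hdis hyl (h.1 ▸ hxL), fun u h ↦ hdis hzl (h.2 ▸ hxL)⟩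
  · intro m hm a b ha hb _
    obtain rfl := List.mem_singleton.1 hm
    rw [hy] at ha
    rw [hz] at hb
    exact Or.inr (Or.inl ⟨(Option.some_injective _ ha).symm, (Option.some_injective _ hb).symm⟩)

/-- The two single vertices are told apart by their numbers of neighbours at distance two or, if
these agree, by pairing them. A paired single vertex must have at least two such neighbours to keep
an edge of colour 1. -/
theorem exists_isLayout_of_singles {y b : V} {L : List (List V)} (hn : 2 < n) (hG : G.Connected)
    (hmin : ∀ v, G.degree r ≤ G.degree v) (hd : 2 ≤ G.degree r)
    (H : IsReducedCover G ([y] :: [b] :: L) (G.neighborSet r))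
    (hup : ∀ x, G.Adj r x → (upper G r x).Nonempty) (hL : L.length = n - 3)
    (h3 : n = 3 → G.degree r = 2 → ∃ x, G.Adj r x ∧ 3 ≤ G.degree x) :
    ∃ Pr zs os, IsLayout G r n Pr zs os := by
  classical
  have hnd := H.nodup
  have hdeg : G.degree r = 2 → n = 3 := fun h2 ↦ by
    have := H.length_le_degree le_rfl
    simp only [List.length_cons] at this
    omega
  have hmem : ∀ x, x ∈ ([y] :: [b] :: L).flatten → G.Adj r x := fun x hx ↦ (H.mem_iff x).1 hx
  have hy : G.Adj r y := hmem y (by simp)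
  have hb : G.Adj r b := hmem b (by simp)
  simp only [List.flatten_cons, List.singleton_append, List.nodup_cons, List.mem_cons,
    not_or] at hnd
  obtain ⟨⟨hyb, hyL⟩, hbL, -⟩ := hnd
  have hsm : ∀ x, [x] ∈ [y] :: [b] :: L → G.Adj r x := fun x hx ↦
    hmem x (List.mem_flatten.2 ⟨[x], hx, by simp⟩)
  have hends : ∀ Pr : V → V → Prop, ∀ l ∈ [[y], [b]], ∀ a b, l.head? = some a →
      l.getLast? = some b → a ≠ b → Distinguished G r Pr a b := by
    intro Pr l hl a b ha hb hab
    simp only [List.mem_cons, List.not_mem_nil, or_false] at hl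
    rcases hl with rfl | rfl <;>
    · simp only [List.head?_cons, List.getLast?_singleton, Option.some.injEq] at ha hb
      exact absurd (ha.symm.trans hb) hab
  have hlists : ∀ Pr : V → V → Prop, Distinguished G r Pr y b → Distinguished G r Pr b y →
      ∀ m ∈ [[y], [b]], ∀ m' ∈ [[y], [b]], m ≠ m' → m.length = m'.length →
      ∃ a a', m = [a] ∧ m' = [a'] ∧ Distinguished G r Pr a a' := by
    intro Pr h1 h2 m hm m' hm' hmm _
    simp only [List.mem_cons, List.not_mem_nil, or_false] at hm hm'
    rcases hm with rfl | rfl <;> rcases hm' with rfl | rfl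
    · exact absurd rfl hmm
    · exact ⟨y, b, rfl, rfl, h1⟩
    · exact ⟨b, y, rfl, rfl, h2⟩
    · exact absurd rfl hmm
  by_cases hcard : (upper G r y).ncard = (upper G r b).ncard
  · obtain ⟨s, hs, hsX⟩ := H.exists_heads
    simp only [List.length_cons] at hs
    have hge : ∀ x, (∃ l ∈ [y] :: [b] :: L, l.head? = some x) → G.Adj r x →
        G.degree x + s.card ≤ (upper G r x).ncard + G.degree r + 1 := fun x hx hrx ↦
      card_le_ncard_upper hG hrx (fun a ha ↦ (hsX a ha).1)
        fun a ha ↦ H.not_adj_heads hx (hsX a ha).2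
    have hgy := hge y ⟨[y], by simp, rfl⟩ hy
    have hgb := hge b ⟨[b], by simp, rfl⟩ hb
    -- The `n - 1` starts of paths are pairwise nonadjacent, which gives at least `n - 2`. For `n =
    -- 3` the missing one comes from the neighbour of degree at least three, which is `y` or `b`;
    -- the counts of both agree.
    have h2 : 2 ≤ (upper G r y).ncard := by
      have hmy := hmin y
      have hmb := hmin b
      rcases Nat.eq_or_lt_of_le hn with hn3 | hn3
      · have hL0 : L = [] := List.length_eq_zero_iff.1 (by rw [hL, ← hn3])
        subst hL0
        have hd2 : G.degree r = 2 := by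
          refine le_antisymm ?_ hd
          rw [← card_neighborFinset_eq_degree]
          refine (Finset.card_le_card (t := {y, b}) fun x hx ↦ ?_).trans Finset.card_le_two
          have := (H.mem_iff x).2 (by simpa using hx)
          simpa using this
        obtain ⟨x, hx, hx3⟩ := h3 hn3.symm hd2
        clear h3
        have := (H.mem_iff x).2 hx
        simp only [List.flatten_cons, List.flatten_nil, List.append_nil, List.singleton_append,
          List.mem_cons, List.not_mem_nil, or_false] at this
        rcases this with h | h
        · rw [h] at hx3
          omega
        · rw [h] at hx3
          omega
      · clear h3
        omega
    refine ⟨fun u w ↦ u = y ∧ w = b, [[y], [b]], L,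
      isPairing_one hd hdeg hy hb hyb (hup y hy), H.toIsPathCover, hL.le, ?_, hends _,
      hlists _ (Or.inr (Or.inl ⟨rfl, rfl⟩)) (Or.inr (Or.inr ⟨rfl, rfl⟩))⟩
    intro x hx
    refine ⟨hup x (hsm x hx), ?_⟩
    by_cases hxy : x = y
    · exact Or.inl (hxy ▸ h2)
    by_cases hxb : x = b
    · left
      rw [hxb, ← hcard]
      exact h2
    · exact Or.inr ⟨fun w h ↦ hxy h.1, fun u h ↦ hxb h.2⟩
  · exact ⟨fun _ _ ↦ False, [[y], [b]], L, isPairing_false, H.toIsPathCover, hL.le,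
      fun x hx ↦ ⟨hup x (hsm x hx), Or.inr ⟨fun _ ↦ id, fun _ ↦ id⟩⟩, hends _,
      hlists _ (Or.inl hcard) (Or.inl (Ne.symm hcard))⟩

/-- The two paths have different lengths, so only `l` needs its ends paired. -/
theorem exists_isLayout_of_single {l : List V} {b : V} {L : List (List V)} (hn : 2 < n)
    (hd : 2 ≤ G.degree r) (H : IsPathCover G (l :: [b] :: L) (G.neighborSet r))
    (hup : ∀ x, G.Adj r x → (upper G r x).Nonempty) (hL : L.length = n - 3)
    (hl : 2 ≤ l.length) : ∃ Pr zs os, IsLayout G r n Pr zs os := by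
  classical
  have hnd := H.nodup
  have hdeg : G.degree r = 2 → n = 3 := fun h2 ↦ by
    have := H.length_le_degree le_rfl
    simp only [List.length_cons] at this
    omega
  have hlne := H.ne_nil l (by simp)
  obtain ⟨y, z, hy, hz⟩ := exists_head_last hlne
  have hyl := List.mem_of_mem_head? hy
  have hzl := List.mem_of_getLast? hz
  simp only [List.flatten_cons] at hnd
  have hdis := List.disjoint_of_nodup_append hnd
  have hyz := ne_of_two_le_length (List.nodup_append.1 hnd).1 hl hy hz
  have hmem : ∀ x, x ∈ (l :: [b] :: L).flatten → G.Adj r x := fun x hx ↦ (H.mem_iff x).1 hx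
  have hy' : G.Adj r y := hmem y (by simp [hyl])
  have hz' : G.Adj r z := hmem z (by simp [hzl])
  refine ⟨fun u w ↦ u = y ∧ w = z, [l, [b]], L,
    isPairing_one hd hdeg hy' hz' hyz (hup y hy'), H, hL.le, ?_, ?_, ?_⟩
  · intro x hx
    refine ⟨hup x (hmem x (List.mem_flatten.2 ⟨[x], hx, by simp⟩)), Or.inr ?_⟩
    rcases List.mem_cons.1 hx with hx | hx
    · rw [← hx] at hl
      simp at hl
    · have hxL : x ∈ ([b] :: L).flatten := List.mem_flatten.2 ⟨[x], hx, by simp⟩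
      exact ⟨fun w h ↦ hdis hyl (h.1 ▸ hxL), fun u h ↦ hdis hzl (h.2 ▸ hxL)⟩
  · intro m hm a c ha hc hac
    simp only [List.mem_cons, List.not_mem_nil, or_false] at hm
    rcases hm with rfl | rfl
    · rw [hy] at ha
      rw [hz] at hc
      exact Or.inr (Or.inl ⟨(Option.some_injective _ ha).symm, (Option.some_injective _ hc).symm⟩)
    · simp only [List.head?_cons, List.getLast?_singleton, Option.some.injEq] at ha hc
      exact absurd (ha.symm.trans hc) hac
  · intro m hm m' hm' hmm hlen
    simp only [List.mem_cons, List.not_mem_nil, or_false] at hm hm'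
    rcases hm with rfl | rfl <;> rcases hm' with rfl | rfl
    · exact absurd rfl hmm
    · simp only [List.length_singleton] at hlen
      omega
    · simp only [List.length_singleton] at hlen
      omega
    · exact absurd rfl hmm

/-- Cutting the last vertex `e` off the shorter path makes the lengths of `l`, `q` and `[e]`
distinct, unless `q` is a single vertex. The ends of `l` are paired, and so are the ends of `q` or,
if `q` is a single vertex, that vertex and `e`. -/
theorem exists_isLayout_of_long {l q : List V} {e : V} {L : List (List V)} (hn : 2 < n)
    (hG : G.Connected) (hmin : ∀ v, G.degree r ≤ G.degree v)
    (hd : 2 ≤ G.degree r) (H : IsReducedCover G (l :: (q ++ [e]) :: L) (G.neighborSet r))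
    (hup : ∀ x, G.Adj r x → (upper G r x).Nonempty) (hL : L.length = n - 3)
    (hq : q ≠ []) (hl : (q ++ [e]).length ≤ l.length) : ∃ Pr zs os, IsLayout G r n Pr zs os := by
  classical
  have hnd := H.nodup
  have hdeg : G.degree r = 2 → n = 3 := fun h2 ↦ by
    have := H.length_le_degree le_rfl
    simp only [List.length_cons] at this
    omega
  have hqpos : 0 < q.length := List.length_pos_of_ne_nil hq
  simp only [List.length_append, List.length_singleton] at hl
  have hlne := H.ne_nil l (by simp)
  obtain ⟨y, z, hy, hz⟩ := exists_head_last hlne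
  obtain ⟨b, c, hb, hc⟩ := exists_head_last hq
  have hyl := List.mem_of_mem_head? hy
  have hzl := List.mem_of_getLast? hz
  have hbq := List.mem_of_mem_head? hb
  have hcq := List.mem_of_getLast? hc
  have hcover : IsPathCover G (l :: q :: [e] :: L) (G.neighborSet r) := by
    have hfl : (l :: q :: [e] :: L).flatten = (l :: (q ++ [e]) :: L).flatten := by simp
    refine ⟨?_, ?_, hfl ▸ H.nodup, fun x ↦ by rw [hfl, H.mem_iff]⟩
    · intro m hm
      simp only [List.mem_cons] at hm
      rcases hm with rfl | rfl | rfl | hm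
      · exact hlne
      · exact hq
      · simp
      · exact H.ne_nil m (by simp [hm])
    · intro m hm
      simp only [List.mem_cons] at hm
      rcases hm with rfl | rfl | rfl | hm
      · exact H.chain m (by simp)
      · exact (List.isChain_append.1 (H.chain (m ++ [e]) (by simp))).1
      · simp
      · exact H.chain m (by simp [hm])
  have hnd' := hcover.nodup
  simp only [List.flatten_cons] at hnd'
  have hdis1 := List.disjoint_of_nodup_append hnd'
  have hnd2 := (List.nodup_append.1 hnd').2.1
  have hdis2 := List.disjoint_of_nodup_append hnd2
  have hdis3 := List.disjoint_of_nodup_append (List.nodup_append.1 hnd2).2.1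
  have hyz := ne_of_two_le_length (List.nodup_append.1 hnd').1 (by omega) hy hz
  have hmem : ∀ x, x ∈ (l :: q :: [e] :: L).flatten → G.Adj r x := fun x hx ↦
    (hcover.mem_iff x).1 hx
  have hy' : G.Adj r y := hmem y (by simp [hyl])
  have hz' : G.Adj r z := hmem z (by simp [hzl])
  have hb' : G.Adj r b := hmem b (by simp [hbq])
  have hc' : G.Adj r c := hmem c (by simp [hcq])
  have he' : G.Adj r e := hmem e (by simp)
  have hlq : ∀ {x w}, x ∈ l → w ∈ q → x ≠ w := fun hx hw h ↦
    hdis1 hx (List.mem_append_left _ (h ▸ hw))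
  have hle : ∀ {x}, x ∈ l → x ≠ e := fun hx h ↦
    hdis1 hx (List.mem_append_right _ (List.mem_append_left _ (by simp [h])))
  have hqe : ∀ {x}, x ∈ q → x ≠ e := fun hx h ↦
    hdis2 hx (List.mem_append_left _ (by simp [h]))
  have hxmem : ∀ x, [x] ∈ [l, q, [e]] ++ L → G.Adj r x := fun x hx ↦
    hmem x (List.mem_flatten.2 ⟨[x], hx, by simp⟩)
  have hxL : ∀ x, [x] ∈ L → x ∉ l ∧ x ∉ q ∧ x ≠ e := by
    intro x hx
    have h1 : x ∈ L.flatten := List.mem_flatten.2 ⟨[x], hx, by simp⟩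
    refine ⟨fun h ↦ hdis1 h ?_, fun h ↦ hdis2 h ?_, fun h ↦ hdis3 (a := x) (by simp [h]) h1⟩
    · exact List.mem_append_right _ (List.mem_append_right _ h1)
    · exact List.mem_append_right _ h1
  rcases Nat.lt_or_ge q.length 2 with hq2 | hq2
  · obtain ⟨x, rfl⟩ := List.length_eq_one_iff.1 (show q.length = 1 by omega)
    obtain rfl : x = b := by simpa using hb
    have hbe : x ≠ e := hqe (by simp)
    -- Since the cover is reduced, `w` is adjacent to neither end of `l`. With `w` itself these are
    -- three neighbours of `r` not adjacent to `w`, so the degree count gives two vertices at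
    -- distance two.
    have hbig : ∀ w, ([x] ++ [e]).head? = some w ∨ ([x] ++ [e]).getLast? = some w →
        G.Adj r w → 2 ≤ (upper G r w).ncard := by
      intro w hw hrw
      have hw' : w = x ∨ w = e := by
        rcases hw with hw | hw
        · left
          simpa using hw.symm
        · right
          simpa using hw.symm
      have hwl : ∀ v ∈ l, v ≠ w := by
        rintro v hv rfl
        rcases hw' with h | h
        · exact hlq hv (by simp) h
        · exact hle hv h
      have hne : ([x] ++ [e] : List V) ≠ l := by
        intro h
        rcases hw' with rfl | rfl
        · exact hwl w (h ▸ by simp) rfl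
        · exact hwl w (h ▸ by simp) rfl
      have h1 := card_le_ncard_upper hG hrw (S := {w, y, z}) (by
        intro s hs
        simp only [Finset.mem_insert, Finset.mem_singleton] at hs
        rcases hs with rfl | rfl | rfl <;> assumption) (by
        intro s hs
        simp only [Finset.mem_insert, Finset.mem_singleton] at hs
        rcases hs with rfl | rfl | rfl
        · exact G.irrefl
        · exact H.not_adj _ (by simp) l (by simp) hne w _ hw (Or.inl hy)
        · exact H.not_adj _ (by simp) l (by simp) hne w _ hw (Or.inr hz))
      have h2 : ({w, y, z} : Finset V).card = 3 :=
        Finset.card_eq_three.2 ⟨w, y, z, (hwl y hyl).symm, (hwl z hzl).symm, hyz, rfl⟩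
      have h3 := hmin w
      omega
    refine ⟨fun u w ↦ (u = y ∧ w = z) ∨ (u = x ∧ w = e), [l, [x], [e]], L,
      isPairing_two hd hdeg hy' hz' hb' he' hyz hbe (hlq hyl hbq) (hle hyl) (hlq hzl hbq)
        (hle hzl) (hup y hy') (hup x hb'), hcover, hL.le, ?_, ?_, ?_⟩
    · intro v hv
      refine ⟨hup v (hxmem v hv), ?_⟩
      by_cases hvx : v = x
      · exact Or.inl (hbig v (Or.inl (by simp [hvx])) (hxmem v hv))
      by_cases hve : v = e
      · exact Or.inl (hbig v (Or.inr (by simp [hve])) (hxmem v hv))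
      have hv' : v ∉ l := by
        simp only [List.cons_append, List.nil_append, List.mem_cons, List.cons.injEq,
          and_true] at hv
        rcases hv with hv | hv | hv | hv
        · rw [← hv] at hl
          simp at hl
        · exact absurd hv hvx
        · exact absurd hv hve
        · exact (hxL v hv).1
      refine Or.inr ⟨fun w h ↦ ?_, fun u h ↦ ?_⟩
      · rcases h with h | h
        · exact hv' (h.1 ▸ hyl)
        · exact hvx h.1
      · rcases h with h | h
        · exact hv' (h.2 ▸ hzl)
        · exact hve h.2
    · intro m hm a d ha hd' had
      simp only [List.mem_cons, List.not_mem_nil, or_false] at hm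
      rcases hm with rfl | rfl | rfl
      · rw [hy] at ha
        rw [hz] at hd'
        exact Or.inr (Or.inl (Or.inl
          ⟨(Option.some_injective _ ha).symm, (Option.some_injective _ hd').symm⟩))
      all_goals
        simp only [List.head?_cons, List.getLast?_singleton, Option.some.injEq] at ha hd'
        exact absurd (ha.symm.trans hd') had
    · intro m hm m' hm' hmm hlen
      simp only [List.mem_cons, List.not_mem_nil, or_false] at hm hm'
      rcases hm with rfl | rfl | rfl <;> rcases hm' with rfl | rfl | rfl
      · exact absurd rfl hmm
      · simp only [List.length_singleton] at hlen hl
        omega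
      · simp only [List.length_singleton] at hlen hl
        omega
      · simp only [List.length_singleton] at hlen hl
        omega
      · exact absurd rfl hmm
      · exact ⟨x, e, rfl, rfl, Or.inr (Or.inl (Or.inr ⟨rfl, rfl⟩))⟩
      · simp only [List.length_singleton] at hlen hl
        omega
      · exact ⟨e, x, rfl, rfl, Or.inr (Or.inr (Or.inr ⟨rfl, rfl⟩))⟩
      · exact absurd rfl hmm
  · have hbc := ne_of_two_le_length (List.nodup_append.1 hnd2).1 hq2 hb hc
    refine ⟨fun u w ↦ (u = y ∧ w = z) ∨ (u = b ∧ w = c), [l, q, [e]], L,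
      isPairing_two hd hdeg hy' hz' hb' hc' hyz hbc (hlq hyl hbq) (hlq hyl hcq) (hlq hzl hbq)
        (hlq hzl hcq) (hup y hy') (hup b hb'), hcover, hL.le, ?_, ?_, ?_⟩
    · intro v hv
      refine ⟨hup v (hxmem v hv), Or.inr ?_⟩
      have hv' : v ∉ l ∧ v ∉ q := by
        simp only [List.cons_append, List.nil_append, List.mem_cons, List.cons.injEq,
          and_true] at hv
        rcases hv with hv | hv | hv | hv
        · rw [← hv] at hl
          simp only [List.length_singleton] at hl
          omega
        · rw [← hv] at hq2
          simp at hq2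
        · exact ⟨fun h ↦ hle h hv, fun h ↦ hqe h hv⟩
        · exact ⟨(hxL v hv).1, (hxL v hv).2.1⟩
      refine ⟨fun w h ↦ ?_, fun u h ↦ ?_⟩
      · rcases h with h | h
        · exact hv'.1 (h.1 ▸ hyl)
        · exact hv'.2 (h.1 ▸ hbq)
      · rcases h with h | h
        · exact hv'.1 (h.2 ▸ hzl)
        · exact hv'.2 (h.2 ▸ hcq)
    · intro m hm a d ha hd' had
      simp only [List.mem_cons, List.not_mem_nil, or_false] at hm
      rcases hm with rfl | rfl | rfl
      · rw [hy] at ha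
        rw [hz] at hd'
        exact Or.inr (Or.inl (Or.inl
          ⟨(Option.some_injective _ ha).symm, (Option.some_injective _ hd').symm⟩))
      · rw [hb] at ha
        rw [hc] at hd'
        exact Or.inr (Or.inl (Or.inr
          ⟨(Option.some_injective _ ha).symm, (Option.some_injective _ hd').symm⟩))
      · simp only [List.head?_cons, List.getLast?_singleton, Option.some.injEq] at ha hd'
        exact absurd (ha.symm.trans hd') had
    · intro m hm m' hm' hmm hlen
      exfalso
      have he1 : [e].length = 1 := rfl
      simp only [List.mem_cons, List.not_mem_nil, or_false] at hm hm'
      rcases hm with rfl | rfl | rfl <;> rcases hm' with rfl | rfl | rfl <;>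
        first | exact hmm rfl | omega

theorem exists_isLayout (hn : 2 < n) (hG : G.Connected) (hfree : G.IndFree (star n))
    (hmin : ∀ v, G.degree r ≤ G.degree v) (hd : 2 ≤ G.degree r)
    (hne : ∃ x, G.Adj r x ∧ (upper G r x).Nonempty)
    (h3 : (∀ x, G.Adj r x → (upper G r x).Nonempty) → n = 3 → G.degree r = 2 →
      ∃ x, G.Adj r x ∧ 3 ≤ G.degree x) :
    ∃ Pr zs os, IsLayout G r n Pr zs os := by
  by_cases hT : ∃ t, G.Adj r t ∧ upper G r t = ∅
  · exact exists_isLayout_of_twin hn hG hfree hmin hd hT hne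
  have hup : ∀ x, G.Adj r x → (upper G r x).Nonempty := fun x hx ↦
    Set.nonempty_iff_ne_empty.2 fun h ↦ hT ⟨x, hx, h⟩
  obtain ⟨L, H⟩ := exists_isReducedCover (G := G) (Set.toFinite (G.neighborSet r))
  have hlen := H.length_le (hfree.indepBound (by omega) r)
  rcases Nat.lt_or_ge (n - 3) L.length with h1 | h1
  swap
  · exact exists_isLayout_of_length_le H.toIsPathCover hup h1
  rcases L with _ | ⟨l, L⟩
  · simp at h1
  simp only [List.length_cons] at h1 hlen
  rcases Nat.eq_or_lt_of_le (show n - 3 ≤ L.length by omega) with h2 | h2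
  · exact exists_isLayout_of_length_eq hn hd H.toIsPathCover hup h2.symm
  rcases L with _ | ⟨l', L⟩
  · simp at h2
  simp only [List.length_cons] at h2 hlen
  have hL : L.length = n - 3 := by omega
  have key : ∀ l l' : List V, IsReducedCover G (l :: l' :: L) (G.neighborSet r) →
      l'.length ≤ l.length → ∃ Pr zs os, IsLayout G r n Pr zs os := by
    intro l l' H hle
    have hl' := H.ne_nil l' (by simp)
    have hl := H.ne_nil l (by simp)
    obtain ⟨q, e, rfl⟩ : ∃ q e, l' = q ++ [e] :=
      ⟨l'.dropLast, l'.getLast hl', (List.dropLast_append_getLast hl').symm⟩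
    rcases eq_or_ne q [] with rfl | hq
    · rw [List.nil_append] at H
      rcases Nat.lt_or_ge l.length 2 with h4 | h4
      · have hpos := List.length_pos_of_ne_nil hl
        obtain ⟨y, rfl⟩ := List.length_eq_one_iff.1 (show l.length = 1 by omega)
        exact exists_isLayout_of_singles hn hG hmin hd H hup hL (h3 hup)
      · exact exists_isLayout_of_single hn hd H.toIsPathCover hup hL h4
    · exact exists_isLayout_of_long hn hG hmin hd H hup hL hq hle
  rcases le_total l'.length l.length with h4 | h4
  · exact key l l' H h4
  · exact key l' l (H.perm (List.Perm.swap _ _ _)) h4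

end SimpleGraph

/-! ### Minimal degree one, complete graphs and 2-regular graphs -/

namespace SimpleGraph

variable {V : Type*} {G : SimpleGraph V}

theorem Connected.mem_of_forall_adj (hG : G.Connected) {S : Set V} {v : V} (hv : v ∈ S)
    (hS : ∀ a ∈ S, ∀ b, G.Adj a b → b ∈ S) (w : V) : w ∈ S := by
  obtain ⟨p⟩ := hG.preconnected v w
  induction p with
  | nil => exact hv
  | cons h _ ih => exact ih (hS _ hv _ h)

theorem Connected.card_le_of_forall_adj (hG : G.Connected) {S : Finset V} {v : V} (hv : v ∈ S)
    (hS : ∀ a ∈ S, ∀ b, G.Adj a b → b ∈ S) : ENat.card V ≤ S.card := by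
  have h : ∀ w, w ∈ S := hG.mem_of_forall_adj (S := ↑S) hv hS
  calc ENat.card V = (Set.univ : Set V).encard := by simp
    _ ≤ (S : Set V).encard := Set.encard_le_encard fun w _ ↦ h w
    _ = S.card := Set.encard_coe_eq_coe_finsetCard S

/-- The only edge at the leaf `r` gets colour 0. Any other leaf at distance at least two is the
start of a path of siblings, since it has no adjacent sibling as predecessor, so its edge has
positive colour. Hence `r` is fixed, and then so is its neighbour. -/
theorem distinguishingIndex_le_of_leaf [G.LocallyFinite] {n : ℕ} (hn : 2 < n) (hG : G.Connected)
    (hfree : G.IndFree (star n)) (hcard : 6 ≤ ENat.card V) {r x : V}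
    (hr : ∀ y, G.Adj r y ↔ y = x) : G.distinguishingIndex ≤ ((n - 1 : ℕ) : ℕ∞) := by
  classical
  have hrx : G.Adj r x := (hr x).2 rfl
  obtain ⟨par, hp⟩ := hG.exists_isParent r
  have hex : ∀ v, ∃ gh : (V → ℕ) × (V → V → ℕ), v ≠ r →
      IsPathColouring G (children r par v) (n - 2) gh.1 gh.2 := by
    intro v
    by_cases hv : v = r
    · exact ⟨⟨0, 0⟩, fun h ↦ absurd hv h⟩
    · obtain ⟨g, h, H⟩ := hp.exists_isPathColouring hG hfree hn hv
      exact ⟨⟨g, h⟩, fun _ ↦ H⟩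
  choose gh hgh using hex
  let g : V → V → ℕ := fun v ↦ if v = r then 0 else (gh v).1
  let h : V → V → V → ℕ := fun v ↦ if v = r then 0 else (gh v).2
  have hg : ∀ v, v ≠ r → IsPathColouring G (children r par v) (n - 2) (g v) (h v) := fun v hv ↦ by
    simpa only [g, h, if_neg hv] using hgh v hv
  have hgr : ∀ y, g r y = 0 := fun y ↦ by simp [g]
  have hhr : ∀ y z, h r y z = 0 := fun y z ↦ by simp [h]
  have hglt : ∀ v y, g v y < n - 1 := fun v y ↦ by
    by_cases hv : v = r
    · rw [hv, hgr]
      omega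
    · have := (hg v hv).le y
      omega
  refine distinguishingIndex_le_of_colouring (treeColouring r par g h fun _ _ ↦ 0)
    (fun v w _ ↦ treeColouring_comm hp (fun u v w ↦ ?_) (fun _ _ ↦ rfl) v w) (fun v w _ ↦ ?_)
    fun φ hφ ↦ ?_
  · by_cases hu : u = r
    · rw [hu, hhr, hhr]
    · exact (hg u hu).symm v w
  · have hle : h (par v) v w ≤ 1 := by
      by_cases hu : par v = r
      · rw [hu, hhr]
        exact zero_le_one
      · exact (hg _ hu).le_one v w
    have h1 := hglt v w
    have h2 := hglt w v
    unfold treeColouring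
    split_ifs <;> grind
  have hxr : x ∈ children r par r := (mem_children_root hG hp).2 hrx
  have hleaf : ∀ y, G.Adj (φ r) y → y = φ x := fun y hy ↦ by
    rw [← (hr (φ.symm y)).1 (by rw [← φ.map_adj_iff]; simpa using hy)]
    simp
  have hφr : φ r = r := by
    by_contra hne
    have hadj := hp.adj _ hne
    have hpar := hleaf _ hadj.symm
    have hcol := hφ _ _ hrx
    rw [treeColouring_child hxr, hgr, ← hpar,
      treeColouring_comm hp (fun u v w ↦ ?_) (fun _ _ ↦ rfl),
      treeColouring_child (⟨hne, rfl⟩ : φ r ∈ children r par (par (φ r)))] at hcol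
    · by_cases hpr : par (φ r) = r
      · rw [hpr] at hadj
        have hrx' := (hr _).1 hadj
        have hφx : φ x = r := hpar.symm.trans hpr
        have := hG.card_le_of_forall_adj (S := {r, x}) (v := r) (by simp) (by
          intro a ha b hab
          simp only [Finset.mem_insert, Finset.mem_singleton] at ha ⊢
          rcases ha with rfl | rfl
          · exact Or.inr ((hr b).1 hab)
          · rw [← hrx'] at hab
            exact Or.inl ((hleaf b hab).trans hφx))
        have h2 : (({r, x} : Finset V).card : ℕ∞) ≤ 2 := by exact_mod_cast Finset.card_le_two
        exact absurd (hcard.trans (this.trans h2)) (by norm_num)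
      · obtain ⟨rank, hrank⟩ := (hg _ hpr).next
        obtain ⟨z, hz, -, hzr, -⟩ := hrank _ ⟨hne, rfl⟩ hcol
        have := hleaf _ hzr.symm
        rw [← hpar] at this
        exact (hp.adj_of_mem hz).ne this.symm
    · by_cases hu : u = r
      · rw [hu, hhr, hhr]
      · exact (hg u hu).symm v w
  refine eq_of_fixes_neighbors hG hp φ hφ hφr (fun y hy ↦ ?_) fun v hv ↦ (hg v hv).rigidOn
  rw [(hr y).1 hy]
  have : G.Adj (φ r) (φ x) := φ.map_adj_iff.2 hrx
  rw [hφr] at this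
  exact (hr _).1 this

/-- Adjacency in the path with vertices `0, 1, 2, …` and the additional edge from `1` to `3`. -/
def PathChord (i j : ℕ) : Prop :=
  i + 1 = j ∨ j + 1 = i ∨ i = 1 ∧ j = 3 ∨ i = 3 ∧ j = 1

theorem PathChord.symm {i j : ℕ} (h : PathChord i j) : PathChord j i := by
  unfold PathChord at *
  omega

/-- The graph is a triangle `1, 2, 3` with a pendant vertex 0 at 1 and a path of length at least two
at 3. Only 0 has degree one and a neighbour of degree three; the other vertices are then fixed one
after another. -/
theorem eq_of_preserves_pathChord {N : ℕ} (hN : 6 ≤ N) (σ : Equiv.Perm (Fin N))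
    (hσ : ∀ i j, PathChord (σ i) (σ j) ↔ PathChord (i : ℕ) j) (i : Fin N) : σ i = i := by
  have hinj : ∀ {i j : ℕ} (hi : i < N) (hj : j < N), i ≠ j →
      (σ ⟨i, hi⟩ : ℕ) ≠ σ ⟨j, hj⟩ := fun hi hj hij h ↦
    hij (congrArg Fin.val (σ.injective (Fin.ext h)))
  have hP : ∀ {i j : ℕ} (hi : i < N) (hj : j < N), PathChord i j →
      PathChord (σ ⟨i, hi⟩) (σ ⟨j, hj⟩) := fun hi hj h ↦ (hσ ⟨_, hi⟩ ⟨_, hj⟩).2 h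
  have h01 := hP (i := 0) (j := 1) (by omega) (by omega) (by unfold PathChord; omega)
  have h12 := hP (i := 1) (j := 2) (by omega) (by omega) (by unfold PathChord; omega)
  have h13 := hP (i := 1) (j := 3) (by omega) (by omega) (by unfold PathChord; omega)
  have h34 := hP (i := 3) (j := 4) (by omega) (by omega) (by unfold PathChord; omega)
  have n02 := hinj (i := 0) (j := 2) (by omega) (by omega) (by omega)
  have n03 := hinj (i := 0) (j := 3) (by omega) (by omega) (by omega)
  have n23 := hinj (i := 2) (j := 3) (by omega) (by omega) (by omega)
  have n14 := hinj (i := 1) (j := 4) (by omega) (by omega) (by omega)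
  have n24 := hinj (i := 2) (j := 4) (by omega) (by omega) (by omega)
  have hleaf : ∀ j : Fin N, PathChord (σ ⟨0, by omega⟩) j → j = σ ⟨1, by omega⟩ := by
    intro j hj
    have := (hσ ⟨0, by omega⟩ (σ.symm j)).1 (by simpa using hj)
    rw [← σ.apply_symm_apply j]
    congr 1
    ext
    unfold PathChord at this
    simp only at this ⊢
    omega
  have h0 : (σ ⟨0, by omega⟩ : ℕ) = 0 := by
    by_contra hne
    have hlt := (σ ⟨0, by omega⟩).2
    have h1lt := (σ ⟨1, by omega⟩).2
    have ha := hleaf ⟨(σ ⟨0, by omega⟩ : ℕ) - 1, by omega⟩ (by unfold PathChord; simp only; omega)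
    have ha' := congrArg Fin.val ha
    simp only at ha'
    by_cases hlast : (σ ⟨0, by omega⟩ : ℕ) + 1 < N
    · have hb := hleaf ⟨(σ ⟨0, by omega⟩ : ℕ) + 1, hlast⟩ (Or.inl rfl)
      have hb' := congrArg Fin.val hb
      simp only at hb'
      omega
    · have l2 := (σ ⟨2, by omega⟩).2
      have l3 := (σ ⟨3, by omega⟩).2
      unfold PathChord at h01 h12 h13
      omega
  have h1 : (σ ⟨1, by omega⟩ : ℕ) = 1 := by
    unfold PathChord at h01
    omega
  have n13 := hinj (i := 1) (j := 3) (by omega) (by omega) (by omega)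
  have n12 := hinj (i := 1) (j := 2) (by omega) (by omega) (by omega)
  have h2 : (σ ⟨2, by omega⟩ : ℕ) = 2 := by
    unfold PathChord at h12 h13 h34
    omega
  have h3 : (σ ⟨3, by omega⟩ : ℕ) = 3 := by
    unfold PathChord at h13
    omega
  suffices H : ∀ k (hk : k < N), (σ ⟨k, hk⟩ : ℕ) = k from Fin.ext (H i i.2)
  intro k
  induction k using Nat.strong_induction_on with
  | _ k ih =>
    intro hk
    by_cases hk3 : k ≤ 3
    · interval_cases k <;> assumption
    · have hkk := hP (i := k - 1) (j := k) (by omega) hk (by unfold PathChord; omega)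
      have ha := ih (k - 1) (by omega) (by omega)
      have hb := hinj (i := k - 2) (j := k) (by omega) hk (by omega)
      have hc := ih (k - 2) (by omega) (by omega)
      have hd := hinj (i := 1) (j := k) (by omega) hk (by omega)
      unfold PathChord at hkk
      omega

/-- Two colours on a complete graph amount to a graph on the same vertices, so an asymmetric graph
suffices. -/
theorem distinguishingIndex_le_of_complete [G.LocallyFinite] {n : ℕ} (hn : 2 < n)
    (hcard : 6 ≤ ENat.card V) (hG : ∀ v w, v ≠ w → G.Adj v w) :
    G.distinguishingIndex ≤ ((n - 1 : ℕ) : ℕ∞) := by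
  classical
  have hne : Nonempty V := by
    by_contra h
    rw [(ENat.card_eq_zero_iff_empty V).2 (not_nonempty_iff.1 h)] at hcard
    simp at hcard
  obtain ⟨v⟩ := hne
  have hfin : Finite V := by
    refine Set.finite_univ_iff.1 (((Set.toFinite (G.neighborSet v)).insert v).subset fun w _ ↦ ?_)
    rcases eq_or_ne w v with h | h
    · exact Or.inl h
    · exact Or.inr (hG v w h.symm)
  have := Fintype.ofFinite V
  obtain ⟨N, ⟨e⟩⟩ := Finite.exists_equiv_fin V
  have hN : 6 ≤ N := by
    rw [ENat.card_congr e] at hcard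
    simpa using hcard
  refine distinguishingIndex_le_of_colouring (fun v w ↦ if PathChord (e v) (e w) then 1 else 0)
    (fun v w _ ↦ ?_) (fun v w _ ↦ ?_) fun φ hφ v ↦ ?_
  · have : PathChord (e v) (e w) ↔ PathChord (e w) (e v) := ⟨PathChord.symm, PathChord.symm⟩
    simp only [this]
  · split_ifs <;> omega
  · have := eq_of_preserves_pathChord hN ((e.symm.trans φ.toEquiv).trans e) (fun i j ↦ ?_) (e v)
    · simpa using this
    · rcases eq_or_ne i j with rfl | hij
      · unfold PathChord
        omega
      have := hφ _ _ (hG (e.symm i) (e.symm j) (e.symm.injective.ne hij))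
      simp only [Equiv.apply_symm_apply] at this
      simp only [Equiv.trans_apply]
      change PathChord (e (φ (e.symm i))) (e (φ (e.symm j))) ↔ _
      split_ifs at this <;> simp_all

theorem exists_other_neighbor [G.LocallyFinite] {v a : V} (hv : G.degree v = 2) (ha : G.Adj v a) :
    ∃ b, b ≠ a ∧ ∀ x, G.Adj v x ↔ x = a ∨ x = b := by
  classical
  rw [← card_neighborFinset_eq_degree, Finset.card_eq_two] at hv
  obtain ⟨p, q, hpq, h⟩ := hv
  have hx : ∀ x, G.Adj v x ↔ x = p ∨ x = q := fun x ↦ by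
    rw [← mem_neighborFinset, h]
    simp
  rcases (hx a).1 ha with rfl | rfl
  · exact ⟨q, hpq.symm, hx⟩
  · exact ⟨p, hpq, fun x ↦ (hx x).trans or_comm⟩

/-- The graph is a cycle or a two-way infinite path. Of the zero edges `v0v1`, `v1v2`, `v3v4`, two
meet only at `v1`. A third one begins one step beyond `v2` but not one step beyond `v0`, because six
vertices ensure `v5 ≠ v0`. So `v1` and its neighbours are fixed, and this propagates. -/
theorem distinguishingIndex_le_of_degree_eq_two [G.LocallyFinite] {n : ℕ} (hn : 2 < n)
    (hG : G.Connected) (hcard : 6 ≤ ENat.card V) (h2 : ∀ v, G.degree v = 2) :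
    G.distinguishingIndex ≤ ((n - 1 : ℕ) : ℕ∞) := by
  classical
  have hbig : ∀ (l : List V) (v : V), v ∈ l → l.length ≤ 5 →
      ¬ ∀ a ∈ l, ∀ b, G.Adj a b → b ∈ l := by
    intro l v hv hl h
    have h1 := hG.card_le_of_forall_adj (S := l.toFinset) (v := v)
      (by simpa using hv) (by simpa using h)
    have h3 : ((l.toFinset.card : ℕ) : ℕ∞) ≤ (5 : ℕ) := by
      exact_mod_cast (List.toFinset_card_le l).trans hl
    exact absurd (hcard.trans (h1.trans h3)) (by norm_num)
  obtain ⟨v1⟩ := hG.nonempty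
  obtain ⟨v0, h10⟩ : ∃ v0, G.Adj v1 v0 := (G.degree_pos_iff_exists_adj v1).1 (by rw [h2]; omega)
  obtain ⟨v2, h20, hv1⟩ := exists_other_neighbor (h2 v1) h10
  obtain ⟨v3, h31, hv2⟩ := exists_other_neighbor (h2 v2) ((hv1 v2).2 (Or.inr rfl)).symm
  obtain ⟨v4, h42, hv3⟩ := exists_other_neighbor (h2 v3) ((hv2 v3).2 (Or.inr rfl)).symm
  obtain ⟨v5, h53, hv4⟩ := exists_other_neighbor (h2 v4) ((hv3 v4).2 (Or.inr rfl)).symm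
  obtain ⟨w, hw1, hv0⟩ := exists_other_neighbor (h2 v0) h10.symm
  have n01 := h10.ne'
  have n12 := ((hv1 v2).2 (Or.inr rfl)).ne
  have n23 := ((hv2 v3).2 (Or.inr rfl)).ne
  have n34 := ((hv3 v4).2 (Or.inr rfl)).ne
  have n30 : v3 ≠ v0 := by
    rintro rfl
    refine hbig [v1, v2, v3] v1 (by simp) (by simp) ?_
    have := (hv3 v1).1 h10.symm
    grind
  have n14 : v4 ≠ v1 := by
    rintro rfl
    have := (hv1 v3).1 ((hv3 v4).2 (Or.inr rfl)).symm
    grind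
  have n40 : v4 ≠ v0 := by
    rintro rfl
    refine hbig [v1, v2, v3, v4] v1 (by simp) (by simp) ?_
    have := (hv4 v1).1 h10.symm
    grind
  have n50 : v5 ≠ v0 := by
    rintro rfl
    refine hbig [v1, v2, v3, v4, v5] v1 (by simp) (by simp) ?_
    have := (hv0 v4).1 ((hv4 v5).2 (Or.inr rfl)).symm
    grind
  let Z : V → V → Prop := fun a b ↦ a = v0 ∧ b = v1 ∨ a = v1 ∧ b = v2 ∨ a = v3 ∧ b = v4
  refine distinguishingIndex_le_of_colouring (fun v w ↦ if Z v w ∨ Z w v then 0 else 1)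
    (fun v w _ ↦ ?_) (fun v w _ ↦ ?_) fun φ hφ ↦ ?_
  · simp only [or_comm]
  · split_ifs <;> omega
  have hZ : ∀ a b, G.Adj a b → Z a b → Z (φ a) (φ b) ∨ Z (φ b) (φ a) := by
    intro a b hab h
    have := hφ a b hab
    simp only [if_pos (Or.inl h : Z a b ∨ Z b a)] at this
    by_contra h'
    simp [if_neg h'] at this
  have z0 := hZ v0 v1 h10.symm (Or.inl ⟨rfl, rfl⟩)
  have z1 := hZ v1 v2 ((hv1 v2).2 (Or.inr rfl)) (Or.inr (Or.inl ⟨rfl, rfl⟩))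
  have z3 := hZ v3 v4 ((hv3 v4).2 (Or.inr rfl)) (Or.inr (Or.inr ⟨rfl, rfl⟩))
  have i02 := φ.injective.ne h20.symm
  have i01 := φ.injective.ne n01
  have i12 := φ.injective.ne n12
  have i13 := φ.injective.ne h31
  have a23 : G.Adj (φ v2) (φ v3) := φ.map_adj_iff.2 ((hv2 v3).2 (Or.inr rfl))
  simp only [Z] at z0 z1 z3
  have f1 : φ v1 = v1 := by grind
  have f2 : φ v2 = v2 := by
    by_contra hne
    have e2 : φ v2 = v0 := by grind
    rw [e2] at a23
    have b2 : ¬ G.Adj v0 v2 := fun h ↦ by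
      have := (hv2 v0).1 h.symm
      grind
    have b3 : ¬ G.Adj v0 v3 := fun h ↦ by
      have := (hv3 v0).1 h.symm
      grind
    have b4 : ¬ G.Adj v0 v4 := fun h ↦ by
      have := (hv4 v0).1 h.symm
      grind
    have b0 : ¬ G.Adj v0 v0 := G.irrefl
    grind
  have f0 : φ v0 = v0 := by grind
  have H := hG.mem_of_forall_adj (S := {v | φ v = v ∧ ∀ x, G.Adj v x → φ x = x}) (v := v1)
    ⟨f1, fun x hx ↦ by rcases (hv1 x).1 hx with rfl | rfl <;> assumption⟩ (by
      rintro a ⟨ha, hax⟩ b hab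
      have hb := hax b hab
      refine ⟨hb, fun x hbx ↦ ?_⟩
      obtain ⟨u, hua, hbu⟩ := exists_other_neighbor (h2 b) hab.symm
      have hux : φ u = u := by
        have h1 : G.Adj (φ b) (φ u) := φ.map_adj_iff.2 ((hbu u).2 (Or.inr rfl))
        rw [hb] at h1
        rcases (hbu _).1 h1 with h | h
        · exact absurd (φ.injective (h.trans ha.symm)) hua
        · exact h
      rcases (hbu x).1 hbx with rfl | rfl
      · exact ha
      · exact hux)
  exact fun v ↦ (H v).1

end SimpleGraph

/-! ### Choice of the root and conclusion -/

namespace SimpleGraph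

variable {V : Type*} {G : SimpleGraph V} {r : V} {n : ℕ}

theorem upper_eq_empty_of_twin {t : V} (h : ∀ c, c ≠ r → c ≠ t → (G.Adj r c ↔ G.Adj t c)) :
    upper G r t = ∅ := by
  refine Set.eq_empty_iff_forall_notMem.2 fun c hc ↦ ?_
  have hcr : c ≠ r := by
    rintro rfl
    have := hc.2
    simp at this
  have := hc.2
  rw [dist_eq_one_iff_adj.2 ((h c hcr hc.1.ne').2 hc.1)] at this
  omega

variable [G.LocallyFinite]

/-- Otherwise connectedness leaves only `r` and its neighbours, and `adj_of_upper_eq_empty` makes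
the graph complete. -/
theorem exists_upper_nonempty (hG : G.Connected) (hmin : ∀ v, G.degree r ≤ G.degree v)
    (hd : 2 ≤ G.degree r) (hnc : ¬ ∀ v w, v ≠ w → G.Adj v w) :
    ∃ x, G.Adj r x ∧ (upper G r x).Nonempty := by
  by_contra! h
  refine hnc ?_
  have hall : ∀ v, v ∈ {v | v = r ∨ G.Adj r v} := by
    refine hG.mem_of_forall_adj (v := r) (Or.inl rfl) ?_
    rintro a (rfl | ha) b hab
    · exact Or.inr hab
    by_contra hb
    simp only [Set.mem_ofPred_eq, not_or] at hb
    have h1 := hG.dist_le_of_adj r hab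
    rw [dist_eq_one_iff_adj.2 ha] at h1
    have h0 : G.dist r b ≠ 0 := fun h ↦ hb.1 (hG.dist_eq_zero_iff.1 h).symm
    have h2 : G.dist r b ≠ 1 := fun h ↦ hb.2 (dist_eq_one_iff_adj.1 h)
    have : b ∈ upper G r a := ⟨hab, by omega⟩
    rw [h a ha] at this
    exact this
  intro v w hvw
  rcases hall v with hv | hv
  · rcases hall w with hw | hw
    · exact absurd (hv.trans hw.symm) hvw
    · rwa [hv]
  · rcases hall w with hw | hw
    · rw [hw]
      exact hv.symm
    · exact adj_of_upper_eq_empty hG hmin hv (h v hv) hw hvw.symm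

/-- A vertex of minimal degree with an adjacent twin is preferred as the root: the twin has no
neighbour at distance two. Without such twins, if the minimal degree is two, the root is taken next
to a vertex of larger degree, which exists by connectedness unless the graph is 2-regular. -/
theorem distinguishingIndex_le_of_minimal_degree (hn : 2 < n) (hG : G.Connected)
    (hfree : G.IndFree (star n)) (hcard : 6 ≤ ENat.card V) (hnc : ¬ ∀ v w, v ≠ w → G.Adj v w)
    (hmin : ∀ v, G.degree r ≤ G.degree v) (hd : 2 ≤ G.degree r) :
    G.distinguishingIndex ≤ ((n - 1 : ℕ) : ℕ∞) := by
  by_cases htw : ∃ a b, G.Adj a b ∧ G.degree a = G.degree r ∧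
      ∀ c, c ≠ a → c ≠ b → (G.Adj a c ↔ G.Adj b c)
  · obtain ⟨a, b, hab, ha, h⟩ := htw
    rw [← ha] at hmin hd
    have hb := upper_eq_empty_of_twin h
    obtain ⟨Pr, zs, os, H⟩ := exists_isLayout hn hG hfree hmin hd
      (exists_upper_nonempty hG hmin hd hnc) fun hup ↦ absurd hb (hup b hab).ne_empty
    exact H.distinguishingIndex_le hn hG hfree hmin hd (Or.inl ⟨b, hab, hb⟩)
  · have hntw : ∀ a b, G.Adj a b → G.degree a = G.degree r →
        ¬ ∀ c, c ≠ a → c ≠ b → (G.Adj a c ↔ G.Adj b c) := fun a b hab ha h ↦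
      htw ⟨a, b, hab, ha, h⟩
    by_cases h2 : ∀ v, G.degree v = 2
    · exact distinguishingIndex_le_of_degree_eq_two hn hG hcard h2
    have hs : ∃ s, G.degree s = G.degree r ∧
        (G.degree s = 2 → ∃ x, G.Adj s x ∧ 3 ≤ G.degree x) := by
      by_cases hr : G.degree r = 2
      · by_contra! h
        refine h2 (hG.mem_of_forall_adj (S := {v | G.degree v = 2}) hr fun a ha b hab ↦ ?_)
        have h3 := (h a (ha.trans hr.symm)).2 b hab
        have h4 := hmin b
        exact le_antisymm (by omega) (by omega)
      · exact ⟨r, rfl, fun h ↦ absurd h hr⟩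
    obtain ⟨s, hs, h3⟩ := hs
    rw [← hs] at hmin hd hntw
    obtain ⟨Pr, zs, os, H⟩ := exists_isLayout hn hG hfree hmin hd
      (exists_upper_nonempty hG hmin hd hnc) fun _ _ ↦ h3
    exact H.distinguishingIndex_le hn hG hfree hmin hd (Or.inr hntw)

end SimpleGraph

theorem theorem2 (n : ℕ) (hn : 2 < n) {V : Type*} (G : SimpleGraph V) [G.LocallyFinite]
    (hconn : G.Connected) (hfree : G.IndFree (SimpleGraph.star n)) (hcard : 6 ≤ ENat.card V) :
    G.distinguishingIndex ≤ ((n - 1 : ℕ) : ℕ∞) := by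
  by_cases hc : ∀ v w, v ≠ w → G.Adj v w
  · exact SimpleGraph.distinguishingIndex_le_of_complete hn hcard hc
  have := hconn.nonempty
  obtain ⟨r, hmin⟩ : ∃ r, ∀ v, G.degree r ≤ G.degree v :=
    ⟨Function.argmin fun v ↦ G.degree v, fun v ↦ Function.argmin_le (fun v ↦ G.degree v) v⟩
  rcases Nat.lt_or_ge (G.degree r) 2 with hlt | hge
  · have : Nontrivial V := by
      rw [← ENat.one_lt_card_iff_nontrivial]
      exact lt_of_lt_of_le (by norm_num) hcard
    have hpos := hconn.preconnected.degree_pos_of_nontrivial r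
    obtain ⟨x, hx⟩ := Finset.card_eq_one.1 (show (G.neighborFinset r).card = 1 by
      rw [SimpleGraph.card_neighborFinset_eq_degree]
      omega)
    refine SimpleGraph.distinguishingIndex_le_of_leaf hn hconn hfree hcard (r := r) (x := x)
      fun y ↦ ?_
    rw [← SimpleGraph.mem_neighborFinset, hx, Finset.mem_singleton]
  · exact SimpleGraph.distinguishingIndex_le_of_minimal_degree hn hconn hfree hcard hc hmin hge
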